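/- **Setting.** Let $\mathcal N$ be an infinite set of names. *Fusion processes.* Prefixes are $\alpha ::= u\vec x \mid \overline u\vec x \mid \phi$ (input, output, fusion), where $\phi$ is a finite set of equalities between names, standing for the equivalence relation it generates. Agents are $P ::= 0 \mid \sum_i\alpha_i.P_i \mid P_1|P_2 \mid (x)P \mid \mathrm{rec}\,X.P \mid X$; finite guarded sums are called sequential. A closed process is an agent without free names and free agent variables in which every recursion is guarded (in $\mathrm{rec}\,X.P$ each $X$ lies within a sequential agent). Structural congruence $\equiv$ is the least congruence containing $\alpha$-conversion, the abelian monoid laws of $|$ with unit $0$, irrelevance of the order of summands and of the way an equivalence $\phi$ is written (with the same names), $(x)0\equiv 0$, $(x)(y)P\equiv(y)(x)P$, $P|(z)Q\equiv(z)(P|Q)$ for $z\notin \mathrm{fn}(P)$, and $\mathrm{rec}\,X.P\equiv P\{\mathrm{rec}\,X.P/X\}$. A substitutive effect of $\phi$ is an idempotent substitution whose kernel is the equivalence generated by $\phi$. Reduction $\to$ is the least relation closed under $\equiv$ on both sides with $(\vec z)(R|(\dots+u\vec x.P)|(\overline u\vec y.Q+\dots))\to(\vec z)(R|P|Q)\sigma$,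 where $|\vec x|=|\vec y|$ and $\sigma$ is a substitutive effect of $\{\vec x=\vec y\}$ that moves only names of $\vec z$, and $(\vec z)(R|(\dots+\phi.P))\to(\vec z)(R|P)\sigma$, where $\sigma$ is a substitutive effect of $\phi$ that moves only names of $\vec z$. *HSHR.* A judgement $\Gamma\vdash G$ consists of a finite set $\Gamma$ of nodes and a finite multiset $G$ of labelled hyperedges on nodes in $\Gamma$; $\mathrm n(G)$ is the set of nodes occurring in $G$. A transition $\Gamma\vdash G\xrightarrow{\Lambda,\pi}\Phi\vdash G'$ has a function $\Lambda$ that assigns to each $x\in\Gamma$ an action and a vector $\mathrm n_\Lambda(x)$ of exposed names of the action's arity, and an idempotent $\pi:\Gamma\to\Gamma$ that fixes the exposed names in $\Gamma$; with $\Gamma_\Lambda$ the set of exposed names outside $\Gamma$, $\Phi\supseteq\Gamma\pi\cup\Gamma_\Lambda$ and $\Phi\setminus(\Gamma\pi\cup\Gamma_\Lambda)\subseteq \mathrm n(G')$. Transitions are derived from ($\alpha$-variants of) productions by: (par) parallel composition of two transitions with disjoint $\Gamma\cup\Phi$; (merge) for an idempotent $\sigma:\Gamma\to\Gamma$ identifying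 only nodes with equal actions, pass to $\Gamma\sigma\vdash G\sigma\xrightarrow{\Lambda',\pi'}\Phi'\vdash G'\sigma\rho$, where $\rho$ is a most general unifier of $\{\mathrm n_\Lambda(x)\sigma=\mathrm n_\Lambda(y)\sigma\mid x\sigma=y\sigma\}\cup\{x\sigma=y\sigma\mid x\pi=y\pi\}$ choosing representatives in $\Gamma\sigma$ whenever possible, $\Lambda'(z\sigma)=\Lambda(z)\sigma\rho$ and $\pi'=\rho|_{\Gamma\sigma}$; (idle) $\Gamma\vdash G\to\Gamma\vdash G$ with the idle action $\epsilon$ (of arity $0$) on every node and $\pi$ the identity; (new) add an isolated node $x\notin\Gamma\cup\Phi$ exposing any action with distinct names that are fresh for $\Gamma\cup\Phi\cup\{x\}$. The target nodes are determined by the conditions on transitions. *Translation.* Edge labels are $m_k$ ($k\ge2$, rank $k$), $n$ (rank $1$) and $L_{\hat S}$ of rank $k$, for each standard sequential process $\hat S$, i.e. one in which each of its free names $x_1,\dots,x_k$ occurs exactly once, in this order. Actions are $\epsilon$ and $in_k,out_k$ of arity $k$. For vectors $\vec v,\vec w$ of distinct names with $\vec v$, $\vec w$, $\mathrm{fn}(P)$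 pairwise disjoint, write $P\equiv(\vec v)(S_1|\dots|S_l)\sigma$ with $S_i$ sequential and the free names of $S_1|\dots|S_l$ occurring once each and listed by $\vec w$, and $S_i=\hat S_i\rho_i$ with $\hat S_i$ standard. Then $$\mathrm{fn}(P),\vec v,\vec w\;\vdash\;\prod_i L_{\hat S_i}(x_1,\dots,x_{k_i})\rho_i\;\Big|\;[\![\sigma]\!]\;\Big|\;\prod_{x\in\vec v}n(x)$$ is a translation $[\![P]\!]_{\vec v,\vec w}$ of $P$ with parameters $\vec v,\vec w$, where $\prod$ denotes parallel composition and $[\![\sigma]\!]=\prod_{x\in\sigma(\vec w)}m_{j+1}(x,y_1,\dots,y_j)$ with $y_1,\dots,y_j$ the names of $\vec w$ that $\sigma$ maps to $x$. Likewise $[\![\xi]\!]$ and $[\![\theta]\!]$ below are formed from the preimages of names under $\xi$ on its domain, and under $\theta$ on the names it moves. *Productions.* For each standard sequential $\sum_i\alpha_i.P_i$ with names $x_1,\dots,x_k$, each $j$, each injective renaming $\xi$ of $\mathrm{fn}(P_j)$ to fresh names and each translation $\Gamma\vdash G$ of $P_j\xi$ with parameters $\vec v,\vec w$ (where $\vec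 v\cup\vec w$, $\{x_1,\dots,x_k\}$, $\mathrm{fn}(P_j)\xi$ are pairwise disjoint) there is a process production $$x_1,\dots,x_k\vdash L_{\sum_i\alpha_i.P_i}(x_1,\dots,x_k)\xrightarrow{\Lambda,id}\Gamma,x_1,\dots,x_k\vdash G\,|\,[\![\xi]\!]\,|\,[\![\theta]\!]\,|\prod_{x}n(x),$$ where $\Lambda$ exposes $(in_{|\vec y|},\vec y)$ on $u$ if $\alpha_j=u\vec y$, $(out_{|\vec y|},\vec y)$ on $u$ if $\alpha_j=\overline u\vec y$, and $\epsilon$ on all other nodes; $\theta$ is a substitutive effect of $\alpha_j$ if $\alpha_j$ is a fusion and the identity otherwise; the last product ranges over those of the $x_i$ that are not exposed, not fused with another $x_{i'}$ by $\theta$, and not in $\mathrm{fn}(P_j)$. It is a communication production if $\alpha_j$ is an input or output, and a fusion production if $\alpha_j$ is a fusion. The auxiliary productions let an edge $m_k$ on distinct nodes expose $(in_l,\vec y)$ on one node and $(out_l,\vec z)$ on a different one, $\epsilon$ elsewhere, with $\vec y,\vec z$ vectors of $l$ distinct fresh names each, disjoint from each other, and add the edges $m_2(y_i,z_i)$, $i=1,\dots,l$,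 the edge $m_k$ being kept and $\pi$ being the identity. Edges $n$ have no productions. *Amoeboids.* A structured amoeboid with set $S$ of external nodes is a nonempty connected graph of $m$ and $n$ edges containing $S$, in which the nodes of $S$ are attached to exactly one edge, all other (internal) nodes to exactly two edges, and each path (with distinct nodes and distinct edges) between two different nodes of $S$ has an odd number of edges. It is simple if it is a single edge $m_k$ on distinct nodes, all external. A pseudoamoeboid is a structured amoeboid with $S=\emptyset$ that shares no node with the rest of the graph. **Theorem (Completeness).** Let $P$ be a closed Fusion process, let $[\![P]\!]_{\vec v,\vec w}$ be a translation of $P$, and let $$[\![P]\!]_{\vec v,\vec w}\xrightarrow{\Lambda,\pi}\Gamma\vdash G$$ be an HSHR transition with a derivation that uses either exactly two communication productions and no fusion production, or exactly one fusion production and no communication production, together with any number of auxiliary productions. Then there is a process $P'$ with $P\to P'$ such that, for some $\vec{v'},\vec{w'}$, $\Gamma\vdash G$ is equal to a translation $[\![P']\!]_{\vec{v'},\vec{w'}}$ up to isolated nodes, injective renaming, equivalence of amoeboids ($G$ may have a structured amoeboid where the translation has a simple one with the same external nodes, the internal nodes not being used elsewhere) and pseudoamoeboids (which $G$ may have in addition).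 -/

import Mathlib

namespace FusionSHR

/-! ## Substitutive effects (most general unifiers of sets of equations between names) -/

/-- `σ` is an idempotent substitution whose kernel is the equivalence generated by `E`. -/
def IsSubstEffect {N : Type} (E : N → N → Prop) (σ : N → N) : Prop :=
  (∀ x, σ (σ x) = σ x) ∧ ∀ x y, σ x = σ y ↔ Relation.EqvGen E x y

/-- The relation given by a finite list of equations. -/
def listRel {V : Type} (φ : List (V × V)) (x y : V) : Prop := (x, y) ∈ φ

/-! ## The Fusion Calculus -/

/-- Prefixes over a type `V` of names. A fusion is written as a list of equalities; it stands for
the equivalence generated by them. -/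
inductive Prefix (V : Type) : Type
  | inp (u : V) (xs : List V) : Prefix V
  | out (u : V) (xs : List V) : Prefix V
  | fus (φ : List (V × V)) : Prefix V

namespace Prefix

def map {V V' : Type} (f : V → V') : Prefix V → Prefix V'
  | inp u xs => inp (f u) (xs.map f)
  | out u xs => out (f u) (xs.map f)
  | fus φ => fus (φ.map fun p => (f p.1, f p.2))

/-- The name occurrences of a prefix, from left to right. -/
def occ {V : Type} : Prefix V → List V
  | inp u xs => u :: xs
  | out u xs => u :: xs
  | fus φ => φ.flatMap fun p => [p.1, p.2]

/-- The equations imposed by a prefix: none for a communication prefix. -/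
def eqs {V : Type} : Prefix V → List (V × V)
  | inp _ _ => []
  | out _ _ => []
  | fus φ => φ

/-- Two ways of writing the same prefix: fusions are equivalence relations, so only the equivalence
generated by the equalities (and which names are written) matters. -/
inductive Same {V : Type} : Prefix V → Prefix V → Prop
  | refl (α : Prefix V) : Same α α
  | fus (φ ψ : List (V × V)) :
      (∀ x, x ∈ (Prefix.fus φ).occ ↔ x ∈ (Prefix.fus ψ).occ) →
      (∀ x y, Relation.EqvGen (listRel φ) x y ↔ Relation.EqvGen (listRel ψ) x y) →
      Same (Prefix.fus φ) (Prefix.fus ψ)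

end Prefix

/-- Agents up to alpha-conversion, with free names in `V` and free agent variables in `W`.
A binder adds one element (`none`) to the type of names, respectively of agent variables.
`sum m α P` is the guarded sum of the `m` summands `α i . P i`. -/
inductive Agent : Type → Type → Type 1
  | nil {V W : Type} : Agent V W
  | sum {V W : Type} (m : ℕ) (α : Fin m → Prefix V) (P : Fin m → Agent V W) : Agent V W
  | par {V W : Type} (P Q : Agent V W) : Agent V W
  | scope {V W : Type} (P : Agent (Option V) W) : Agent V W
  | fix {V W : Type} (P : Agent V (Option W)) : Agent V W
  | var {V W : Type} (X : W) : Agent V W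

namespace Agent

/-- Capture-free substitution of names for names. -/
def mapName : {V W : Type} → Agent V W → {V' : Type} → (V → V') → Agent V' W
  | _, _, nil, _, _ => nil
  | _, _, sum m α P, _, f => sum m (fun i => (α i).map f) (fun i => (P i).mapName f)
  | _, _, par P Q, _, f => par (P.mapName f) (Q.mapName f)
  | _, _, scope P, _, f => scope (P.mapName (Option.map f))
  | _, _, fix P, _, f => fix (P.mapName f)
  | _, _, var X, _, _ => var X

/-- Renaming of agent variables. -/
def mapVar : {V W : Type} → Agent V W → {W' : Type} → (W → W') → Agent V W'
  | _, _, nil, _, _ => nil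
  | _, _, sum m α P, _, g => sum m α (fun i => (P i).mapVar g)
  | _, _, par P Q, _, g => par (P.mapVar g) (Q.mapVar g)
  | _, _, scope P, _, g => scope (P.mapVar g)
  | _, _, fix P, _, g => fix (P.mapVar (Option.map g))
  | _, _, var X, _, g => var (g X)

/-- Capture-free substitution of agents for agent variables. -/
def bind : {V W : Type} → Agent V W → {W' : Type} → (W → Agent V W') → Agent V W'
  | _, _, nil, _, _ => nil
  | _, _, sum m α P, _, s => sum m α (fun i => (P i).bind s)
  | _, _, par P Q, _, s => par (P.bind s) (Q.bind s)
  | _, _, scope P, _, s => scope (P.bind fun X => (s X).mapName some)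
  | _, _, fix P, _, s => fix (P.bind fun o =>
      match o with
      | none => var none
      | some X => (s X).mapVar some)
  | _, _, var X, _, s => s X

/-- `P{rec X.P / X}`. -/
def unfold {V W : Type} (P : Agent V (Option W)) : Agent V W :=
  P.bind fun o =>
    match o with
    | none => fix P
    | some X => var X

/-- The occurrences of free names in an agent, from left to right. -/
def occ : {V W : Type} → Agent V W → List V
  | _, _, nil => []
  | _, _, sum m α P => (List.finRange m).flatMap fun i => (α i).occ ++ (P i).occ
  | _, _, par P Q => P.occ ++ Q.occ
  | _, _, scope P => P.occ.filterMap id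
  | _, _, fix P => P.occ
  | _, _, var _ => []

/-- The free names. -/
def fn {N W : Type} [DecidableEq N] (P : Agent N W) : Finset N := P.occ.toFinset

/-- The agent variable `X` has a free occurrence that is not within a sequential agent. -/
def UnguardedVar : {V W : Type} → Agent V W → W → Prop
  | _, _, nil, _ => False
  | _, _, sum _ _ _, _ => False
  | _, _, par P Q, X => P.UnguardedVar X ∨ Q.UnguardedVar X
  | _, _, scope P, X => P.UnguardedVar X
  | _, _, fix P, X => P.UnguardedVar (some X)
  | _, _, var Y, X => Y = X

/-- Every recursion is guarded. -/
def Guarded : {V W : Type} → Agent V W → Prop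
  | _, _, nil => True
  | _, _, sum _ _ P => ∀ i, (P i).Guarded
  | _, _, par P Q => P.Guarded ∧ Q.Guarded
  | _, _, scope P => P.Guarded
  | _, _, fix P => ¬ P.UnguardedVar none ∧ P.Guarded
  | _, _, var _ => True

/-- Sequential agents: the guarded sums. -/
def IsSequential {V W : Type} (S : Agent V W) : Prop := ∃ m α P, S = sum m α P

/-- The scope `(x) P` of a named free name `x`. -/
def res {N W : Type} [DecidableEq N] (x : N) (P : Agent N W) : Agent N W :=
  scope (P.mapName fun y => if y = x then none else some y)

/-- `(x₁) … (xₙ) P`. -/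
def resList {N W : Type} [DecidableEq N] (xs : List N) (P : Agent N W) : Agent N W :=
  xs.foldr res P

/-- `P₁ | … | Pₙ`. -/
def parList {V W : Type} (Ps : List (Agent V W)) : Agent V W := Ps.foldr par nil

end Agent

open Agent in
/-- Structural congruence. Alpha-conversion is built into the representation. -/
inductive Cong : {V W : Type} → Agent V W → Agent V W → Prop
  | refl {V W : Type} (P : Agent V W) : Cong P P
  | symm {V W : Type} {P Q : Agent V W} : Cong P Q → Cong Q P
  | trans {V W : Type} {P Q R : Agent V W} : Cong P Q → Cong Q R → Cong P R
  | sum {V W : Type} (m : ℕ) (α β : Fin m → Prefix V) (P Q : Fin m → Agent V W) :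
      (∀ i, (α i).Same (β i)) → (∀ i, Cong (P i) (Q i)) → Cong (sum m α P) (sum m β Q)
  | par {V W : Type} {P P' Q Q' : Agent V W} :
      Cong P P' → Cong Q Q' → Cong (par P Q) (par P' Q')
  | scope {V W : Type} {P Q : Agent (Option V) W} : Cong P Q → Cong (scope P) (scope Q)
  | fix {V W : Type} {P Q : Agent V (Option W)} : Cong P Q → Cong (fix P) (fix Q)
  | sum_perm {V W : Type} (m : ℕ) (e : Equiv.Perm (Fin m)) (α : Fin m → Prefix V)
      (P : Fin m → Agent V W) :
      Cong (Agent.sum m α P) (Agent.sum m (α ∘ e) (P ∘ e))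
  | par_assoc {V W : Type} (P Q R : Agent V W) :
      Cong (Agent.par (Agent.par P Q) R) (Agent.par P (Agent.par Q R))
  | par_comm {V W : Type} (P Q : Agent V W) : Cong (Agent.par P Q) (Agent.par Q P)
  | par_nil {V W : Type} (P : Agent V W) : Cong (Agent.par P nil) P
  | scope_nil {V W : Type} :
      Cong (Agent.scope (nil : Agent (Option V) W)) (nil : Agent V W)
  | scope_comm {V W : Type} (P : Agent (Option (Option V)) W) :
      Cong (Agent.scope (Agent.scope P))
        (Agent.scope (Agent.scope (P.mapName fun o =>
          match o with
          | none => some none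
          | some none => none
          | some (some x) => some (some x))))
  | extrusion {V W : Type} (P : Agent V W) (Q : Agent (Option V) W) :
      Cong (Agent.par P (Agent.scope Q)) (Agent.scope (Agent.par (P.mapName some) Q))
  | unfold {V W : Type} (P : Agent V (Option W)) : Cong (Agent.fix P) P.unfold

open Agent in
/-- The reduction semantics. -/
inductive Red {N : Type} [DecidableEq N] : Agent N Empty → Agent N Empty → Prop
  | comm (z : List N) (R : Agent N Empty)
      (m : ℕ) (α : Fin m → Prefix N) (P : Fin m → Agent N Empty) (i : Fin m)
      (n : ℕ) (β : Fin n → Prefix N) (Q : Fin n → Agent N Empty) (j : Fin n)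
      (u : N) (xs ys : List N) (σ : N → N) :
      α i = Prefix.inp u xs → β j = Prefix.out u ys → xs.length = ys.length →
      IsSubstEffect (listRel (xs.zip ys)) σ → (∀ x, σ x ≠ x → x ∈ z) →
      Red (resList z (par R (par (sum m α P) (sum n β Q))))
        (resList z ((par R (par (P i) (Q j))).mapName σ))
  | fus (z : List N) (R : Agent N Empty)
      (m : ℕ) (α : Fin m → Prefix N) (P : Fin m → Agent N Empty) (i : Fin m)
      (φ : List (N × N)) (σ : N → N) :
      α i = Prefix.fus φ → IsSubstEffect (listRel φ) σ → (∀ x, σ x ≠ x → x ∈ z) →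
      Red (resList z (par R (sum m α P))) (resList z ((par R (P i)).mapName σ))
  | struct {P P' Q' Q : Agent N Empty} : Cong P P' → Red P' Q' → Cong Q' Q → Red P Q

/-! ## Synchronized hyperedge replacement with Hoare synchronization -/

/-- A ranked alphabet of edge labels. -/
class RankedAlphabet (LE : Type*) where
  rank : LE → ℕ

/-- A set of actions with arities and an idle action. -/
class ActionSet (Act : Type*) where
  ar : Act → ℕ
  eps : Act
  ar_eps : ar eps = 0

/-- A hyperedge `L(x₁,…,xₙ)`. -/
structure Edge (LE : Type*) (N : Type) [RankedAlphabet LE] where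
  label : LE
  nodes : List N
  rank_eq : nodes.length = RankedAlphabet.rank label

/-- Graph terms up to associativity, commutativity and identity of parallel composition:
finite multisets of edges, `+` is parallel composition and `0` is `nil`. -/
abbrev Graph (LE : Type*) (N : Type) [RankedAlphabet LE] := Multiset (Edge LE N)

section SHR

variable {LE : Type*} [RankedAlphabet LE] {Act : Type*} [ActionSet Act] {N : Type} [DecidableEq N]

/-- Application of a substitution to an edge. -/
def Edge.map (f : N → N) (e : Edge LE N) : Edge LE N where
  label := e.label
  nodes := e.nodes.map f
  rank_eq := by rw [List.length_map, e.rank_eq]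

/-- Application of a substitution to a graph. -/
def Graph.map (f : N → N) (G : Graph LE N) : Graph LE N := Multiset.map (Edge.map f) G

/-- The names occurring in a graph. -/
def Graph.names (G : Graph LE N) : Finset N :=
  (Multiset.bind G fun e => (e.nodes : Multiset N)).toFinset

/-- The data of a transition `Γ ⊢ G --Λ,π--> Φ ⊢ G'`; `Λ` and `π` are functions on `Γ`, their
values outside `Γ` play no role. -/
structure Transition (LE : Type*) [RankedAlphabet LE] (Act : Type*) (N : Type) where
  Γ : Finset N
  G : Graph LE N
  Λ : N → Act × List N
  π : N → N
  Φ : Finset N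
  G' : Graph LE N

namespace Transition

/-- `n(Λ)`: the exposed names. -/
def exposed (T : Transition LE Act N) : Finset N :=
  T.Γ.biUnion fun x => (T.Λ x).2.toFinset

/-- `Γπ ∪ Γ_Λ`: the representatives of the old nodes and the fresh exposed names. -/
def surviving (T : Transition LE Act N) : Finset N :=
  T.Γ.image T.π ∪ (T.exposed \ T.Γ)

/-- The conditions on a SHR transition. -/
structure IsSHR (T : Transition LE Act N) : Prop where
  source_wf : Graph.names T.G ⊆ T.Γ
  target_wf : Graph.names T.G' ⊆ T.Φ
  arity : ∀ x ∈ T.Γ, (T.Λ x).2.length = ActionSet.ar (T.Λ x).1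
  maps : ∀ x ∈ T.Γ, T.π x ∈ T.Γ
  idem : ∀ x ∈ T.Γ, T.π (T.π x) = T.π x
  exposed_repr : ∀ x ∈ T.exposed, x ∈ T.Γ → T.π x = x
  nodes_kept : T.surviving ⊆ T.Φ
  no_isolated : T.Φ \ T.surviving ⊆ Graph.names T.G'

/-- The conclusion of rule (par). -/
structure IsPar (T₁ T₂ T : Transition LE Act N) : Prop where
  disj : Disjoint (T₁.Γ ∪ T₁.Φ) (T₂.Γ ∪ T₂.Φ)
  nodes : T.Γ = T₁.Γ ∪ T₂.Γ
  source : T.G = T₁.G + T₂.G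
  label_left : ∀ x ∈ T₁.Γ, T.Λ x = T₁.Λ x ∧ T.π x = T₁.π x
  label_right : ∀ x ∈ T₂.Γ, T.Λ x = T₂.Λ x ∧ T.π x = T₂.π x
  target_nodes : T.Φ = T₁.Φ ∪ T₂.Φ
  target : T.G' = T₁.G' + T₂.G'

/-- The equations unified by rule (merge). -/
def mergeEqs (T : Transition LE Act N) (σ : N → N) (a b : N) : Prop :=
  (∃ x ∈ T.Γ, ∃ y ∈ T.Γ, σ x = σ y ∧ (a, b) ∈ ((T.Λ x).2.map σ).zip ((T.Λ y).2.map σ)) ∨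
    ∃ x ∈ T.Γ, ∃ y ∈ T.Γ, T.π x = T.π y ∧ a = σ x ∧ b = σ y

/-- The conclusion `T'` of rule (merge) applied to `T` with the idempotent substitution
`σ : Γ → Γ` (extended by the identity) and the most general unifier `ρ`. The nodes of the target
are determined by the conditions on SHR transitions. -/
structure IsMerge (σ ρ : N → N) (T T' : Transition LE Act N) : Prop where
  maps : ∀ x ∈ T.Γ, σ x ∈ T.Γ
  idem : ∀ x, σ (σ x) = σ x
  outside : ∀ x, x ∉ T.Γ → σ x = x
  same_action : ∀ x ∈ T.Γ, ∀ y ∈ T.Γ, σ x = σ y → x ≠ y → (T.Λ x).1 = (T.Λ y).1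
  mgu : IsSubstEffect (T.mergeEqs σ) ρ
  representatives : ∀ x, (∃ y ∈ T.Γ.image σ, ρ y = ρ x) → ρ x ∈ T.Γ.image σ
  nodes : T'.Γ = T.Γ.image σ
  source : T'.G = T.G.map σ
  label : ∀ z ∈ T.Γ, T'.Λ (σ z) = ((T.Λ z).1, (T.Λ z).2.map (ρ ∘ σ))
  fusion : ∀ x ∈ T'.Γ, T'.π x = ρ x
  target : T'.G' = T.G'.map (ρ ∘ σ)

/-- An instance of rule (idle). -/
structure IsIdle (T : Transition LE Act N) : Prop where
  label : ∀ x ∈ T.Γ, T.Λ x = (ActionSet.eps, []) ∧ T.π x = x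
  target_nodes : T.Φ = T.Γ
  target : T.G' = T.G

/-- The conclusion `T'` of rule (new): a fresh isolated node `x` exposes `a` with distinct fresh
names `ys`. -/
structure IsNew (x : N) (a : Act) (ys : List N) (T T' : Transition LE Act N) : Prop where
  node_fresh : x ∉ T.Γ ∪ T.Φ
  names_fresh : ∀ y ∈ ys, y ∉ T.Γ ∪ T.Φ ∪ {x}
  nodup : ys.Nodup
  nodes : T'.Γ = insert x T.Γ
  source : T'.G = T.G
  label_old : ∀ z ∈ T.Γ, T'.Λ z = T.Λ z ∧ T'.π z = T.π z
  label_new : T'.Λ x = (a, ys) ∧ T'.π x = x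
  target_nodes : T'.Φ = T.Φ ∪ {x} ∪ ys.toFinset
  target : T'.G' = T.G'

end Transition

/-- Derivability of transitions from a family of productions sorted by kind, with the rules for
Hoare synchronization. The multiset records the kinds of the production instances that are used. -/
inductive Derives {κ : Type} (Prods : κ → Transition LE Act N → Prop) :
    Multiset κ → Transition LE Act N → Prop
  | prod {k : κ} {T : Transition LE Act N} : Prods k T → T.IsSHR → Derives Prods {k} T
  | idle {T : Transition LE Act N} : T.IsIdle → T.IsSHR → Derives Prods 0 T
  | par {U₁ U₂ : Multiset κ} {T₁ T₂ T : Transition LE Act N} :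
      Derives Prods U₁ T₁ → Derives Prods U₂ T₂ → T₁.IsPar T₂ T → T.IsSHR →
      Derives Prods (U₁ + U₂) T
  | merge {U : Multiset κ} {T T' : Transition LE Act N} (σ ρ : N → N) :
      Derives Prods U T → Transition.IsMerge σ ρ T T' → T'.IsSHR → Derives Prods U T'
  | new {U : Multiset κ} {T T' : Transition LE Act N} (x : N) (a : Act) (ys : List N) :
      Derives Prods U T → Transition.IsNew x a ys T T' → T'.IsSHR → Derives Prods U T'

end SHR

/-! ## The translation of Fusion processes -/

/-- Edge labels: `m k` is the connector with `k + 2` tentacles, `n` closes a node, and `L k S` is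
the label of the standard sequential process `S`, whose free names `x₁, …, x_k` are the elements
of `Fin k`. -/
inductive Label : Type 1
  | m (k : ℕ) : Label
  | n : Label
  | L (k : ℕ) (S : Agent (Fin k) Empty) : Label

instance : RankedAlphabet Label where
  rank
    | Label.m k => k + 2
    | Label.n => 1
    | Label.L k _ => k

/-- Actions: no synchronization, and input and output of `k` names. -/
inductive Action : Type
  | eps : Action
  | inn (k : ℕ) : Action
  | out (k : ℕ) : Action

instance : ActionSet Action where
  ar
    | Action.eps => 0
    | Action.inn k => k
    | Action.out k => k
  eps := Action.eps
  ar_eps := rfl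

section Translation

variable {N : Type} [DecidableEq N]

/-- The connector `m_k(x, y, l₁, …)`, where `k` is the number of attached nodes. -/
def mEdge (x y : N) (l : List N) : Edge Label N where
  label := Label.m l.length
  nodes := x :: y :: l
  rank_eq := rfl

/-- The edge `n(x)`. -/
def nEdge (x : N) : Edge Label N where
  label := Label.n
  nodes := [x]
  rank_eq := rfl

/-- The edge `L_S(x₁,…,x_k)`. -/
def lEdge {k : ℕ} (S : Agent (Fin k) Empty) (x : Fin k → N) : Edge Label N where
  label := Label.L k S
  nodes := List.ofFn x
  rank_eq := List.length_ofFn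

/-- `m_{k+1}(x, l₁, …, l_k)` for a list `l` of length `k ≥ 1`. -/
def connector (x : N) : List N → Graph Label N
  | [] => 0
  | y :: l => {mEdge x y l}

/-- The translation of the substitution that maps the names in the list `w` along `σ`: one
connector `m_{k+1}(x, σ⁻¹(x))` for each `x` in the image, with `σ⁻¹(x)` in the order of `w`. -/
def translSubst (w : List N) (σ : N → N) : Graph Label N :=
  ∑ x ∈ w.toFinset.image σ, connector x (w.filter fun y => σ y = x)

/-- The edges `n(x)` for `x` in a finite set. -/
def closeAll (s : Finset N) : Graph Label N := s.val.map nEdge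

/-- A standard sequential process: linear, with its names numbered from left to right. -/
def IsStandard {k : ℕ} (S : Agent (Fin k) Empty) : Prop :=
  S.IsSequential ∧ S.occ = List.finRange k

/-- `e` is the edge `L_Ŝ(x₁,…,x_k)ρ` of the sequential process `S = Ŝ(x₁,…,x_k)ρ`. -/
def IsTranslSeq (S : Agent N Empty) (e : Edge Label N) : Prop :=
  ∃ (k : ℕ) (S' : Agent (Fin k) Empty) (ρ : Fin k → N),
    IsStandard S' ∧ S = S'.mapName ρ ∧ e = lEdge S' ρ

/-- `Γ ⊢ G` is a translation of the process `P` with parameters `v` and `w`: the process is brought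
by structural congruence to the form `(v) (S₁ | … | S_l) σ`, where the `S_i` are sequential and
`S₁ | … | S_l` is linear with `w` as its vector of free names. (Restricted names are
alpha-converted to the nodes `v`, and the names of the linear agent are chosen to be the
nodes `w`.) -/
def Translates (P : Agent N Empty) (v w : List N) (Γ : Finset N) (G : Graph Label N) : Prop :=
  ∃ (Ss : List (Agent N Empty)) (es : List (Edge Label N)) (σ : N → N),
    (∀ S ∈ Ss, S.IsSequential) ∧
    (Agent.parList Ss).occ = w ∧ w.Nodup ∧ v.Nodup ∧ v.Disjoint w ∧
    (∀ x ∈ P.fn, x ∉ v ∧ x ∉ w) ∧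
    Cong P (Agent.resList v ((Agent.parList Ss).mapName σ)) ∧
    List.Forall₂ IsTranslSeq Ss es ∧
    Γ = P.fn ∪ v.toFinset ∪ w.toFinset ∧
    G = (es : Multiset (Edge Label N)) + translSubst w σ + closeAll v.toFinset

/-- The actions exposed by a prefix. -/
def Prefix.label : Prefix N → N → Action × List N
  | Prefix.inp u xs, x => if x = u then (Action.inn xs.length, xs) else (Action.eps, [])
  | Prefix.out u xs, x => if x = u then (Action.out xs.length, xs) else (Action.eps, [])
  | Prefix.fus _, _ => (Action.eps, [])

/-- Kinds of productions: process productions for communication and fusion prefixes, and auxiliary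
productions for connectors. -/
inductive ProdKind : Type
  | comm : ProdKind
  | fusion : ProdKind
  | aux : ProdKind

instance : DecidableEq ProdKind := fun a b => by
  cases a <;> cases b <;> first | exact isTrue rfl | exact isFalse (fun h => by cases h)

def Prefix.kind {V : Type} : Prefix V → ProdKind
  | Prefix.inp _ _ => ProdKind.comm
  | Prefix.out _ _ => ProdKind.comm
  | Prefix.fus _ => ProdKind.fusion

/-- The names in `s` that are fused by `θ`. -/
def fusedNames (s : Finset N) (θ : N → N) : Finset N :=
  s.filter fun x => ∃ y ∈ s, y ≠ x ∧ θ x = θ y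

/-- The process productions, one for each summand `α j . Q j` of a standard sequential process and
each choice of the names (so that the family is closed under alpha-conversion). No node of the
source is merged by the transition label: the substitutive effect `θ` of a fusion prefix is
implemented by its connectors. -/
inductive ProcessProduction : ProdKind → Transition Label Action N → Prop
  | mk {k m : ℕ} (α : Fin m → Prefix (Fin k)) (Q : Fin m → Agent (Fin k) Empty) (j : Fin m)
      (x : Fin k → N) (ξ : N → N) (θ : N → N) (v w : List N) (Γ : Finset N) (G : Graph Label N)
      (standard : IsStandard (Agent.sum m α Q))
      (x_inj : Function.Injective x)
      (ξ_inj : Set.InjOn ξ ((Q j).mapName x).fn)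
      (transl : Translates (((Q j).mapName x).mapName ξ) v w Γ G)
      (vw_fresh : ∀ i, x i ∉ v ∧ x i ∉ w)
      (ξ_fresh : ∀ y ∈ ((Q j).mapName x).fn, ξ y ∉ v ∧ ξ y ∉ w ∧ ∀ i, ξ y ≠ x i)
      (effect : IsSubstEffect (listRel ((α j).map x).eqs) θ) :
      ProcessProduction (α j).kind
        { Γ := Finset.univ.image x
          G := {lEdge (Agent.sum m α Q) x}
          Λ := ((α j).map x).label
          π := id
          Φ := Γ ∪ Finset.univ.image x
          G' := G + translSubst ((Q j).mapName x).fn.toList ξ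
            + translSubst (((α j).map x).occ.filter fun y => θ y ≠ y) θ
            + closeAll (Finset.univ.image x \
                ((Finset.univ.image x).biUnion (fun y => (((α j).map x).label y).2.toFinset)
                  ∪ fusedNames (Finset.univ.image x) θ
                  ∪ ((Q j).mapName x).fn)) }

/-- The auxiliary productions: a connector with distinct nodes `x, y, l` synchronizes an input
on its node `a` with an output on its node `b`. -/
inductive AuxProduction : Transition Label Action N → Prop
  | mk (x y : N) (l : List N) (a b : N) (ys zs : List N)
      (nodup : (x :: y :: l).Nodup)
      (ha : a ∈ x :: y :: l) (hb : b ∈ x :: y :: l) (hab : a ≠ b)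
      (len : ys.length = zs.length)
      (fresh : (ys ++ zs).Nodup) (disj : (ys ++ zs).Disjoint (x :: y :: l)) :
      AuxProduction
        { Γ := (x :: y :: l).toFinset
          G := {mEdge x y l}
          Λ := fun z =>
            if z = a then (Action.inn ys.length, ys)
            else if z = b then (Action.out zs.length, zs)
            else (Action.eps, [])
          π := id
          Φ := (x :: y :: l).toFinset ∪ ys.toFinset ∪ zs.toFinset
          G' := {mEdge x y l} + (List.zipWith (fun s t => mEdge s t []) ys zs : Graph Label N) }

/-- All the productions of the HSHR system. -/
inductive FusionProduction : ProdKind → Transition Label Action N → Prop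
  | process {k : ProdKind} {T : Transition Label Action N} :
      ProcessProduction k T → FusionProduction k T
  | auxiliary {T : Transition Label Action N} :
      AuxProduction T → FusionProduction ProdKind.aux T

/-! ## Amoeboids -/

/-- `es` is the list of edges of a path from `a` to `b`: the nodes that are visited are pairwise
distinct, and so are the edges (as elements of the multiset `M`). `ns` lists the visited nodes. -/
def IsPath (M : Graph Label N) (a b : N) (ns : List N) (es : List (Edge Label N)) : Prop :=
  ns.Nodup ∧ ns.head? = some a ∧ ns.getLast? = some b ∧ (es : Multiset (Edge Label N)) ≤ M ∧
    List.Forall₂ (fun e (p : N × N) => p.1 ∈ e.nodes ∧ p.2 ∈ e.nodes) es (ns.zip ns.tail)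

/-- Structured amoeboids `M` with set `S` of external nodes. -/
structure IsAmoeboid (S : Finset N) (M : Graph Label N) : Prop where
  edges : ∀ e ∈ M, (∃ k, e.label = Label.m k) ∨ e.label = Label.n
  nonempty : M ≠ 0
  connected : ∀ a ∈ Graph.names M, ∀ b ∈ Graph.names M, ∃ ns es, IsPath M a b ns es
  external_sub : S ⊆ Graph.names M
  external : ∀ x ∈ S, (M.filter fun e => x ∈ e.nodes).card = 1
  internal : ∀ x ∈ Graph.names M \ S, (M.filter fun e => x ∈ e.nodes).card = 2
  odd : ∀ a ∈ S, ∀ b ∈ S, a ≠ b → ∀ ns es, IsPath M a b ns es → Odd es.length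

/-- `Realizes H G`: the graph `G` is obtained from `H` by replacing simple amoeboids by structured
amoeboids with the same external nodes (whose internal nodes are not used elsewhere), and by adding
pseudoamoeboids, i.e. amoeboids without external nodes that share no node with the rest. -/
inductive Realizes (H : Graph Label N) : Graph Label N → Prop
  | refl : Realizes H H
  | amoeboid (R M : Graph Label N) (x y : N) (l : List N) :
      Realizes H (R + {mEdge x y l}) → (x :: y :: l).Nodup →
      IsAmoeboid (x :: y :: l).toFinset M →
      Disjoint (Graph.names M \ (x :: y :: l).toFinset) (Graph.names R) →
      Realizes H (R + M)
  | pseudo (R M : Graph Label N) :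
      Realizes H R → IsAmoeboid ∅ M → Disjoint (Graph.names M) (Graph.names R) →
      Realizes H (R + M)

/-- The judgement `Γ ⊢ G` equals `Γ' ⊢ H` up to isolated nodes (the nodes of `Γ` and `Γ'` that
are attached to no edge are disregarded), injective renamings, equivalence of amoeboids and
pseudoamoeboids. -/
def EqualUpTo (Γ : Finset N) (G : Graph Label N) (Γ' : Finset N) (H : Graph Label N) : Prop :=
  Graph.names G ⊆ Γ ∧ Graph.names H ⊆ Γ' ∧
    ∃ f : N → N, Function.Injective f ∧ Realizes (H.map f) G

end Translation

end FusionSHR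

/-!
A derivation of synchronized hyperedge replacement can be normalized to a single merging of a
parallel composition of basic transitions: productions, idle transitions, and isolated nodes
(`Derives.exists_isDecomp`). The names of the merged transition are then the classes of the
equivalence generated by explicit equations between the names of the basic transitions.

In the translation `Π L_S | ⟦σ⟧ | Π n(x)` of a closed process `(v)(S₁ | … | S_l)σ`, every node of
`w` is attached to one process edge and to one connector, and every node of `v` to one edge `n` and
at most one connector. Edges `n` can only be idle, so an active node lies in `w`, and both its
process edge and its connector are rewritten by productions. With two communication productions this
leaves one possibility: a single connector synchronizes an input with an output, so the two subjects
are identified by `σ` and the process can communicate (`IsRun.exists_red_of_comm`). With one fusion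
production no node is active (`IsRun.exists_red_of_fusion`). In both cases the unifier fuses no
nodes and leaves the names added by the process productions alone, because an explicit assignment of
names solves the unification problem (`IsDecomp.kernel_le`). Hence the target of the transition
consists of the untouched edges of the source, the graphs of the continuations, and connectors for
the equations imposed by the reaction.

It remains to compare this graph with a translation of the reduct (`Reduct.realizes`). Its
connectors form two families. The red ones come from the translations `⟦σ⟧` and `⟦σ₁⟧` of the source
and of the continuations; every node is attached to exactly one of them. The blue ones are those
created by the reaction; together with the edges `n` on consumed names, they are attached to each
node at most once. So red and blue edges alternate along paths, every path between external nodes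
begins and ends with a red edge, and every connected component is an amoeboid
(`IsWiring.isAmoeboid`). The components correspond to the names of the reduct, and their external
nodes are such a name together with its occurrences; components without external nodes are
pseudoamoeboids. A name all of whose occurrences are consumed is not restricted in the chosen form
of the reduct, so that its edge `n` belongs to its pseudoamoeboid.
-/

set_option linter.unusedSectionVars false

namespace FusionSHR

/-! ### Names, renamings and structural congruence -/

namespace Prefix

theorem map_map {V V' V'' : Type} (f : V → V') (g : V' → V'') (α : Prefix V) :
    (α.map f).map g = α.map (g ∘ f) := by
  cases α <;> simp [Prefix.map, Function.comp_def]

theorem occ_map {V V' : Type} (f : V → V') (α : Prefix V) : (α.map f).occ = α.occ.map f := by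
  cases α <;> simp [Prefix.map, Prefix.occ, List.flatMap_map, List.map_flatMap]

theorem map_congr {V V' : Type} {f g : V → V'} {α : Prefix V} (h : ∀ x ∈ α.occ, f x = g x) :
    α.map f = α.map g := by
  cases α with
  | inp u xs => simpa [Prefix.map, Prefix.occ] using h
  | out u xs => simpa [Prefix.map, Prefix.occ] using h
  | fus φ =>
    simp only [Prefix.occ, List.mem_flatMap] at h
    simp only [Prefix.map, Prefix.fus.injEq, List.map_inj_left]
    intro p hp
    rw [h p.1 ⟨p, hp, by simp⟩, h p.2 ⟨p, hp, by simp⟩]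

end Prefix

theorem eqvGen_listRel_map {V V' : Type} (f : V → V') {φ ψ : List (V × V)}
    (h : ∀ x y, Relation.EqvGen (listRel φ) x y → Relation.EqvGen (listRel ψ) x y) {x y : V'}
    (hxy : Relation.EqvGen (listRel (φ.map fun p => (f p.1, f p.2))) x y) :
    Relation.EqvGen (listRel (ψ.map fun p => (f p.1, f p.2))) x y := by
  have key : ∀ a b, Relation.EqvGen (listRel ψ) a b →
      Relation.EqvGen (listRel (ψ.map fun p => (f p.1, f p.2))) (f a) (f b) := by
    intro a b hab
    induction hab with
    | rel a b hab => exact .rel _ _ (List.mem_map.2 ⟨(a, b), hab, rfl⟩)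
    | refl => exact .refl _
    | symm _ _ _ ih => exact .symm _ _ ih
    | trans _ _ _ _ _ ih1 ih2 => exact .trans _ _ _ ih1 ih2
  induction hxy with
  | rel x y hxy =>
    obtain ⟨⟨a, b⟩, hab, he⟩ := List.mem_map.1 hxy
    cases he
    exact key _ _ (h _ _ (.rel _ _ hab))
  | refl => exact .refl _
  | symm _ _ _ ih => exact .symm _ _ ih
  | trans _ _ _ _ _ ih1 ih2 => exact .trans _ _ _ ih1 ih2

theorem Prefix.Same.map {V V' : Type} (f : V → V') {α β : Prefix V} (h : α.Same β) :
    (α.map f).Same (β.map f) := by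
  cases h with
  | refl => exact .refl _
  | fus φ ψ hocc hgen =>
    refine .fus _ _ (fun x => ?_) (fun x y => ⟨?_, ?_⟩)
    · have h1 := Prefix.occ_map f (Prefix.fus φ)
      have h2 := Prefix.occ_map f (Prefix.fus ψ)
      simp only [Prefix.map] at h1 h2
      rw [h1, h2]
      simp only [List.mem_map, hocc]
    · exact eqvGen_listRel_map f fun a b => (hgen a b).1
    · exact eqvGen_listRel_map f fun a b => (hgen a b).2

theorem Prefix.Same.mem_occ {V : Type} {α β : Prefix V} (h : α.Same β) (x : V) :
    x ∈ α.occ ↔ x ∈ β.occ := by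
  cases h with
  | refl => rfl
  | fus φ ψ hocc _ => exact hocc x

namespace Agent

theorem mapName_mapName {V W : Type} (P : Agent V W) {V' V'' : Type} (f : V → V') (g : V' → V'') :
    (P.mapName f).mapName g = P.mapName (g ∘ f) := by
  induction P generalizing V' V'' with
  | nil => rfl
  | var => rfl
  | sum m α P ih => simp only [mapName, Prefix.map_map, ih]
  | par P Q ihP ihQ => simp only [mapName, ihP, ihQ]
  | scope P ih => simp only [mapName, ih, Option.map_comp_map]
  | fix P ih => simp only [mapName, ih]

theorem occ_mapName {V W : Type} (P : Agent V W) {V' : Type} (f : V → V') :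
    (P.mapName f).occ = P.occ.map f := by
  induction P generalizing V' with
  | nil => rfl
  | var => rfl
  | sum m α P ih => simp [mapName, occ, Prefix.occ_map, ih, List.map_flatMap]
  | par P Q ihP ihQ => simp [mapName, occ, ihP, ihQ]
  | scope P ih => simp [mapName, occ, ih, List.filterMap_map, List.map_filterMap]
  | fix P ih => simp [mapName, occ, ih]

theorem mapName_congr {V W : Type} {P : Agent V W} {V' : Type} {f g : V → V'}
    (h : ∀ x ∈ P.occ, f x = g x) : P.mapName f = P.mapName g := by
  induction P generalizing V' with
  | nil => rfl
  | var => rfl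
  | sum m α P ih =>
    simp only [occ, List.mem_flatMap, List.mem_append] at h
    simp only [mapName, sum.injEq, heq_eq_eq, true_and]
    exact ⟨funext fun i => Prefix.map_congr fun x hx => h x ⟨i, List.mem_finRange i, .inl hx⟩,
      funext fun i => ih i fun x hx => h x ⟨i, List.mem_finRange i, .inr hx⟩⟩
  | par P Q ihP ihQ =>
    simp only [occ, List.mem_append] at h
    simp only [mapName]
    rw [ihP fun x hx => h x (.inl hx), ihQ fun x hx => h x (.inr hx)]
  | scope P ih =>
    simp only [mapName]
    rw [ih]
    rintro (_ | x) hx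
    · rfl
    · simp only [Option.map_some]
      rw [h x]
      simpa [occ] using hx
  | fix P ih =>
    simp only [mapName]
    rw [ih]
    exact h

theorem mapVar_mapName {V W : Type} (P : Agent V W) {V' W' : Type} (f : V → V') (g : W → W') :
    (P.mapVar g).mapName f = (P.mapName f).mapVar g := by
  induction P generalizing V' W' with
  | nil => rfl
  | var => rfl
  | sum m α P ih => simp only [mapName, mapVar, ih]
  | par P Q ihP ihQ => simp only [mapName, mapVar, ihP, ihQ]
  | scope P ih => simp only [mapName, mapVar, ih]
  | fix P ih => simp only [mapName, mapVar, ih]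

theorem bind_mapName {V W : Type} (P : Agent V W) {V' W' : Type} (f : V → V')
    (s : W → Agent V W') :
    (P.bind s).mapName f = (P.mapName f).bind fun X => (s X).mapName f := by
  induction P generalizing V' W' with
  | nil => rfl
  | var => rfl
  | sum m α P ih => simp only [mapName, bind, ih]
  | par P Q ihP ihQ => simp only [mapName, bind, ihP, ihQ]
  | scope P ih =>
    simp only [mapName, bind, ih, mapName_mapName]
    rfl
  | fix P ih =>
    simp only [mapName, bind, ih]
    congr 2
    funext o
    cases o with
    | none => rfl
    | some X => exact mapVar_mapName _ _ _

theorem unfold_mapName {V W : Type} (P : Agent V (Option W)) {V' : Type} (f : V → V') :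
    P.unfold.mapName f = (P.mapName f).unfold := by
  unfold unfold
  rw [bind_mapName]
  congr 1
  funext o
  cases o <;> rfl

theorem occ_mapVar {V W : Type} (P : Agent V W) {W' : Type} (g : W → W') :
    (P.mapVar g).occ = P.occ := by
  induction P generalizing W' with
  | nil => rfl
  | var => rfl
  | sum m α P ih => simp only [occ, mapVar, ih]
  | par P Q ihP ihQ => simp only [occ, mapVar, ihP, ihQ]
  | scope P ih => simp only [occ, mapVar, ih]
  | fix P ih => simp only [occ, mapVar, ih]

theorem mem_occ_bind_of_mem {V W : Type} (P : Agent V W) {W' : Type} (s : W → Agent V W') {x : V}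
    (h : x ∈ P.occ) : x ∈ (P.bind s).occ := by
  induction P generalizing W' with
  | nil => exact h
  | var => simp [occ] at h
  | sum m α P ih =>
    simp only [occ, bind, List.mem_flatMap, List.mem_append] at h ⊢
    obtain ⟨i, hi, h⟩ := h
    exact ⟨i, hi, h.imp_right fun h => ih i _ h⟩
  | par P Q ihP ihQ =>
    simp only [occ, bind, List.mem_append] at h ⊢
    exact h.imp (fun h => ihP _ h) fun h => ihQ _ h
  | scope P ih =>
    simp only [occ, bind, List.mem_filterMap, id, exists_eq_right] at h ⊢
    exact ih _ h
  | fix P ih => exact ih _ h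

theorem mem_occ_of_mem_occ_bind {V W : Type} (P : Agent V W) {W' : Type} (s : W → Agent V W')
    {x : V} (h : x ∈ (P.bind s).occ) : x ∈ P.occ ∨ ∃ X, x ∈ (s X).occ := by
  induction P generalizing W' with
  | nil => exact .inl h
  | var X => exact .inr ⟨X, h⟩
  | sum m α P ih =>
    simp only [occ, bind, List.mem_flatMap, List.mem_append] at h ⊢
    obtain ⟨i, hi, h⟩ := h
    rcases h with h | h
    · exact .inl ⟨i, hi, .inl h⟩
    · exact (ih i _ h).imp_left fun h => ⟨i, hi, .inr h⟩
  | par P Q ihP ihQ =>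
    simp only [occ, bind, List.mem_append] at h ⊢
    rcases h with h | h
    · exact (ihP _ h).imp_left .inl
    · exact (ihQ _ h).imp_left .inr
  | scope P ih =>
    simp only [occ, bind, List.mem_filterMap, id, exists_eq_right] at h ⊢
    refine (ih _ h).imp_right fun ⟨X, hX⟩ => ⟨X, ?_⟩
    simpa [occ_mapName] using hX
  | fix P ih =>
    refine (ih _ h).imp_right ?_
    rintro ⟨_ | X, hX⟩
    · simp [occ] at hX
    · exact ⟨X, by simpa [occ_mapVar] using hX⟩

theorem mem_occ_unfold {V W : Type} (P : Agent V (Option W)) (x : V) :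
    x ∈ P.unfold.occ ↔ x ∈ P.occ := by
  refine ⟨fun h => ?_, mem_occ_bind_of_mem P _⟩
  rcases mem_occ_of_mem_occ_bind P _ h with h | ⟨_ | X, hX⟩
  · exact h
  · exact hX
  · simp [occ] at hX

theorem mem_fn {N W : Type} [DecidableEq N] {P : Agent N W} {x : N} : x ∈ P.fn ↔ x ∈ P.occ :=
  List.mem_toFinset

end Agent

open Agent

theorem Cong.mapName {V W : Type} {P Q : Agent V W} (h : Cong P Q) {V' : Type} (f : V → V') :
    Cong (P.mapName f) (Q.mapName f) := by
  induction h generalizing V' with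
  | refl => exact .refl _
  | symm _ ih => exact .symm (ih f)
  | trans _ _ ih1 ih2 => exact .trans (ih1 f) (ih2 f)
  | sum m α β P Q hα _ ih => exact .sum _ _ _ _ _ (fun i => (hα i).map f) fun i => ih i f
  | par _ _ ih1 ih2 => exact .par (ih1 f) (ih2 f)
  | scope _ ih => exact .scope (ih _)
  | fix _ ih => exact .fix (ih f)
  | sum_perm m e α P => exact .sum_perm m e (fun i => (α i).map f) fun i => (P i).mapName f
  | par_assoc => exact .par_assoc _ _ _
  | par_comm => exact .par_comm _ _
  | par_nil => exact .par_nil _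
  | scope_nil => exact .scope_nil
  | scope_comm P =>
    simp only [Agent.mapName, mapName_mapName]
    have := Cong.scope_comm (P.mapName (Option.map (Option.map f)))
    rw [mapName_mapName] at this
    convert this using 4
    funext o
    rcases o with _ | _ | o <;> rfl
  | extrusion P Q =>
    simp only [Agent.mapName, mapName_mapName]
    have := Cong.extrusion (P.mapName f) (Q.mapName (Option.map f))
    rw [mapName_mapName] at this
    exact this
  | unfold P =>
    rw [unfold_mapName]
    exact .unfold _

theorem Cong.mem_occ {V W : Type} {P Q : Agent V W} (h : Cong P Q) (x : V) :
    x ∈ P.occ ↔ x ∈ Q.occ := by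
  induction h with
  | refl => rfl
  | symm _ ih => exact (ih x).symm
  | trans _ _ ih1 ih2 => exact (ih1 x).trans (ih2 x)
  | sum m α β P Q hα _ ih =>
    simp only [occ, List.mem_flatMap, List.mem_append, ih, (hα _).mem_occ]
  | par _ _ ih1 ih2 => simp only [occ, List.mem_append, ih1, ih2]
  | scope _ ih => simp only [occ, List.mem_filterMap, id, exists_eq_right, ih]
  | fix _ ih => exact ih x
  | sum_perm m e α P =>
    simp only [occ, List.mem_flatMap, List.mem_append, List.mem_finRange, true_and,
      Function.comp_apply]
    exact (e.exists_congr_left (p := fun i => x ∈ (α i).occ ∨ x ∈ (P i).occ)).trans (by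
      constructor
      · rintro ⟨i, hi⟩; exact ⟨e.symm (e.symm i), by simpa using hi⟩
      · rintro ⟨i, hi⟩; exact ⟨e (e i), by simpa using hi⟩)
  | par_assoc => simp only [occ, List.append_assoc]
  | par_comm => simp only [occ, List.mem_append, or_comm]
  | par_nil => simp only [occ, List.append_nil]
  | scope_nil => simp [occ]
  | scope_comm P =>
    simp only [occ, occ_mapName, List.mem_filterMap, id, exists_eq_right, List.mem_map]
    constructor
    · intro h; exact ⟨_, h, rfl⟩
    · rintro ⟨_ | _ | o, h, he⟩ <;> simp_all
  | extrusion P Q => simp [occ, occ_mapName]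
  | unfold P => exact (mem_occ_unfold P x).symm

namespace Agent

variable {N W : Type} [DecidableEq N]

theorem mem_occ_res {x y : N} {P : Agent N W} : y ∈ (res x P).occ ↔ y ∈ P.occ ∧ y ≠ x := by
  simp only [res, occ, occ_mapName, List.mem_filterMap, id, exists_eq_right, List.mem_map]
  constructor
  · rintro ⟨z, hz, h⟩
    split_ifs at h with hzx
    cases h
    exact ⟨hz, hzx⟩
  · rintro ⟨h1, h2⟩
    exact ⟨y, h1, if_neg h2⟩

theorem mem_occ_resList {v : List N} {y : N} {P : Agent N W} :
    y ∈ (resList v P).occ ↔ y ∈ P.occ ∧ y ∉ v := by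
  induction v with
  | nil => simp [resList]
  | cons x v ih =>
    change y ∈ (res x (resList v P)).occ ↔ _
    rw [mem_occ_res, ih]
    simp only [List.mem_cons]
    tauto

theorem resList_append (v v' : List N) (P : Agent N W) :
    resList (v ++ v') P = resList v (resList v' P) := List.foldr_append

/-- Renaming a restriction; the binder may change, as agents are taken up to alpha-conversion. -/
theorem mapName_res {x x' : N} {P : Agent N W} {f f' : N → N}
    (h : ∀ y ∈ P.occ, (y = x → f' y = x') ∧ (y ≠ x → f' y = f y ∧ f y ≠ x')) :
    (res x P).mapName f = res x' (P.mapName f') := by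
  simp only [res, mapName, mapName_mapName]
  congr 1
  apply mapName_congr
  intro y hy
  by_cases hyx : y = x
  · have := (h y hy).1 hyx
    subst hyx
    simp [this]
  · obtain ⟨h1, h2⟩ := (h y hy).2 hyx
    simp [hyx, h1, h2]

theorem mapName_resList {v : List N} (hv : v.Nodup) {P : Agent N W} {f : N → N}
    (h : ∀ y ∈ (resList v P).occ, f y ∉ v) :
    (resList v P).mapName f = resList v (P.mapName fun y => if y ∈ v then y else f y) := by
  induction v generalizing f with
  | nil => simp [resList]
  | cons x v ih =>
    obtain ⟨hx, hv⟩ := List.nodup_cons.1 hv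
    change (res x (resList v P)).mapName f = res x (resList v _)
    rw [mapName_res (x' := x) (f' := fun y => if y = x then x else f y), ih hv]
    · congr 2
      apply mapName_congr
      intro y _
      by_cases h1 : y = x
      · subst h1; simp
      · simp [h1]
    · intro y hy
      by_cases h1 : y = x
      · simpa [h1] using hx
      · have := h y (mem_occ_res.2 ⟨hy, h1⟩)
        simp only [List.mem_cons, not_or] at this
        simpa [h1] using this.2
    · intro y hy
      refine ⟨fun h1 => by simp [h1], fun h1 => ⟨by simp [h1], ?_⟩⟩
      have := h y (mem_occ_res.2 ⟨hy, h1⟩)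
      simp only [List.mem_cons, not_or] at this
      exact this.1

theorem mapName_resList_of_injective {v : List N} {P : Agent N W} {f : N → N}
    (hf : Function.Injective f) :
    (resList v P).mapName f = resList (v.map f) (P.mapName f) := by
  induction v with
  | nil => rfl
  | cons x v ih =>
    change (res x (resList v P)).mapName f = res (f x) (resList (v.map f) _)
    rw [← ih]
    exact mapName_res fun y _ => ⟨fun h => by rw [h], fun h => ⟨rfl, hf.ne h⟩⟩

theorem mapName_parList {V V' W : Type} (Ps : List (Agent V W)) (f : V → V') :
    (parList Ps).mapName f = parList (Ps.map fun P => P.mapName f) := by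
  induction Ps with
  | nil => rfl
  | cons P Ps ih =>
    change par (P.mapName f) ((parList Ps).mapName f) = _
    rw [ih]; rfl

theorem occ_parList {V W : Type} (Ps : List (Agent V W)) :
    (parList Ps).occ = Ps.flatMap occ := by
  induction Ps with
  | nil => rfl
  | cons P Ps ih =>
    change P.occ ++ (parList Ps).occ = _
    rw [ih, List.flatMap_cons]

end Agent

theorem Cong.of_eq {V W : Type} {P Q : Agent V W} (h : P = Q) : Cong P Q := h ▸ .refl _

theorem Cong.nil_par {V W : Type} (P : Agent V W) : Cong (Agent.par Agent.nil P) P :=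
  (Cong.par_comm _ _).trans (.par_nil _)

theorem Cong.parList_perm {V W : Type} {Ps Qs : List (Agent V W)} (h : Ps.Perm Qs) :
    Cong (Agent.parList Ps) (Agent.parList Qs) := by
  induction h with
  | nil => exact .refl _
  | cons x _ ih => exact .par (.refl _) ih
  | swap x y l =>
    exact (Cong.par_assoc _ _ _).symm.trans ((Cong.par (.par_comm _ _) (.refl _)).trans
      (.par_assoc _ _ _))
  | trans _ _ ih1 ih2 => exact ih1.trans ih2

theorem Cong.parList_append {V W : Type} (Ps Qs : List (Agent V W)) :
    Cong (Agent.parList (Ps ++ Qs)) (Agent.par (Agent.parList Ps) (Agent.parList Qs)) := by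
  induction Ps with
  | nil => exact (Cong.nil_par _).symm
  | cons P Ps ih => exact (Cong.par (.refl _) ih).trans (Cong.par_assoc _ _ _).symm

section CongLaws

variable {N W : Type} [DecidableEq N]

theorem Cong.res {x : N} {P Q : Agent N W} (h : Cong P Q) : Cong (Agent.res x P) (Agent.res x Q) :=
  .scope (h.mapName _)

theorem Cong.resList {v : List N} {P Q : Agent N W} (h : Cong P Q) :
    Cong (Agent.resList v P) (Agent.resList v Q) := by
  induction v with
  | nil => exact h
  | cons x v ih => exact ih.res

theorem Cong.par_res {x : N} {P Q : Agent N W} (hx : x ∉ Q.occ) :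
    Cong (Agent.par Q (Agent.res x P)) (Agent.res x (Agent.par Q P)) := by
  refine (Cong.extrusion _ _).trans (Cong.of_eq ?_)
  simp only [Agent.res, Agent.mapName]
  congr 2
  refine mapName_congr fun y hy => ?_
  rw [if_neg]
  rintro rfl
  exact hx hy

theorem Cong.res_of_notMem {x : N} {P : Agent N W} (hx : x ∉ P.occ) :
    Cong (Agent.res x P) P := by
  have h : Agent.res x P = Agent.scope (P.mapName some) := by
    simp only [Agent.res]
    congr 1
    refine mapName_congr fun y hy => ?_
    rw [if_neg]
    rintro rfl
    exact hx hy
  rw [h]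
  exact (Cong.scope (Cong.par_nil _).symm).trans
    ((Cong.extrusion _ _).symm.trans ((Cong.par (.refl _) .scope_nil).trans (.par_nil _)))

theorem Cong.par_resList {v : List N} {P Q : Agent N W} (h : ∀ x ∈ v, x ∉ Q.occ) :
    Cong (Agent.par Q (Agent.resList v P)) (Agent.resList v (Agent.par Q P)) := by
  induction v with
  | nil => exact .refl _
  | cons x v ih =>
    exact (Cong.par_res (h x List.mem_cons_self)).trans
      (ih fun y hy => h y (List.mem_cons_of_mem _ hy)).res

/-- Restrictions of names that do not occur may be dropped. -/
theorem Cong.resList_filter {v : List N} {P : Agent N W} (p : N → Bool)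
    (h : ∀ x ∈ v, p x = false → x ∉ P.occ) :
    Cong (Agent.resList v P) (Agent.resList (v.filter p) P) := by
  induction v with
  | nil => exact .refl _
  | cons x v ih =>
    have ih := ih fun y hy => h y (List.mem_cons_of_mem _ hy)
    by_cases hp : p x = true
    · rw [List.filter_cons_of_pos hp]
      exact ih.res
    · rw [List.filter_cons_of_neg hp]
      refine Cong.trans (Cong.res_of_notMem fun hx => ?_) ih
      exact h x List.mem_cons_self (by simpa using hp) (mem_occ_resList.1 hx).1

end CongLaws

/-! ### A normal form for derivations -/

theorem eqvGen_map {α β : Type*} {r : α → α → Prop} {s : β → β → Prop} (φ : α → β)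
    (h : ∀ a b, r a b → Relation.EqvGen s (φ a) (φ b)) {a b : α} (hab : Relation.EqvGen r a b) :
    Relation.EqvGen s (φ a) (φ b) := by
  induction hab with
  | rel a b hab => exact h a b hab
  | refl => exact .refl _
  | symm _ _ _ ih => exact .symm _ _ ih
  | trans _ _ _ _ _ ih1 ih2 => exact .trans _ _ _ ih1 ih2

section SHR

variable {LE : Type*} [RankedAlphabet LE] {N : Type} [DecidableEq N]

theorem Graph.mem_names {G : Graph LE N} {x : N} : x ∈ G.names ↔ ∃ e ∈ G, x ∈ e.nodes := by
  simp [Graph.names]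

theorem Graph.names_add (G H : Graph LE N) : Graph.names (G + H) = G.names ∪ H.names := by
  ext x
  simp only [Graph.mem_names, Multiset.mem_add, Finset.mem_union, or_and_right, exists_or]

theorem Graph.mem_names_sum {ι : Type*} {s : Finset ι} {G : ι → Graph LE N} {x : N} :
    x ∈ Graph.names (∑ i ∈ s, G i) ↔ ∃ i ∈ s, x ∈ (G i).names := by
  classical
  simp only [Graph.mem_names, Multiset.mem_sum]
  constructor
  · rintro ⟨e, ⟨i, hi, he⟩, hx⟩; exact ⟨i, hi, e, he, hx⟩
  · rintro ⟨i, hi, e, he, hx⟩; exact ⟨e, ⟨i, hi, he⟩, hx⟩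

end SHR

section SHR

variable {LE : Type*} [RankedAlphabet LE] {N : Type}

theorem Graph.map_add (f : N → N) (G H : Graph LE N) :
    Graph.map f (G + H) = Graph.map f G + Graph.map f H := Multiset.map_add _ _ _

theorem Graph.map_sum {ι : Type*} (f : N → N) (s : Finset ι) (G : ι → Graph LE N) :
    Graph.map f (∑ i ∈ s, G i) = ∑ i ∈ s, Graph.map f (G i) :=
  _root_.map_sum (Multiset.mapAddMonoidHom (Edge.map f)) G s

theorem Edge.ext' {e e' : Edge LE N} (h1 : e.label = e'.label) (h2 : e.nodes = e'.nodes) :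
    e = e' := by
  cases e; cases e'; cases h1; cases h2; rfl

theorem Edge.map_map (f g : N → N) (e : Edge LE N) : (e.map f).map g = e.map (g ∘ f) :=
  Edge.ext' rfl (by simp [Edge.map])

theorem Graph.map_map (f g : N → N) (G : Graph LE N) :
    Graph.map g (Graph.map f G) = Graph.map (g ∘ f) G := by
  simp only [Graph.map, Multiset.map_map, Function.comp_def, Edge.map_map]

theorem Edge.map_congr {f g : N → N} {e : Edge LE N} (h : ∀ x ∈ e.nodes, f x = g x) :
    e.map f = e.map g := Edge.ext' rfl (List.map_congr_left h)

theorem Edge.map_id (e : Edge LE N) : e.map id = e := Edge.ext' rfl (by simp [Edge.map])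

theorem Graph.map_id (G : Graph LE N) : Graph.map id G = G := by
  simp only [Graph.map, Edge.map_id, Multiset.map_id']

theorem Graph.map_congr [DecidableEq N] {f g : N → N} {G : Graph LE N}
    (h : ∀ x ∈ G.names, f x = g x) : Graph.map f G = Graph.map g G :=
  Multiset.map_congr rfl fun _ he => Edge.map_congr fun x hx =>
    h x (Graph.mem_names.2 ⟨_, he, hx⟩)

theorem Graph.mem_names_map [DecidableEq N] {f : N → N} {G : Graph LE N} {x : N} :
    x ∈ Graph.names (Graph.map f G) ↔ ∃ y ∈ G.names, f y = x := by
  simp only [Graph.mem_names, Graph.map, Multiset.mem_map]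
  constructor
  · rintro ⟨_, ⟨e, he, rfl⟩, hx⟩
    obtain ⟨y, hy, rfl⟩ := List.mem_map.1 hx
    exact ⟨y, ⟨e, he, hy⟩, rfl⟩
  · rintro ⟨y, ⟨e, he, hy⟩, rfl⟩
    exact ⟨_, ⟨e, he, rfl⟩, List.mem_map_of_mem hy⟩

end SHR

section Normal

variable {LE : Type*} [RankedAlphabet LE] {Act : Type*} [ActionSet Act] {N : Type} [DecidableEq N]
  {κ : Type}

/-- The transitions from which derivations are built by parallel composition and merging:
instances of productions, idle transitions, and single isolated nodes exposing distinct fresh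
names. The multiset records the kind of the production, if any. -/
inductive Basic (Prods : κ → Transition LE Act N → Prop) :
    Multiset κ → Transition LE Act N → Prop
  | prod {k : κ} {T : Transition LE Act N} : Prods k T → T.IsSHR → Basic Prods {k} T
  | idle {T : Transition LE Act N} : T.IsIdle → T.IsSHR → Basic Prods 0 T
  | new {T : Transition LE Act N} (x : N) (a : Act) (ys : List N) :
      T.Γ = {x} → T.G = 0 → T.Λ x = (a, ys) → ys.length = ActionSet.ar a → T.π = id →
      ys.Nodup → x ∉ ys → T.Φ = insert x ys.toFinset → T.G' = 0 → Basic Prods 0 T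

/-- The equations that merging along the node maps `f i` imposes on the names of the basic
transitions `B i`; a name `x` of `B i` is represented by the pair `(i, x)`. -/
def unifEqs {ι : Type} (B : ι → Transition LE Act N) (f : ι → N → N) (p q : ι × N) : Prop :=
  (p.2 ∈ (B p.1).Γ ∧ q.2 ∈ (B q.1).Γ ∧ f p.1 p.2 = f q.1 q.2) ∨
  ∃ x ∈ (B p.1).Γ, ∃ y ∈ (B q.1).Γ, f p.1 x = f q.1 y ∧
    (p.2, q.2) ∈ ((B p.1).Λ x).2.zip ((B q.1).Λ y).2

/-- `T` is obtained from the disjoint union of the basic transitions `B i` by one merging: the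
nodes are identified along the maps `f i`, and the names of the targets along the maps `g i`, whose
joint kernel is generated by `unifEqs`. -/
structure IsDecomp {ι : Type} [Fintype ι] (B : ι → Transition LE Act N) (f g : ι → N → N)
    (T : Transition LE Act N) : Prop where
  source : T.G = ∑ i, Graph.map (f i) (B i).G
  target : T.G' = ∑ i, Graph.map (g i) (B i).G'
  nodes : ∀ z, z ∈ T.Γ ↔ ∃ i, ∃ x ∈ (B i).Γ, f i x = z
  label : ∀ i, ∀ x ∈ (B i).Γ, T.Λ (f i x) = (((B i).Λ x).1, ((B i).Λ x).2.map (g i))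
  fusion : ∀ i, ∀ x ∈ (B i).Γ, T.π (f i x) = g i x
  repr : ∀ i, ∀ x ∈ (B i).Γ ∪ (B i).Φ, g i x ∈ T.Γ → T.π (g i x) = g i x
  kernel : ∀ i j, ∀ x ∈ (B i).Γ ∪ (B i).Φ, ∀ y ∈ (B j).Γ ∪ (B j).Φ, g i x = g j y →
    Relation.EqvGen (unifEqs B f) (i, x) (j, y)

theorem Transition.IsSHR.mem_target {T : Transition LE Act N} (hT : T.IsSHR) {x : N}
    (hx : x ∈ T.Φ) : x ∈ T.Γ ∨ (∃ y ∈ T.Γ, x ∈ (T.Λ y).2) ∨ x ∈ T.G'.names := by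
  by_cases h : x ∈ T.surviving
  · rcases Finset.mem_union.1 h with h | h
    · obtain ⟨y, hy, rfl⟩ := Finset.mem_image.1 h
      exact .inl (hT.maps y hy)
    · obtain ⟨y, hy, h⟩ := Finset.mem_biUnion.1 (Finset.mem_sdiff.1 h).1
      exact .inr (.inl ⟨y, hy, List.mem_toFinset.1 h⟩)
  · exact .inr (.inr (hT.no_isolated (Finset.mem_sdiff.2 ⟨hx, h⟩)))

theorem Basic.mem_target {Prods : κ → Transition LE Act N → Prop} {u : Multiset κ}
    {T : Transition LE Act N} (hT : Basic Prods u T) {x : N} (hx : x ∈ T.Φ) :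
    x ∈ T.Γ ∨ (∃ y ∈ T.Γ, x ∈ (T.Λ y).2) ∨ x ∈ T.G'.names := by
  cases hT with
  | prod _ h => exact h.mem_target hx
  | idle _ h => exact h.mem_target hx
  | new z a ys hΓ _ hΛ _ _ _ _ hΦ _ =>
    rw [hΦ, Finset.mem_insert, List.mem_toFinset] at hx
    rcases hx with rfl | hx
    · exact .inl (by simp [hΓ])
    · exact .inr (.inl ⟨z, by simp [hΓ], by simpa [hΛ] using hx⟩)

theorem Transition.IsSHR.exposed_mem {T : Transition LE Act N} (hT : T.IsSHR) {x c : N}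
    (hx : x ∈ T.Γ) (hc : c ∈ (T.Λ x).2) : c ∈ T.Γ ∪ T.Φ := by
  by_cases h : c ∈ T.Γ
  · exact Finset.mem_union_left _ h
  · exact Finset.mem_union_right _ (hT.nodes_kept (Finset.mem_union_right _
      (Finset.mem_sdiff.2 ⟨Finset.mem_biUnion.2 ⟨x, hx, List.mem_toFinset.2 hc⟩, h⟩)))

theorem Basic.exposed_mem {Prods : κ → Transition LE Act N → Prop} {u : Multiset κ}
    {T : Transition LE Act N} (hT : Basic Prods u T) {x c : N} (hx : x ∈ T.Γ)
    (hc : c ∈ (T.Λ x).2) : c ∈ T.Γ ∪ T.Φ := by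
  cases hT with
  | prod _ h => exact h.exposed_mem hx hc
  | idle _ h => exact h.exposed_mem hx hc
  | new z a ys hΓ _ hΛ _ _ _ _ hΦ _ =>
    rw [hΓ, Finset.mem_singleton] at hx
    rw [hx, hΛ] at hc
    rw [hΦ, Finset.mem_union, Finset.mem_insert, List.mem_toFinset]
    exact .inr (.inr hc)

theorem IsDecomp.mem_nodes {Prods : κ → Transition LE Act N → Prop} {ι : Type} [Fintype ι]
    {u : ι → Multiset κ} {B : ι → Transition LE Act N} {f g : ι → N → N}
    {T : Transition LE Act N} (h : IsDecomp B f g T) (hB : ∀ i, Basic Prods (u i) (B i))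
    (hT : T.IsSHR) (i : ι) (x : N) (hx : x ∈ (B i).Γ ∪ (B i).Φ) : g i x ∈ T.Γ ∪ T.Φ := by
  have : x ∈ (B i).Γ ∨ (∃ y ∈ (B i).Γ, x ∈ ((B i).Λ y).2) ∨ x ∈ (B i).G'.names :=
    (Finset.mem_union.1 hx).elim .inl (hB i).mem_target
  rw [Finset.mem_union]
  rcases this with hx | ⟨y, hy, hx⟩ | hx
  · left
    rw [← h.fusion i x hx]
    exact hT.maps _ ((h.nodes _).2 ⟨i, x, hx, rfl⟩)
  · by_cases hg : g i x ∈ T.Γ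
    · exact .inl hg
    · right
      refine hT.nodes_kept (Finset.mem_union_right _ (Finset.mem_sdiff.2 ⟨?_, hg⟩))
      refine Finset.mem_biUnion.2 ⟨f i y, (h.nodes _).2 ⟨i, y, hy, rfl⟩, ?_⟩
      rw [h.label i y hy, List.mem_toFinset]
      exact List.mem_map_of_mem hx
  · right
    refine hT.target_wf ?_
    rw [h.target, Graph.mem_names_sum]
    exact ⟨i, Finset.mem_univ i, Graph.mem_names_map.2 ⟨x, hx, rfl⟩⟩

theorem IsDecomp.single {T : Transition LE Act N} (hπ : ∀ x ∈ T.Γ, T.π x = x) :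
    IsDecomp (fun _ : Unit => T) (fun _ => id) (fun _ => id) T where
  source := by simp [Graph.map_id]
  target := by simp [Graph.map_id]
  nodes := by simp
  label := by simp
  fusion := by simpa using hπ
  repr := fun _ x _ => hπ x
  kernel := by
    rintro i j x _ y _ h
    cases h
    exact .refl _

/-- The rule (par) takes the disjoint union of two decompositions. -/
theorem IsDecomp.par {ι₁ ι₂ : Type} [Fintype ι₁] [Fintype ι₂] {B₁ : ι₁ → Transition LE Act N}
    {f₁ g₁ : ι₁ → N → N} {B₂ : ι₂ → Transition LE Act N} {f₂ g₂ : ι₂ → N → N}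
    {T₁ T₂ T : Transition LE Act N} (h₁ : IsDecomp B₁ f₁ g₁ T₁) (h₂ : IsDecomp B₂ f₂ g₂ T₂)
    (hm₁ : ∀ i, ∀ x ∈ (B₁ i).Γ ∪ (B₁ i).Φ, g₁ i x ∈ T₁.Γ ∪ T₁.Φ)
    (hm₂ : ∀ i, ∀ x ∈ (B₂ i).Γ ∪ (B₂ i).Φ, g₂ i x ∈ T₂.Γ ∪ T₂.Φ)
    (h : T₁.IsPar T₂ T) :
    IsDecomp (Sum.elim B₁ B₂) (Sum.elim f₁ f₂) (Sum.elim g₁ g₂) T where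
  source := by simp [h.source, h₁.source, h₂.source]
  target := by simp [h.target, h₁.target, h₂.target]
  nodes z := by simp [h.nodes, h₁.nodes, h₂.nodes]
  label := by
    rintro (i | i) x hx
    · exact (h.label_left _ ((h₁.nodes _).2 ⟨i, x, hx, rfl⟩)).1.trans (h₁.label i x hx)
    · exact (h.label_right _ ((h₂.nodes _).2 ⟨i, x, hx, rfl⟩)).1.trans (h₂.label i x hx)
  fusion := by
    rintro (i | i) x hx
    · exact (h.label_left _ ((h₁.nodes _).2 ⟨i, x, hx, rfl⟩)).2.trans (h₁.fusion i x hx)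
    · exact (h.label_right _ ((h₂.nodes _).2 ⟨i, x, hx, rfl⟩)).2.trans (h₂.fusion i x hx)
  repr := by
    rintro (i | i) x hx hg
    · rw [h.nodes, Finset.mem_union] at hg
      rcases hg with hg | hg
      · exact (h.label_left _ hg).2.trans (h₁.repr i x hx hg)
      · exact absurd (Finset.mem_union_left _ hg) (Finset.disjoint_left.1 h.disj (hm₁ i x hx))
    · rw [h.nodes, Finset.mem_union] at hg
      rcases hg with hg | hg
      · exact absurd (hm₂ i x hx) (Finset.disjoint_left.1 h.disj (Finset.mem_union_left _ hg))
      · exact (h.label_right _ hg).2.trans (h₂.repr i x hx hg)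
  kernel := by
    rintro (i | i) (j | j) x hx y hy hg
    · exact eqvGen_map (r := unifEqs B₁ f₁) (fun p : ι₁ × N => (Sum.inl p.1, p.2))
        (fun p q hpq => .rel _ _ hpq) (h₁.kernel i j x hx y hy hg)
    · have := hm₁ i x hx
      rw [show g₁ i x = g₂ j y from hg] at this
      exact absurd (hm₂ j y hy) (Finset.disjoint_left.1 h.disj this)
    · have := hm₁ j y hy
      rw [show g₁ j y = g₂ i x from hg.symm] at this
      exact absurd (hm₂ i x hx) (Finset.disjoint_left.1 h.disj this)
    · exact eqvGen_map (r := unifEqs B₂ f₂) (fun p : ι₂ × N => (Sum.inr p.1, p.2))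
        (fun p q hpq => .rel _ _ hpq) (h₂.kernel i j x hx y hy hg)

/-- The rule (merge) composes the node maps with `σ` and the target maps with `ρ ∘ σ`. The equations
unified by `ρ` are images of equations between names of the basic transitions, so the joint kernel
is still generated by `unifEqs`. -/
theorem IsDecomp.merge {ι : Type} [Fintype ι] {B : ι → Transition LE Act N} {f g : ι → N → N}
    {T T' : Transition LE Act N} {σ ρ : N → N} (h : IsDecomp B f g T)
    (hex : ∀ i, ∀ x ∈ (B i).Γ, ∀ c ∈ ((B i).Λ x).2, c ∈ (B i).Γ ∪ (B i).Φ) (hT : T.IsSHR)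
    (hm : Transition.IsMerge σ ρ T T') :
    IsDecomp B (fun i => σ ∘ f i) (fun i => ρ ∘ σ ∘ g i) T' := by
  -- every name representing `(i, x)` in the source of the substitution `ρ`
  let Rep (a : N) (p : ι × N) : Prop :=
    (p.2 ∈ (B p.1).Γ ∪ (B p.1).Φ ∧ a = σ (g p.1 p.2)) ∨
      (p.2 ∈ (B p.1).Γ ∧ a = σ (f p.1 p.2))
  have mem : ∀ p : ι × N, p.2 ∈ (B p.1).Γ → f p.1 p.2 ∈ T.Γ :=
    fun p hp => (h.nodes _).2 ⟨p.1, p.2, hp, rfl⟩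
  have lift : ∀ p q : ι × N, Relation.EqvGen (unifEqs B f) p q →
      Relation.EqvGen (unifEqs B fun i => σ ∘ f i) p q := by
    intro p q hpq
    refine eqvGen_map id (fun p q hpq => .rel _ _ ?_) hpq
    rcases hpq with ⟨h1, h2, h3⟩ | ⟨x, hx, y, hy, h3, h4⟩
    · exact .inl ⟨h1, h2, congrArg σ h3⟩
    · exact .inr ⟨x, hx, y, hy, congrArg σ h3, h4⟩
  have ker : ∀ p q : ι × N, p.2 ∈ (B p.1).Γ ∪ (B p.1).Φ → q.2 ∈ (B q.1).Γ ∪ (B q.1).Φ →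
      g p.1 p.2 = g q.1 q.2 → Relation.EqvGen (unifEqs B fun i => σ ∘ f i) p q :=
    fun p q hp hq hg => lift _ _ (h.kernel p.1 q.1 p.2 hp q.2 hq hg)
  -- a target name that is a node represents the same element as some node does
  have node : ∀ p : ι × N, p.2 ∈ (B p.1).Γ ∪ (B p.1).Φ → g p.1 p.2 ∈ T.Γ →
      ∃ r : ι × N, r.2 ∈ (B r.1).Γ ∧ f r.1 r.2 = g p.1 p.2 ∧
        Relation.EqvGen (unifEqs B fun i => σ ∘ f i) p r := by
    intro p hp hg
    obtain ⟨j, z, hz, hfz⟩ := (h.nodes _).1 hg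
    refine ⟨(j, z), hz, hfz, ker _ _ hp (Finset.mem_union_left _ hz) ?_⟩
    rw [← h.fusion j z hz, hfz, h.repr p.1 p.2 hp hg]
  have rep_rep : ∀ a p q, Rep a p → Rep a q →
      Relation.EqvGen (unifEqs B fun i => σ ∘ f i) p q := by
    have ff : ∀ p q : ι × N, p.2 ∈ (B p.1).Γ → q.2 ∈ (B q.1).Γ →
        σ (f p.1 p.2) = σ (f q.1 q.2) → Relation.EqvGen (unifEqs B fun i => σ ∘ f i) p q :=
      fun p q hp hq h => .rel _ _ (.inl ⟨hp, hq, h⟩)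
    have gf : ∀ p q : ι × N, p.2 ∈ (B p.1).Γ ∪ (B p.1).Φ → q.2 ∈ (B q.1).Γ →
        σ (g p.1 p.2) = σ (f q.1 q.2) → Relation.EqvGen (unifEqs B fun i => σ ∘ f i) p q := by
      intro p q hp hq hpq
      have hg : g p.1 p.2 ∈ T.Γ := by
        by_contra hg
        rw [hm.outside _ hg] at hpq
        exact hg (hpq ▸ hm.maps _ (mem q hq))
      obtain ⟨r, hr, hfr, hpr⟩ := node p hp hg
      exact .trans _ _ _ hpr (ff r q hr hq (by rw [hfr, hpq]))
    rintro a p q (⟨hp, rfl⟩ | ⟨hp, rfl⟩) (⟨hq, hpq⟩ | ⟨hq, hpq⟩)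
    · by_cases hgp : g p.1 p.2 ∈ T.Γ
      · obtain ⟨r, hr, hfr, hpr⟩ := node p hp hgp
        exact .trans _ _ _ hpr (.symm _ _ (gf q r hq hr (by rw [hfr, hpq])))
      · by_cases hgq : g q.1 q.2 ∈ T.Γ
        · obtain ⟨r, hr, hfr, hqr⟩ := node q hq hgq
          exact .trans _ _ _ (gf p r hp hr (by rw [hfr, hpq])) (.symm _ _ hqr)
        · rw [hm.outside _ hgp, hm.outside _ hgq] at hpq
          exact ker p q hp hq hpq
    · exact gf p q hp hq hpq
    · exact .symm _ _ (gf q p hq hp hpq.symm)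
    · exact ff p q hp hq hpq
  -- names that are unified by `ρ` represent equivalent elements; names without a representation
  -- are not touched by the equations
  let K (a b : N) : Prop :=
    a = b ∨ ∃ p q, Rep a p ∧ Rep b q ∧ Relation.EqvGen (unifEqs B fun i => σ ∘ f i) p q
  have hK : ∀ a b, Relation.EqvGen (T.mergeEqs σ) a b → K a b := by
    intro a b hab
    induction hab with
    | refl => exact .inl rfl
    | symm a b _ ih =>
      rcases ih with rfl | ⟨p, q, hp, hq, hpq⟩
      · exact .inl rfl
      · exact .inr ⟨q, p, hq, hp, .symm _ _ hpq⟩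
    | trans a b c _ _ ih1 ih2 =>
      rcases ih1 with rfl | ⟨p, q, hp, hq, hpq⟩
      · exact ih2
      · rcases ih2 with rfl | ⟨p', q', hp', hq', hpq'⟩
        · exact .inr ⟨p, q, hp, hq, hpq⟩
        · exact .inr ⟨p, q', hp, hq',
            .trans _ _ _ hpq (.trans _ _ _ (rep_rep b q p' hq hp') hpq')⟩
    | rel a b hab =>
      rcases hab with ⟨x, hx, y, hy, hxy, hab⟩ | ⟨x, hx, y, hy, hxy, rfl, rfl⟩
      · obtain ⟨i, x, hx', rfl⟩ := (h.nodes _).1 hx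
        obtain ⟨j, y, hy', rfl⟩ := (h.nodes _).1 hy
        rw [h.label i x hx', h.label j y hy'] at hab
        simp only [List.map_map, List.zip_map, List.mem_map, Prod.exists, Prod.map_apply,
          Prod.mk.injEq] at hab
        obtain ⟨c, d, hcd, rfl, rfl⟩ := hab
        obtain ⟨hc, hd⟩ := List.of_mem_zip hcd
        exact .inr ⟨(i, c), (j, d), .inl ⟨hex i x hx' c hc, rfl⟩, .inl ⟨hex j y hy' d hd, rfl⟩,
          .rel _ _ (.inr ⟨x, hx', y, hy', hxy, hcd⟩)⟩
      · obtain ⟨i, x, hx', rfl⟩ := (h.nodes _).1 hx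
        obtain ⟨j, y, hy', rfl⟩ := (h.nodes _).1 hy
        rw [h.fusion i x hx', h.fusion j y hy'] at hxy
        exact .inr ⟨(i, x), (j, y), .inr ⟨hx', rfl⟩, .inr ⟨hy', rfl⟩,
          ker _ _ (Finset.mem_union_left _ hx') (Finset.mem_union_left _ hy') hxy⟩
  refine ⟨?_, ?_, ?_, ?_, ?_, ?_, ?_⟩
  · rw [hm.source, h.source, Graph.map_sum]
    exact Finset.sum_congr rfl fun i _ => Graph.map_map _ _ _
  · rw [hm.target, h.target, Graph.map_sum]
    exact Finset.sum_congr rfl fun i _ => Graph.map_map _ _ _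
  · intro z
    rw [hm.nodes, Finset.mem_image]
    constructor
    · rintro ⟨y, hy, rfl⟩
      obtain ⟨i, x, hx, rfl⟩ := (h.nodes _).1 hy
      exact ⟨i, x, hx, rfl⟩
    · rintro ⟨i, x, hx, rfl⟩
      exact ⟨f i x, mem (i, x) hx, rfl⟩
  · intro i x hx
    change T'.Λ (σ (f i x)) = _
    rw [hm.label _ (mem (i, x) hx), h.label i x hx]
    simp
  · intro i x hx
    have : σ (f i x) ∈ T'.Γ := by
      rw [hm.nodes]; exact Finset.mem_image_of_mem _ (mem (i, x) hx)
    change T'.π (σ (f i x)) = ρ (σ (g i x))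
    rw [hm.fusion _ this, hm.mgu.2]
    refine .rel _ _ (.inr ⟨f i x, mem (i, x) hx, g i x, ?_, ?_, rfl, rfl⟩)
    · rw [← h.fusion i x hx]; exact hT.maps _ (mem (i, x) hx)
    · rw [← h.fusion i x hx, hT.idem _ (mem (i, x) hx)]
  · intro i x hx hg
    rw [hm.fusion _ hg]
    exact hm.mgu.1 _
  · intro i j x hx y hy hxy
    rcases hK _ _ ((hm.mgu.2 _ _).1 hxy) with he | ⟨p, q, hp, hq, hpq⟩
    · exact rep_rep _ (i, x) (j, y) (.inl ⟨hx, rfl⟩) (.inl ⟨hy, he⟩)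
    · exact .trans _ _ _ (rep_rep _ (i, x) p (.inl ⟨hx, rfl⟩) hp)
        (.trans _ _ _ hpq (rep_rep _ q (j, y) hq (.inl ⟨hy, rfl⟩)))

theorem Derives.isSHR {Prods : κ → Transition LE Act N → Prop} {U : Multiset κ}
    {T : Transition LE Act N} (h : Derives Prods U T) : T.IsSHR := by
  rcases h with ⟨_, h⟩ | ⟨_, h⟩ | ⟨_, _, _, h⟩ | ⟨_, _, _, _, h⟩ | ⟨_, _, _, _, _, h⟩ <;> exact h

/-- Every derivation can be brought to the form of a single merging of a parallel composition of
basic transitions. -/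
theorem Derives.exists_isDecomp {Prods : κ → Transition LE Act N → Prop}
    (hπ : ∀ k T, Prods k T → T.π = id) {U : Multiset κ} {T : Transition LE Act N}
    (h : Derives Prods U T) :
    ∃ (ι : Type) (_ : Fintype ι) (u : ι → Multiset κ) (B : ι → Transition LE Act N)
      (f g : ι → N → N), (∀ i, Basic Prods (u i) (B i)) ∧ U = ∑ i, u i ∧ IsDecomp B f g T := by
  induction h with
  | @prod k T hp hT =>
    refine ⟨Unit, inferInstance, fun _ => {k}, fun _ => T, fun _ => id, fun _ => id,
      fun _ => .prod hp hT, by simp, .single ?_⟩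
    rw [hπ k T hp]
    exact fun _ _ => rfl
  | @idle T hi hT =>
    exact ⟨Unit, inferInstance, fun _ => 0, fun _ => T, fun _ => id, fun _ => id,
      fun _ => .idle hi hT, by simp, .single fun x hx => (hi.label x hx).2⟩
  | par h₁ h₂ hp _ ih₁ ih₂ =>
    obtain ⟨ι₁, _, u₁, B₁, f₁, g₁, hB₁, rfl, hd₁⟩ := ih₁
    obtain ⟨ι₂, _, u₂, B₂, f₂, g₂, hB₂, rfl, hd₂⟩ := ih₂
    refine ⟨ι₁ ⊕ ι₂, inferInstance, Sum.elim u₁ u₂, _, _, _, ?_, by simp,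
      hd₁.par hd₂ (hd₁.mem_nodes hB₁ h₁.isSHR) (hd₂.mem_nodes hB₂ h₂.isSHR) hp⟩
    rintro (i | i)
    exacts [hB₁ i, hB₂ i]
  | merge σ ρ h hm _ ih =>
    obtain ⟨ι, _, u, B, f, g, hB, rfl, hd⟩ := ih
    exact ⟨ι, inferInstance, u, B, _, _, hB, rfl,
      hd.merge (fun i x hx c hc => (hB i).exposed_mem hx hc) h.isSHR hm⟩
  | @new U T T' x a ys h hn hT' ih =>
    obtain ⟨ι, _, u, B, f, g, hB, rfl, hd⟩ := ih
    -- the rule is a parallel composition with the transition of the isolated node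
    let T₂ : Transition LE Act N :=
      { Γ := {x}, G := 0, Λ := fun _ => (a, ys), π := id, Φ := insert x ys.toFinset, G' := 0 }
    have hxys : x ∉ ys := fun hx => hn.names_fresh x hx (by simp)
    have hp : T.IsPar T₂ T' := by
      refine ⟨?_, ?_, ?_, hn.label_old, ?_, ?_, ?_⟩
      · rw [Finset.disjoint_right]
        intro y hy
        have : y = x ∨ y ∈ ys := by simpa [T₂] using hy
        rcases this with rfl | hy
        · exact hn.node_fresh
        · exact fun h => hn.names_fresh y hy (Finset.mem_union_left _ h)
      · rw [hn.nodes]; ext; simp [T₂]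
      · simp [hn.source, T₂]
      · intro z hz
        rw [Finset.mem_singleton.1 hz]
        exact hn.label_new
      · rw [hn.target_nodes]; ext; simp [T₂]
      · simp [hn.target, T₂]
    have har : ys.length = ActionSet.ar a := by
      have := hT'.arity x (by simp [hn.nodes])
      rwa [hn.label_new.1] at this
    have hB₂ : Basic Prods 0 T₂ := .new x a ys rfl rfl rfl har rfl hn.nodup hxys rfl rfl
    have hd₂ : IsDecomp (fun _ : Unit => T₂) (fun _ => id) (fun _ => id) T₂ :=
      .single fun _ _ => rfl
    refine ⟨ι ⊕ Unit, inferInstance, Sum.elim u fun _ => 0, _, _, _, ?_, by simp,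
      hd.par hd₂ (hd.mem_nodes hB h.isSHR) (fun _ _ h => h) hp⟩
    rintro (i | i)
    exacts [hB i, hB₂]

end Normal

/-! ### Paths and amoeboids -/

section Wiring

variable {N : Type} [DecidableEq N]

/-- The number of edges attached to a node. -/
def Graph.deg (G : Graph Label N) (x : N) : ℕ := (G.filter fun e => x ∈ e.nodes).card

theorem Graph.deg_add (G H : Graph Label N) (x : N) :
    Graph.deg (G + H) x = G.deg x + H.deg x := by
  simp [Graph.deg, Multiset.filter_add]

theorem Graph.deg_sum {ι : Type*} (s : Finset ι) (G : ι → Graph Label N) (x : N) :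
    Graph.deg (∑ i ∈ s, G i) x = ∑ i ∈ s, (G i).deg x := by
  classical
  induction s using Finset.induction_on with
  | empty => simp [Graph.deg]
  | insert i s hi ih => rw [Finset.sum_insert hi, Finset.sum_insert hi, Graph.deg_add, ih]

theorem Graph.deg_eq_zero {G : Graph Label N} {x : N} : G.deg x = 0 ↔ x ∉ G.names := by
  simp [Graph.deg, Graph.mem_names, Multiset.filter_eq_nil]

theorem Graph.deg_pos {G : Graph Label N} {x : N} : 0 < G.deg x ↔ x ∈ G.names := by
  rw [Nat.pos_iff_ne_zero, Ne, Graph.deg_eq_zero, not_not]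

/-- Two nodes are attached to a common edge. -/
def Graph.Adj (G : Graph Label N) (x y : N) : Prop := ∃ e ∈ G, x ∈ e.nodes ∧ y ∈ e.nodes

/-- Paths to `b` from a given node, with their lists of nodes and of edges, built from the last edge
backwards. The edges are pairwise distinct as elements of the type of edges, which is stronger than
being distinct elements of a multiset. -/
inductive PathTo (M : Graph Label N) (b : N) : N → List N → List (Edge Label N) → Prop
  | nil : PathTo M b b [b] []
  | cons {a c : N} {e : Edge Label N} {ns : List N} {es : List (Edge Label N)} :
      PathTo M b c ns es → a ∈ e.nodes → c ∈ e.nodes → e ∈ M → a ∉ ns → e ∉ es →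
      PathTo M b a (a :: ns) (e :: es)

namespace PathTo

variable {M : Graph Label N} {a b : N} {ns : List N} {es : List (Edge Label N)}

theorem head (h : PathTo M b a ns es) : ns.head? = some a := by
  cases h <;> rfl

theorem isPath (h : PathTo M b a ns es) : IsPath M a b ns es := by
  have : ns.Nodup ∧ ns.getLast? = some b ∧ es.Nodup ∧ (∀ e ∈ es, e ∈ M) ∧
      List.Forall₂ (fun (e : Edge Label N) (p : N × N) => p.1 ∈ e.nodes ∧ p.2 ∈ e.nodes) es
        (ns.zip ns.tail) := by
    induction h with
    | nil => simp
    | @cons a c e ns es h ha hc he hns hes ih =>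
      obtain ⟨h1, h2, h3, h4, h5⟩ := ih
      have h6 := h.head
      cases ns with
      | nil => simp at h6
      | cons d ns =>
        simp only [List.head?_cons, Option.some.injEq] at h6
        subst h6
        refine ⟨List.nodup_cons.2 ⟨hns, h1⟩, ?_, List.nodup_cons.2 ⟨hes, h3⟩, ?_, ?_⟩
        · rw [List.getLast?_cons_cons]; exact h2
        · simpa using ⟨he, h4⟩
        · exact .cons ⟨ha, hc⟩ h5
  obtain ⟨h1, h2, h3, h4, h5⟩ := this
  exact ⟨h1, h.head, h2, (Multiset.le_iff_subset (Multiset.coe_nodup.2 h3)).2 fun e he => h4 e he,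
    h5⟩

theorem exists_node (h : PathTo M b a ns es) {e : Edge Label N} (he : e ∈ es) :
    ∃ x ∈ ns, x ∈ e.nodes := by
  induction h with
  | nil => simp at he
  | @cons a c e' ns es h ha hc _ _ _ ih =>
    rcases List.mem_cons.1 he with rfl | he
    · exact ⟨a, List.mem_cons_self, ha⟩
    · obtain ⟨x, hx, hxe⟩ := ih he
      exact ⟨x, List.mem_cons_of_mem _ hx, hxe⟩

/-- The part of a path from the last node attached to a given edge. -/
theorem exists_suffix (h : PathTo M b a ns es) (e : Edge Label N) (he : ∃ x ∈ ns, x ∈ e.nodes) :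
    ∃ c ns' es', PathTo M b c ns' es' ∧ c ∈ e.nodes ∧ (∀ x ∈ ns', x ∈ e.nodes → x = c) ∧
      e ∉ es' := by
  induction h with
  | nil =>
    obtain ⟨x, hx, hxe⟩ := he
    rw [List.mem_singleton] at hx
    subst hx
    exact ⟨x, [x], [], .nil, hxe, by simp, by simp⟩
  | @cons a c e' ns es h ha hc he' hns hes ih =>
    by_cases hex : ∃ x ∈ ns, x ∈ e.nodes
    · exact ih hex
    · have hae : a ∈ e.nodes := by
        obtain ⟨x, hx, hxe⟩ := he
        rcases List.mem_cons.1 hx with rfl | hx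
        · exact hxe
        · exact absurd ⟨x, hx, hxe⟩ hex
      refine ⟨a, _, _, .cons h ha hc he' hns hes, hae, ?_, ?_⟩
      · intro x hx hxe
        rcases List.mem_cons.1 hx with rfl | hx
        · rfl
        · exact absurd ⟨x, hx, hxe⟩ hex
      · intro hmem
        rcases List.mem_cons.1 hmem with rfl | hmem
        · exact hex ⟨c, List.mem_of_mem_head? h.head, hc⟩
        · exact hex (h.exists_node hmem)

end PathTo

/-- Connected nodes are joined by a path with distinct nodes and edges: to prepend an edge `e` to a
path, the path is cut at the last node attached to `e`. -/
theorem exists_isPath {M : Graph Label N} {a b : N} (h : Relation.ReflTransGen M.Adj a b) :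
    ∃ ns es, IsPath M a b ns es := by
  suffices ∃ ns es, PathTo M b a ns es by
    obtain ⟨ns, es, h⟩ := this
    exact ⟨ns, es, h.isPath⟩
  induction h using Relation.ReflTransGen.head_induction_on with
  | refl => exact ⟨_, _, .nil⟩
  | @head a a' h _ ih =>
    obtain ⟨e, he, hae, hae'⟩ := h
    obtain ⟨ns, es, hp⟩ := ih
    obtain ⟨c, ns', es', hp', hc, hns', hes'⟩ :=
      hp.exists_suffix e ⟨a', List.mem_of_mem_head? hp.head, hae'⟩
    by_cases hac : a = c
    · exact ⟨ns', es', hac ▸ hp'⟩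
    · exact ⟨_, _, .cons hp' hae hc he (fun h => hac (hns' a h hae)) hes'⟩

/-- A path on which red and other edges alternate and whose last edge is red has odd length if its
first edge is red. -/
theorem odd_length_of_alternating (red : Edge Label N → Prop) {M : Graph Label N} {b : N}
    (alt : ∀ e₁ e₂ y, ({e₁, e₂} : Multiset (Edge Label N)) ≤ M → y ∈ e₁.nodes → y ∈ e₂.nodes →
      (red e₁ ↔ ¬ red e₂))
    (last : ∀ e ∈ M, b ∈ e.nodes → red e) (es : List (Edge Label N)) :
    ∀ (ns : List N) (e : Edge Label N), (((e :: es : List (Edge Label N)) : Multiset _)) ≤ M →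
      ns.getLast? = some b →
      List.Forall₂ (fun (e : Edge Label N) (p : N × N) => p.1 ∈ e.nodes ∧ p.2 ∈ e.nodes)
        (e :: es) (ns.zip ns.tail) → (Odd (e :: es).length ↔ red e) := by
  induction es with
  | nil =>
    intro ns e hle hlast hp
    match ns, hp with
    | [x, y], hp =>
      simp only [List.getLast?_cons_cons, List.getLast?_singleton, Option.some.injEq] at hlast
      simp only [List.tail_cons, List.zip_cons_cons, List.zip_nil_right, List.forall₂_cons] at hp
      have : red e := last e (Multiset.mem_of_le hle (by simp)) (hlast ▸ hp.1.2)
      simp [this]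
    | x :: y :: z :: ns, hp => simp at hp
  | cons e' es ih =>
    intro ns e hle hlast hp
    match ns, hp with
    | [x, y], hp => simp at hp
    | x :: y :: z :: ns, hp =>
      rw [List.getLast?_cons_cons] at hlast
      simp only [List.tail_cons, List.zip_cons_cons, List.forall₂_cons] at hp
      have h1 : ((e' :: es : List (Edge Label N)) : Multiset _) ≤ M :=
        (Multiset.le_cons_self _ e).trans hle
      have := ih (y :: z :: ns) e' h1 hlast (by simpa using hp.2)
      have h2 := alt e e' y (le_trans (by
        rw [← Multiset.cons_coe, ← Multiset.cons_coe]
        exact Multiset.cons_le_cons e (Multiset.cons_le_cons e' (Multiset.zero_le _))) hle)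
        hp.1.2 hp.2.1.1
      rw [List.length_cons, Nat.odd_add_one, this, h2]

theorem nodes_ne_nil_of_label_m {e : Edge Label N} (h : ∃ k, e.label = Label.m k) :
    e.nodes ≠ [] := by
  obtain ⟨k, hk⟩ := h
  have := e.rank_eq
  rw [hk] at this
  intro h
  rw [h] at this
  simp [RankedAlphabet.rank] at this

theorem mem_closeAll {s : Finset N} {e : Edge Label N} :
    e ∈ closeAll s ↔ ∃ x ∈ s, nEdge x = e := by
  simp [closeAll]

theorem names_closeAll (s : Finset N) : Graph.names (closeAll s) = s := by
  ext x
  simp only [Graph.mem_names, mem_closeAll]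
  constructor
  · rintro ⟨_, ⟨y, hy, rfl⟩, hx⟩
    simp only [nEdge, List.mem_singleton] at hx
    exact hx ▸ hy
  · exact fun hx => ⟨_, ⟨x, hx, rfl⟩, by simp [nEdge]⟩

theorem deg_closeAll (s : Finset N) (x : N) :
    Graph.deg (closeAll s) x = if x ∈ s then 1 else 0 := by
  have h : Graph.deg (closeAll s) x = (s.filter fun y => x = y).card := by
    simp only [Graph.deg, closeAll, Multiset.filter_map, Multiset.card_map, Finset.card,
      Finset.filter_val, Function.comp_def, nEdge, List.mem_singleton]
  rw [h, Finset.filter_eq]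
  split_ifs <;> simp

theorem closeAll_union {s t : Finset N} (h : Disjoint s t) :
    closeAll (s ∪ t) = closeAll s + closeAll t := by
  rw [closeAll, closeAll, closeAll, ← Finset.disjUnion_eq_union _ _ h, Finset.disjUnion_val,
    Multiset.map_add]

theorem le_of_le_add_of_forall {α : Type*} {s t u : Multiset α} (h : s ≤ t + u) (p : α → Prop)
    (hs : ∀ a ∈ s, p a) (hu : ∀ a ∈ u, ¬ p a) : s ≤ t := by
  classical
  calc s = s.filter p := (Multiset.filter_eq_self.2 hs).symm
    _ ≤ (t + u).filter p := Multiset.filter_le_filter p h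
    _ = t.filter p := by rw [Multiset.filter_add, Multiset.filter_eq_nil.2 hu, add_zero]
    _ ≤ t := Multiset.filter_le _ _

/-- The edges all of whose nodes are in the class `c`. -/
def Graph.part (cls : N → N) (G : Graph Label N) (c : N) : Graph Label N :=
  G.filter fun e => ∀ x ∈ e.nodes, cls x = c

/-- Red and blue connectors that can be assembled to amoeboids: every node is attached to exactly
one red edge, and to at most one of the blue edges and the edges `n` on the nodes `D`. The classes
of `cls` are the connected components. -/
structure IsWiring (R B : Graph Label N) (D : Finset N) (cls : N → N) : Prop where
  label : ∀ e ∈ R + B, ∃ k, e.label = Label.m k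
  deg_red : ∀ x ∈ R.names, R.deg x = 1
  deg_blue : ∀ x ∈ B.names, B.deg x = 1
  blue_sub : B.names ⊆ R.names
  closed_sub : D ⊆ R.names
  disj : ∀ x ∈ D, x ∉ B.names
  ne : ∀ e ∈ R, e ∉ B
  cls_const : ∀ e ∈ R + B, ∀ x ∈ e.nodes, ∀ y ∈ e.nodes, cls x = cls y
  conn : ∀ x ∈ R.names, ∀ y ∈ R.names, cls x = cls y →
    Relation.ReflTransGen (Graph.Adj (R + B)) x y

namespace IsWiring

variable {R B : Graph Label N} {D : Finset N} {cls : N → N}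

theorem cls_eq (h : IsWiring R B D cls) {e : Edge Label N} (he : e ∈ R + B + closeAll D) :
    ∀ x ∈ e.nodes, ∀ y ∈ e.nodes, cls x = cls y := by
  rcases Multiset.mem_add.1 he with he | he
  · exact h.cls_const e he
  · obtain ⟨z, _, rfl⟩ := mem_closeAll.1 he
    simp [nEdge]

theorem nodes_ne_nil (h : IsWiring R B D cls) {e : Edge Label N}
    (he : e ∈ R + B + closeAll D) : e.nodes ≠ [] := by
  rcases Multiset.mem_add.1 he with he | he
  · exact nodes_ne_nil_of_label_m (h.label e he)
  · obtain ⟨z, _, rfl⟩ := mem_closeAll.1 he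
    simp [nEdge]

theorem mem_part (h : IsWiring R B D cls) {e : Edge Label N} (he : e ∈ R + B + closeAll D)
    {x : N} (hx : x ∈ e.nodes) : e ∈ Graph.part cls (R + B + closeAll D) (cls x) :=
  Multiset.mem_filter.2 ⟨he, fun y hy => h.cls_eq he y hy x hx⟩

theorem deg_part (h : IsWiring R B D cls) (x : N) :
    (Graph.part cls (R + B + closeAll D) (cls x)).deg x = (R + B + closeAll D).deg x := by
  rw [Graph.deg, Graph.deg, Graph.part, Multiset.filter_filter]
  congr 1
  refine Multiset.filter_congr fun e he => ⟨fun h => h.1, fun hx => ⟨hx, fun y hy => ?_⟩⟩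
  exact h.cls_eq he y hy x hx

theorem names_eq (h : IsWiring R B D cls) :
    Graph.names (R + B + closeAll D) = R.names := by
  rw [Graph.names_add, Graph.names_add, names_closeAll, Finset.union_eq_left.2 h.blue_sub,
    Finset.union_eq_left.2 h.closed_sub]

theorem mem_names_part (h : IsWiring R B D cls) {c x : N} :
    x ∈ (Graph.part cls (R + B + closeAll D) c).names ↔ x ∈ R.names ∧ cls x = c := by
  rw [← h.names_eq]
  constructor
  · intro hx
    obtain ⟨e, he, hx⟩ := Graph.mem_names.1 hx
    obtain ⟨he, hc⟩ := Multiset.mem_filter.1 he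
    exact ⟨Graph.mem_names.2 ⟨e, he, hx⟩, hc x hx⟩
  · rintro ⟨hx, rfl⟩
    obtain ⟨e, he, hx⟩ := Graph.mem_names.1 hx
    exact Graph.mem_names.2 ⟨e, h.mem_part he hx, hx⟩

/-- The external nodes: those attached to a red edge only. -/
def ext (R B : Graph Label N) (D : Finset N) : Finset N := R.names \ (B.names ∪ D)

theorem adj_part (h : IsWiring R B D cls) {x y : N}
    (hxy : Relation.ReflTransGen (Graph.Adj (R + B)) x y) :
    cls y = cls x ∧ Relation.ReflTransGen
      (Graph.Adj (Graph.part cls (R + B + closeAll D) (cls x))) x y := by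
  induction hxy with
  | refl => exact ⟨rfl, .refl⟩
  | tail _ hyz ih =>
    obtain ⟨e, he, hy, hz⟩ := hyz
    refine ⟨(h.cls_const e he _ hz _ hy).trans ih.1, ih.2.tail ⟨e, ?_, hy, hz⟩⟩
    rw [← ih.1]
    exact h.mem_part (Multiset.mem_add.2 (.inl he)) hy

/-- Every component is an amoeboid: red and blue edges alternate on its paths, and the edges at
external nodes are red. -/
theorem isAmoeboid (h : IsWiring R B D cls) {c : N} (hc : ∃ x ∈ R.names, cls x = c) :
    IsAmoeboid ((ext R B D).filter fun x => cls x = c)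
      (Graph.part cls (R + B + closeAll D) c) where
  edges e he := by
    have he := (Multiset.mem_filter.1 he).1
    rcases Multiset.mem_add.1 he with he | he
    · exact .inl (h.label e he)
    · obtain ⟨z, _, rfl⟩ := mem_closeAll.1 he
      exact .inr rfl
  nonempty := by
    obtain ⟨x, hx, rfl⟩ := hc
    obtain ⟨e, he, hxe⟩ := Graph.mem_names.1 hx
    intro h0
    have := h.mem_part (Multiset.mem_add.2 (.inl (Multiset.mem_add.2 (.inl he)))) hxe
    rw [h0] at this
    exact Multiset.notMem_zero _ this
  connected a ha b hb := by
    obtain ⟨ha', rfl⟩ := h.mem_names_part.1 ha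
    obtain ⟨hb', hab⟩ := h.mem_names_part.1 hb
    exact exists_isPath (h.adj_part (h.conn a ha' b hb' hab.symm)).2
  external_sub x hx := by
    obtain ⟨hx', rfl⟩ := Finset.mem_filter.1 hx
    exact h.mem_names_part.2 ⟨(Finset.mem_sdiff.1 hx').1, rfl⟩
  external x hx := by
    obtain ⟨hx₀, rfl⟩ := Finset.mem_filter.1 hx
    obtain ⟨hx, hx'⟩ := Finset.mem_sdiff.1 hx₀
    rw [Finset.mem_union, not_or] at hx'
    have := h.deg_part x
    rw [Graph.deg_add, Graph.deg_add, h.deg_red x hx, Graph.deg_eq_zero.2 hx'.1, deg_closeAll,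
      if_neg hx'.2] at this
    exact this
  internal x hx := by
    obtain ⟨hx₀, hx'⟩ := Finset.mem_sdiff.1 hx
    obtain ⟨hx₁, rfl⟩ := h.mem_names_part.1 hx₀
    have := h.deg_part x
    rw [Graph.deg_add, Graph.deg_add, h.deg_red x hx₁, deg_closeAll] at this
    refine this.trans ?_
    by_cases hB : x ∈ B.names
    · rw [h.deg_blue x hB, if_neg fun hD => h.disj x hD hB]
    · rw [Graph.deg_eq_zero.2 hB, if_pos]
      by_contra hD
      exact hx' (Finset.mem_filter.2
        ⟨Finset.mem_sdiff.2 ⟨hx₁, by simp [Finset.mem_union, hB, hD]⟩, rfl⟩)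
  odd a ha b hb hab ns es hp := by
    classical
    obtain ⟨ha, -⟩ := Finset.mem_filter.1 ha
    obtain ⟨hb, -⟩ := Finset.mem_filter.1 hb
    simp only [ext, Finset.mem_sdiff, Finset.mem_union, not_or] at ha hb
    obtain ⟨hnd, hhead, hlast, hle, hes⟩ := hp
    -- an edge `n` cannot be passed
    have hn : ∀ e ∈ es, e ∈ R + B := by
      intro e he
      have hmem := (Multiset.mem_filter.1 (Multiset.mem_of_le hle he)).1
      refine (Multiset.mem_add.1 hmem).resolve_right fun hmem => ?_
      obtain ⟨z, _, rfl⟩ := mem_closeAll.1 hmem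
      have hstep : ∀ (ns : List N) (es : List (Edge Label N)), ns.Nodup →
          List.Forall₂ (fun (e : Edge Label N) (p : N × N) => p.1 ∈ e.nodes ∧ p.2 ∈ e.nodes) es
            (ns.zip ns.tail) → nEdge z ∉ es := by
        intro ns
        induction ns with
        | nil => intro es _ hes; simp at hes; simp [hes]
        | cons x ns ih =>
          cases ns with
          | nil => intro es _ hes; simp at hes; simp [hes]
          | cons y ns =>
            intro es hnd hes
            simp only [List.tail_cons, List.zip_cons_cons] at hes
            cases hes with
            | cons h1 h2 =>
              intro hmem
              rcases List.mem_cons.1 hmem with rfl | hmem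
              · simp only [nEdge, List.mem_singleton] at h1
                simp [h1.1, h1.2] at hnd
              · exact ih _ (List.nodup_cons.1 hnd).2 (by simpa using h2) hmem
      exact hstep ns es hnd hes he
    have hle' : (es : Multiset (Edge Label N)) ≤ R + B := by
      refine le_of_le_add_of_forall (hle.trans (Multiset.filter_le _ _)) (fun e => e ∈ R + B) hn ?_
      intro e he hRB
      obtain ⟨z, _, rfl⟩ := mem_closeAll.1 he
      obtain ⟨k, hk⟩ := h.label _ hRB
      cases hk
    match es, ns, hhead, hlast, hes, hle' with
    | [], ns, hhead, hlast, hes, _ =>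
      match ns, hhead, hlast, hes with
      | [x], hhead, hlast, _ =>
        simp at hhead hlast
        exact absurd (hhead.symm.trans hlast) hab
      | x :: y :: ns, _, _, hes => simp at hes
    | e :: es, ns, hhead, hlast, hes, hle' =>
      -- two distinct edges of the same colour share no node
      have pair : ∀ (F F' : Graph Label N), (∀ e ∈ F', e ∉ F) → ∀ e₁ e₂ : Edge Label N, e₁ ∈ F →
          e₂ ∈ F → ({e₁, e₂} : Multiset (Edge Label N)) ≤ F + F' → ∀ y ∈ e₁.nodes, y ∈ e₂.nodes →
          2 ≤ F.deg y := by
        intro F F' hF e₁ e₂ h1 h2 hle y hy1 hy2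
        have h3 := le_of_le_add_of_forall hle (fun e => e ∈ F) (by simp [h1, h2]) hF
        have h4 := Multiset.card_le_card
          (Multiset.filter_le_filter (fun e : Edge Label N => y ∈ e.nodes) h3)
        rw [Multiset.filter_eq_self.2] at h4
        · simpa [Graph.deg] using h4
        · simp [hy1, hy2]
      refine (odd_length_of_alternating (fun e => e ∈ R) (M := R + B) (b := b) ?_ ?_ es ns e hle'
        hlast hes).2 ?_
      · intro e₁ e₂ y hle hy1 hy2
        constructor
        · intro h1 h2
          have := pair R B (fun e he he' => h.ne e he' he) e₁ e₂ h1 h2 hle y hy1 hy2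
          rw [h.deg_red y (Graph.mem_names.2 ⟨_, h1, hy1⟩)] at this
          omega
        · intro h2
          by_contra h1
          have h1 := (Multiset.mem_add.1 (Multiset.mem_of_le hle (by simp))).resolve_left h1
          have h2 := (Multiset.mem_add.1 (Multiset.mem_of_le hle (by simp))).resolve_left h2
          rw [add_comm R B] at hle
          have := pair B R h.ne e₁ e₂ h1 h2 hle y hy1 hy2
          rw [h.deg_blue y (Graph.mem_names.2 ⟨_, h1, hy1⟩)] at this
          omega
      · intro e he hbe
        exact (Multiset.mem_add.1 he).resolve_right fun he =>
          hb.2.1 (Graph.mem_names.2 ⟨e, he, hbe⟩)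
      · have he : e ∈ R + B := hn e List.mem_cons_self
        refine (Multiset.mem_add.1 he).resolve_right fun he =>
          ha.2.1 (Graph.mem_names.2 ⟨e, he, ?_⟩)
        match ns, hhead, hes with
        | [x], _, hes => simp at hes
        | x :: y :: ns, hhead, hes =>
          simp only [List.head?_cons, Option.some.injEq] at hhead
          simp only [List.tail_cons, List.zip_cons_cons, List.forall₂_cons] at hes
          exact hhead ▸ hes.1.1

end IsWiring

/-! ### Connectors of substitutions -/

theorem mem_connector {x : N} {l : List N} {e : Edge Label N} (he : e ∈ connector x l) :
    (∃ k, e.label = Label.m k) ∧ e.nodes = x :: l ∧ l ≠ [] := by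
  cases l with
  | nil => simp [connector] at he
  | cons y l =>
    simp only [connector, Multiset.mem_singleton] at he
    subst he
    exact ⟨⟨_, rfl⟩, rfl, by simp⟩

theorem exists_mem_connector (x : N) {l : List N} (hl : l ≠ []) : ∃ e, connector x l = {e} := by
  cases l with
  | nil => exact absurd rfl hl
  | cons y l => exact ⟨_, rfl⟩

theorem mem_translSubst {w : List N} {σ : N → N} {e : Edge Label N} (he : e ∈ translSubst w σ) :
    (∃ k, e.label = Label.m k) ∧
      ∃ y ∈ w, e.nodes = σ y :: w.filter fun z => σ z = σ y := by
  obtain ⟨x, hx, he⟩ := Multiset.mem_sum.1 he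
  obtain ⟨y, hy, rfl⟩ := Finset.mem_image.1 hx
  obtain ⟨h1, h2, -⟩ := mem_connector he
  exact ⟨h1, y, List.mem_toFinset.1 hy, h2⟩

theorem exists_mem_translSubst {w : List N} (σ : N → N) {y : N} (hy : y ∈ w) :
    ∃ e ∈ translSubst w σ, e.nodes = σ y :: w.filter fun z => σ z = σ y := by
  have hl : w.filter (fun z => σ z = σ y) ≠ [] :=
    List.ne_nil_of_mem (List.mem_filter.2 ⟨hy, by simp⟩)
  obtain ⟨e, he⟩ := exists_mem_connector (σ y) hl
  have he' : e ∈ connector (σ y) (w.filter fun z => σ z = σ y) := by rw [he]; simp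
  exact ⟨e, Multiset.mem_sum.2 ⟨σ y, Finset.mem_image_of_mem _ (List.mem_toFinset.2 hy), he'⟩,
    (mem_connector he').2.1⟩

theorem mem_names_translSubst {w : List N} {σ : N → N} {x : N} :
    x ∈ (translSubst w σ).names ↔ x ∈ w ∨ ∃ y ∈ w, σ y = x := by
  rw [Graph.mem_names]
  constructor
  · rintro ⟨e, he, hx⟩
    obtain ⟨-, y, hy, hn⟩ := mem_translSubst he
    rw [hn, List.mem_cons] at hx
    rcases hx with rfl | hx
    · exact .inr ⟨y, hy, rfl⟩
    · exact .inl (List.mem_filter.1 hx).1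
  · rintro (hx | ⟨y, hy, rfl⟩)
    · obtain ⟨e, he, hn⟩ := exists_mem_translSubst σ hx
      exact ⟨e, he, by simp [hn, hx]⟩
    · obtain ⟨e, he, hn⟩ := exists_mem_translSubst σ hy
      exact ⟨e, he, by simp [hn]⟩

theorem deg_translSubst {w : List N} {σ : N → N} (h : ∀ y ∈ w, σ y ∉ w) {x : N}
    (hx : x ∈ (translSubst w σ).names) : (translSubst w σ).deg x = 1 := by
  have hdeg : ∀ c ∈ w.toFinset.image σ, (connector c (w.filter fun y => σ y = c)).deg x =
      if x = c ∨ x ∈ w ∧ σ x = c then 1 else 0 := by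
    intro c hc
    obtain ⟨y, hy, rfl⟩ := Finset.mem_image.1 hc
    have hl : w.filter (fun z => σ z = σ y) ≠ [] :=
      List.ne_nil_of_mem (List.mem_filter.2 ⟨List.mem_toFinset.1 hy, by simp⟩)
    obtain ⟨e, he⟩ := exists_mem_connector (σ y) hl
    have he' : e ∈ connector (σ y) (w.filter fun z => σ z = σ y) := by rw [he]; simp
    rw [he, Graph.deg, Multiset.filter_singleton, (mem_connector he').2.1]
    simp only [List.mem_cons, List.mem_filter, decide_eq_true_eq]
    split_ifs <;> rfl
  rw [translSubst, Graph.deg_sum, Finset.sum_congr rfl hdeg]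
  rcases mem_names_translSubst.1 hx with hx | ⟨y, hy, rfl⟩
  · rw [Finset.sum_eq_single (σ x)]
    · simp [hx]
    · intro c hc hne
      obtain ⟨y, hy, rfl⟩ := Finset.mem_image.1 hc
      refine if_neg ?_
      rintro (rfl | ⟨-, h2⟩)
      · exact h y (List.mem_toFinset.1 hy) hx
      · exact hne h2.symm
    · intro hn
      exact absurd (Finset.mem_image_of_mem _ (List.mem_toFinset.2 hx)) hn
  · rw [Finset.sum_eq_single (σ y)]
    · simp
    · intro c _ hne
      refine if_neg ?_
      rintro (rfl | ⟨h1, -⟩)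
      · exact hne rfl
      · exact h y hy h1
    · intro hn
      exact absurd (Finset.mem_image_of_mem _ (List.mem_toFinset.2 hy)) hn

/-! ### Replacing simple amoeboids by components of a wiring -/

theorem Realizes.add_sum_pseudo {H X : Graph Label N} (cls : N → N) (M : N → Graph Label N)
    (C : Finset N) (hX : Realizes H X) (hM : ∀ c ∈ C, IsAmoeboid ∅ (M c))
    (hcls : ∀ c ∈ C, ∀ x ∈ (M c).names, cls x = c)
    (hdisj : ∀ c ∈ C, ∀ x ∈ (M c).names, x ∉ X.names) : Realizes H (X + ∑ c ∈ C, M c) := by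
  induction C using Finset.induction_on with
  | empty => simpa using hX
  | insert c C hc ih =>
    have mono : ∀ {d}, d ∈ C → d ∈ insert c C := fun h => Finset.mem_insert_of_mem h
    rw [Finset.sum_insert hc, add_comm (M c), ← add_assoc]
    refine .pseudo _ _ (ih (fun d hd => hM d (mono hd)) (fun d hd => hcls d (mono hd))
      fun d hd => hdisj d (mono hd)) (hM c (Finset.mem_insert_self _ _)) ?_
    rw [Finset.disjoint_left]
    intro x hx hx'
    rw [Graph.names_add, Finset.mem_union, Graph.mem_names_sum] at hx'
    rcases hx' with hx' | ⟨d, hd, hx'⟩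
    · exact hdisj c (Finset.mem_insert_self _ _) x hx hx'
    · have h1 := hcls c (Finset.mem_insert_self _ _) x hx
      have h2 := hcls d (mono hd) x hx'
      exact hc (h1.symm.trans h2 ▸ hd)

/-- Simple amoeboids can be replaced one at a time; the function `cls` separates their nodes. -/
theorem Realizes.sum_amoeboids {A : Graph Label N} (cls : N → N) (M : N → Graph Label N)
    (y : N → N) (l : N → List N) (C : Finset N) (hnd : ∀ c ∈ C, (c :: y c :: l c).Nodup)
    (hM : ∀ c ∈ C, IsAmoeboid (c :: y c :: l c).toFinset (M c))
    (hcls : ∀ c ∈ C, ∀ x ∈ (M c).names, cls x = c)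
    (hdisj : ∀ c ∈ C, ∀ x ∈ (M c).names \ (c :: y c :: l c).toFinset, x ∉ A.names) :
    Realizes (A + ∑ c ∈ C, {mEdge c (y c) (l c)}) (A + ∑ c ∈ C, M c) := by
  suffices h : ∀ C' ⊆ C, Realizes (A + ∑ c ∈ C, {mEdge c (y c) (l c)})
      (A + ∑ c ∈ C \ C', {mEdge c (y c) (l c)} + ∑ c ∈ C', M c) by
    simpa using h C subset_rfl
  intro C' hC'
  induction C' using Finset.induction_on with
  | empty => simpa using Realizes.refl
  | insert c C' hc ih =>
    have hcC : c ∈ C := hC' (Finset.mem_insert_self _ _)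
    have ih := ih ((Finset.subset_insert _ _).trans hC')
    have hsplit : C \ C' = insert c (C \ insert c C') := by
      ext z
      simp only [Finset.mem_sdiff, Finset.mem_insert, not_or]
      constructor
      · rintro ⟨h1, h2⟩
        by_cases hz : z = c
        · exact .inl hz
        · exact .inr ⟨h1, hz, h2⟩
      · rintro (rfl | ⟨h1, _, h2⟩)
        · exact ⟨hcC, hc⟩
        · exact ⟨h1, h2⟩
    rw [hsplit, Finset.sum_insert (by simp)] at ih
    have ih' : Realizes (A + ∑ c ∈ C, {mEdge c (y c) (l c)})
        ((A + ∑ c ∈ C \ insert c C', {mEdge c (y c) (l c)} + ∑ c ∈ C', M c) +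
          {mEdge c (y c) (l c)}) := by
      convert ih using 1
      abel
    have := Realizes.amoeboid _ (M c) c (y c) (l c) ih' (hnd c hcC) (hM c hcC) ?_
    · rw [Finset.sum_insert hc]
      convert this using 1
      abel
    · rw [Finset.disjoint_left]
      intro x hx hx'
      have hxc := hcls c hcC x (Finset.mem_sdiff.1 hx).1
      rw [Graph.names_add, Graph.names_add, Finset.mem_union, Finset.mem_union,
        Graph.mem_names_sum, Graph.mem_names_sum] at hx'
      rcases hx' with (hx' | ⟨d, hd, hx'⟩) | ⟨d, hd, hx'⟩
      · exact hdisj c hcC x hx hx'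
      · obtain ⟨hd, hd'⟩ := Finset.mem_sdiff.1 hd
        obtain ⟨e, he, hxe⟩ := Graph.mem_names.1 hx'
        rw [Multiset.mem_singleton] at he
        subst he
        have := hcls d hd x ((hM d hd).external_sub (List.mem_toFinset.2 hxe))
        exact hd' (by rw [← this, hxc]; exact Finset.mem_insert_self _ _)
      · have := hcls d (hC' (Finset.mem_insert_of_mem hd)) x hx'
        exact hc (hxc.symm.trans this ▸ hd)

/-- A graph is the sum of its parts if every edge lies within a single class. -/
theorem sum_part (cls : N → N) (G : Graph Label N) (C : Finset N)
    (hC : ∀ e ∈ G, ∃! c, c ∈ C ∧ ∀ x ∈ e.nodes, cls x = c) :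
    ∑ c ∈ C, Graph.part cls G c = G := by
  induction G using Multiset.induction_on with
  | empty => simp [Graph.part]
  | cons e G ih =>
    have ih := ih fun e' he' => hC e' (Multiset.mem_cons_of_mem he')
    obtain ⟨c, ⟨hc, hec⟩, huniq⟩ := hC e (Multiset.mem_cons_self e G)
    have : ∀ d ∈ C, Graph.part cls (e ::ₘ G) d =
        (if d = c then {e} else 0) + Graph.part cls G d := by
      intro d hd
      split_ifs with h
      · subst h
        rw [Graph.part, Multiset.filter_cons_of_pos _ hec]
        rfl
      · rw [Graph.part, Multiset.filter_cons_of_neg, zero_add]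
        · rfl
        · exact fun h' => h (huniq d ⟨hd, h'⟩)
    rw [Finset.sum_congr rfl this, Finset.sum_add_distrib, ih, Finset.sum_ite_eq' C c, if_pos hc]
    rfl

/-- A wiring realizes the connectors of a substitution `σ` whose classes are those of the wiring,
next to a graph `A` that is attached to it at external nodes only. The components of the classes in
the image of `σ` replace the connectors, the other ones are pseudoamoeboids. -/
theorem IsWiring.realizes {R B A : Graph Label N} {D : Finset N} {cls : N → N}
    (h : IsWiring R B D cls) {w : List N} {σ : N → N} (hw : w.Nodup)
    (hleaf : ∀ y ∈ w, y ∈ IsWiring.ext R B D ∧ cls y = σ y)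
    (hhub : ∀ y ∈ w, σ y ∈ IsWiring.ext R B D ∧ cls (σ y) = σ y ∧ σ y ∉ w)
    (hext : ∀ x ∈ IsWiring.ext R B D, x ∈ w ∨ ∃ y ∈ w, σ y = x)
    (hA : ∀ x ∈ R.names, x ∈ A.names → x ∈ IsWiring.ext R B D) :
    Realizes (A + translSubst w σ) (A + (R + B + closeAll D)) := by
  set G := R + B + closeAll D with hG
  set C := R.names.image cls
  set C₁ := w.toFinset.image σ with hC₁
  have hC₁C : C₁ ⊆ C := by
    intro c hc
    obtain ⟨y, hy, rfl⟩ := Finset.mem_image.1 hc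
    have hy := List.mem_toFinset.1 hy
    exact Finset.mem_image.2 ⟨y, (Finset.mem_sdiff.1 (hleaf y hy).1).1, (hleaf y hy).2⟩
  have hsum : G = ∑ c ∈ C₁, Graph.part cls G c + ∑ c ∈ C \ C₁, Graph.part cls G c := by
    rw [add_comm, Finset.sum_sdiff hC₁C, sum_part]
    intro e he
    obtain ⟨x, hx⟩ := List.exists_mem_of_ne_nil _ (h.nodes_ne_nil he)
    refine ⟨cls x, ⟨Finset.mem_image_of_mem _ ?_, fun y hy => h.cls_eq he y hy x hx⟩,
      fun d hd => (hd.2 x hx).symm⟩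
    rw [← h.names_eq]
    exact Graph.mem_names.2 ⟨e, he, hx⟩
  have hfilter : ∀ c, ∃ y l, c ∈ C₁ → (w.filter fun y => σ y = c) = y :: l := by
    intro c
    by_cases hc : c ∈ C₁
    · obtain ⟨y, hy, rfl⟩ := Finset.mem_image.1 hc
      have hy' : y ∈ w.filter fun z => σ z = σ y :=
        List.mem_filter.2 ⟨List.mem_toFinset.1 hy, by simp⟩
      obtain ⟨z, l, hzl⟩ := List.exists_cons_of_ne_nil (List.ne_nil_of_mem hy')
      exact ⟨z, l, fun _ => hzl⟩
    · exact ⟨c, [], fun h => absurd h hc⟩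
  choose y l hyl using hfilter
  have htrans : translSubst w σ = ∑ c ∈ C₁, {mEdge c (y c) (l c)} := by
    rw [translSubst]
    refine Finset.sum_congr rfl fun c hc => ?_
    rw [hyl c hc]
    rfl
  have hext₁ : ∀ c ∈ C₁, (c :: y c :: l c).toFinset =
      (IsWiring.ext R B D).filter fun x => cls x = c := by
    intro c hc
    rw [← hyl c hc]
    obtain ⟨z, hz, rfl⟩ := Finset.mem_image.1 hc
    have hz := List.mem_toFinset.1 hz
    ext x
    simp only [List.toFinset_cons, Finset.mem_insert, List.mem_toFinset, List.mem_filter,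
      decide_eq_true_eq, Finset.mem_filter]
    constructor
    · rintro (rfl | ⟨hx, hxz⟩)
      · exact ⟨(hhub z hz).1, (hhub z hz).2.1⟩
      · exact ⟨(hleaf x hx).1, (hleaf x hx).2.trans hxz⟩
    · rintro ⟨hx, hxz⟩
      rcases hext x hx with hx | ⟨y, hy, rfl⟩
      · exact .inr ⟨hx, (hleaf x hx).2.symm.trans hxz⟩
      · exact .inl ((hhub y hy).2.1.symm.trans hxz)
  have hext₂ : ∀ c ∈ C \ C₁, (∅ : Finset N) = (IsWiring.ext R B D).filter fun x => cls x = c := by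
    intro c hc
    symm
    rw [Finset.filter_eq_empty_iff]
    rintro x hx rfl
    refine (Finset.mem_sdiff.1 hc).2 ?_
    rcases hext x hx with hx | ⟨y, hy, rfl⟩
    · rw [(hleaf x hx).2]
      exact Finset.mem_image_of_mem _ (List.mem_toFinset.2 hx)
    · rw [(hhub y hy).2.1]
      exact Finset.mem_image_of_mem _ (List.mem_toFinset.2 hy)
  have hne : ∀ c ∈ C, ∃ x ∈ R.names, cls x = c := fun c hc => Finset.mem_image.1 hc
  have hnames : ∀ c, ∀ x ∈ (Graph.part cls G c).names, x ∈ R.names ∧ cls x = c :=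
    fun c x hx => h.mem_names_part.1 hx
  rw [htrans, hsum, ← add_assoc]
  refine .add_sum_pseudo cls _ _ (.sum_amoeboids cls _ y l C₁ ?_ ?_ ?_ ?_) ?_ ?_ ?_
  · intro c hc
    rw [← hyl c hc, List.nodup_cons]
    obtain ⟨z, hz, rfl⟩ := Finset.mem_image.1 hc
    exact ⟨fun hmem => (hhub z (List.mem_toFinset.1 hz)).2.2 (List.mem_filter.1 hmem).1,
      hw.filter _⟩
  · intro c hc
    rw [hext₁ c hc]
    exact h.isAmoeboid (hne c (hC₁C hc))
  · exact fun c _ x hx => (hnames c x hx).2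
  · intro c hc x hx hxA
    obtain ⟨hx, hx'⟩ := Finset.mem_sdiff.1 hx
    obtain ⟨hx, hxc⟩ := hnames c x hx
    rw [hext₁ c hc] at hx'
    exact hx' (Finset.mem_filter.2 ⟨hA x hx hxA, hxc⟩)
  · intro c hc
    rw [hext₂ c hc]
    exact h.isAmoeboid (hne c (Finset.mem_sdiff.1 hc).1)
  · exact fun c _ x hx => (hnames c x hx).2
  · intro c hc x hx hxX
    obtain ⟨hx, hxc⟩ := hnames c x hx
    rw [Graph.names_add, Finset.mem_union, Graph.mem_names_sum] at hxX
    rcases hxX with hxA | ⟨d, hd, hxd⟩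
    · have : x ∈ (∅ : Finset N) := by
        rw [hext₂ c hc]
        exact Finset.mem_filter.2 ⟨hA x hx hxA, hxc⟩
      simp at this
    · have := (hnames d x hxd).2
      exact (Finset.mem_sdiff.1 hc).2 (hxc.symm.trans this ▸ hd)

end Wiring

/-! ### The target of a transition realizes a translation of the reduct -/

section Reduct

variable {N : Type} [DecidableEq N]

theorem IsTranslSeq.nodes {S : Agent N Empty} {e : Edge Label N} (h : IsTranslSeq S e) :
    e.nodes = S.occ := by
  obtain ⟨k, S', ρ, hS, rfl, rfl⟩ := h
  rw [occ_mapName, hS.2]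
  simp [lEdge, List.ofFn_eq_map]

theorem mem_names_translSeqs {Ss : List (Agent N Empty)} {es : List (Edge Label N)}
    (h : List.Forall₂ IsTranslSeq Ss es) {x : N} :
    x ∈ Graph.names (es : Graph Label N) ↔ x ∈ (parList Ss).occ := by
  rw [Graph.mem_names, occ_parList, List.mem_flatMap]
  induction h with
  | nil => simp
  | cons h _ ih =>
    simp only [Multiset.mem_coe, List.mem_cons, exists_eq_or_imp, h.nodes] at ih ⊢
    rw [ih]

/-- The continuation `K` of a reaction, renamed by `ξ` to fresh names, and a translation of `Kξ`
with parameters `v₁` and `(parList S₁).occ`. -/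
structure Cont (N : Type) [DecidableEq N] where
  K : Agent N Empty
  ξ : N → N
  v₁ : List N
  S₁ : List (Agent N Empty)
  e₁ : List (Edge Label N)
  σ₁ : N → N
  ξ_inj : ∀ x ∈ K.occ, ∀ y ∈ K.occ, ξ x = ξ y → x = y
  ξ_notMem : ∀ x ∈ K.occ, ξ x ∉ v₁ ∧ ξ x ∉ (parList S₁).occ
  K_cong : Cong (K.mapName ξ) (resList v₁ ((parList S₁).mapName σ₁))
  S₁_seq : ∀ S ∈ S₁, S.IsSequential
  S₁_transl : List.Forall₂ IsTranslSeq S₁ e₁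
  w₁_nodup : (parList S₁).occ.Nodup
  v₁_nodup : v₁.Nodup
  v₁_notMem : ∀ x ∈ v₁, x ∉ (parList S₁).occ

namespace Cont

/-- The names of the sequential processes in the continuation. -/
abbrev w₁ (C : Cont N) : List N := (parList C.S₁).occ

/-- The nodes that the production adds. -/
def fresh (C : Cont N) : Finset N := C.v₁.toFinset ∪ C.w₁.toFinset ∪ C.K.fn.image C.ξ

/-- The edges that the production adds for the continuation. -/
noncomputable def graph (C : Cont N) : Graph Label N :=
  (C.e₁ : Multiset (Edge Label N)) + translSubst C.w₁ C.σ₁ + closeAll C.v₁.toFinset +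
    translSubst C.K.fn.toList C.ξ

variable {C : Cont N}

theorem mem_fresh {z : N} :
    z ∈ C.fresh ↔ (z ∈ C.v₁ ∨ z ∈ C.w₁) ∨ ∃ y ∈ C.K.occ, C.ξ y = z := by
  simp only [fresh, Finset.mem_union, List.mem_toFinset, Finset.mem_image, mem_fn]

theorem fresh_ξ {y : N} (hy : y ∈ C.K.occ) : C.ξ y ∈ C.fresh := mem_fresh.2 (.inr ⟨y, hy, rfl⟩)

theorem fresh_v₁ {z : N} (hz : z ∈ C.v₁) : z ∈ C.fresh := mem_fresh.2 (.inl (.inl hz))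

theorem fresh_w₁ {z : N} (hz : z ∈ C.w₁) : z ∈ C.fresh := mem_fresh.2 (.inl (.inr hz))

theorem σ₁_mem {y : N} (hy : y ∈ C.w₁) : C.σ₁ y ∈ C.v₁ ∨ ∃ z ∈ C.K.occ, C.ξ z = C.σ₁ y := by
  by_cases h : C.σ₁ y ∈ C.v₁
  · exact .inl h
  · right
    have : C.σ₁ y ∈ (C.K.mapName C.ξ).occ := by
      rw [C.K_cong.mem_occ, mem_occ_resList, occ_mapName]
      exact ⟨List.mem_map_of_mem hy, h⟩
    rw [occ_mapName] at this
    simpa using this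

theorem ξ_mem {y : N} (hy : y ∈ C.K.occ) : ∃ z ∈ C.w₁, C.σ₁ z = C.ξ y := by
  have : C.ξ y ∈ (C.K.mapName C.ξ).occ := by
    rw [occ_mapName]
    exact List.mem_map_of_mem hy
  rw [C.K_cong.mem_occ, mem_occ_resList, occ_mapName] at this
  simpa using this.1

end Cont

/-- A process `(v)(Sr | S)σ` in which the sequential processes `S` with names `Wc` react: `K` is
the parallel composition of their continuations, `E` the equations between names of `Wc` (before
`σ` is applied) that are imposed, and `τ` their substitutive effect. The connectors `B₀` implement
the equations `E`. The sequential processes `Sr` and their edges `er` do not take part in the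
reaction. -/
structure Reduct (N : Type) [DecidableEq N] extends Cont N where
  v : List N
  w : List N
  Sr : List (Agent N Empty)
  er : List (Edge Label N)
  Wc : Finset N
  σ : N → N
  τ : N → N
  E : List (N × N)
  B₀ : Graph Label N
  v_nodup : v.Nodup
  v_disj_w : ∀ x ∈ v, x ∉ w
  σ_mem : ∀ y ∈ w, σ y ∈ v
  mem_w : ∀ y, y ∈ w ↔ y ∈ Wc ∨ y ∈ (parList Sr).occ
  wr_disj : ∀ y ∈ (parList Sr).occ, y ∉ Wc
  wr_nodup : (parList Sr).occ.Nodup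
  Sr_seq : ∀ S ∈ Sr, S.IsSequential
  Sr_transl : List.Forall₂ IsTranslSeq Sr er
  K_occ : ∀ x ∈ K.occ, x ∈ Wc
  fresh_notMem : ∀ x ∈ toCont.fresh, x ∉ v ∧ x ∉ w
  E_mem : ∀ p ∈ E, p.1 ∈ Wc ∧ p.2 ∈ Wc
  B₀_label : ∀ e ∈ B₀, ∃ k, e.label = Label.m k
  B₀_deg : ∀ x ∈ B₀.names, B₀.deg x = 1
  B₀_names : ∀ x ∈ B₀.names, x ∈ Wc ∧ x ∉ K.occ
  B₀_sound : ∀ e ∈ B₀, ∀ x ∈ e.nodes, ∀ y ∈ e.nodes, Relation.EqvGen (listRel E) x y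
  B₀_complete : ∀ p ∈ E, Relation.ReflTransGen B₀.Adj p.1 p.2
  τ_effect : IsSubstEffect (listRel (E.map fun p => (σ p.1, σ p.2))) τ

theorem EqvGen.mem_or_eq {α : Type*} {r : α → α → Prop} {s : α → Prop}
    (hr : ∀ a b, r a b → s a ∧ s b) {a b : α} (h : Relation.EqvGen r a b) :
    a = b ∨ s a ∧ s b := by
  induction h with
  | rel a b h => exact .inr (hr a b h)
  | refl => exact .inl rfl
  | symm _ _ _ ih => exact ih.imp Eq.symm And.symm
  | trans _ _ _ _ _ ih1 ih2 =>
    rcases ih1 with rfl | ih1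
    · exact ih2
    · rcases ih2 with rfl | ih2
      · exact .inr ih1
      · exact .inr ⟨ih1.1, ih2.2⟩

namespace Reduct

variable (X : Reduct N)

/-- The names of the remaining sequential processes. -/
abbrev wr : List N := (parList X.Sr).occ

theorem ξ_fresh {x : N} (hx : x ∈ X.K.occ) :
    X.ξ x ∉ X.v ∧ X.ξ x ∉ X.w ∧ X.ξ x ∉ X.v₁ ∧ X.ξ x ∉ X.w₁ := by
  have := X.fresh_notMem _ (Cont.fresh_ξ hx)
  exact ⟨this.1, this.2, X.ξ_notMem x hx⟩

theorem v₁_fresh {x : N} (hx : x ∈ X.v₁) : x ∉ X.v ∧ x ∉ X.w ∧ x ∉ X.w₁ := by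
  have := X.fresh_notMem _ (Cont.fresh_v₁ hx)
  exact ⟨this.1, this.2, X.v₁_notMem x hx⟩

theorem w₁_fresh {x : N} (hx : x ∈ X.w₁) : x ∉ X.v ∧ x ∉ X.w :=
  X.fresh_notMem _ (Cont.fresh_w₁ hx)

theorem wr_sub {y : N} (hy : y ∈ X.wr) : y ∈ X.w := (X.mem_w y).2 (.inr hy)

theorem Wc_sub {y : N} (hy : y ∈ X.Wc) : y ∈ X.w := (X.mem_w y).2 (.inl hy)

theorem K_sub {y : N} (hy : y ∈ X.K.occ) : y ∈ X.w := X.Wc_sub (X.K_occ y hy)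

theorem τ_idem (x : N) : X.τ (X.τ x) = X.τ x := X.τ_effect.1 x

theorem τ_moves {x : N} (h : X.τ x ≠ x) :
    (∃ y ∈ X.w, X.σ y = x) ∧ ∃ y ∈ X.w, X.σ y = X.τ x := by
  have h1 := (X.τ_effect.2 x (X.τ x)).1 (X.τ_idem x).symm
  have h2 := EqvGen.mem_or_eq (s := fun a => ∃ y ∈ X.w, X.σ y = a) (fun a b hab => by
    obtain ⟨p, hp, he⟩ := List.mem_map.1 hab
    cases he
    exact ⟨⟨p.1, X.Wc_sub (X.E_mem p hp).1, rfl⟩, ⟨p.2, X.Wc_sub (X.E_mem p hp).2, rfl⟩⟩) h1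
  exact h2.resolve_left fun h' => h h'.symm

theorem τ_eq_self {x : N} (hx : x ∉ X.v) : X.τ x = x := by
  by_contra h
  obtain ⟨⟨y, hy, rfl⟩, -⟩ := X.τ_moves h
  exact hx (X.σ_mem y hy)

theorem τσ_hub {y : N} (hy : y ∈ X.w) : ∃ z ∈ X.w, X.σ z = X.τ (X.σ y) := by
  by_cases h : X.τ (X.σ y) = X.σ y
  · exact ⟨y, hy, h.symm⟩
  · exact (X.τ_moves h).2

theorem τσ_mem {y : N} (hy : y ∈ X.w) : X.τ (X.σ y) ∈ X.v := by
  obtain ⟨z, hz, h⟩ := X.τσ_hub hy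
  exact h ▸ X.σ_mem z hz

open Classical in
/-- The renaming of the fresh free names of the continuation `Kξ` back to those of `Kστ`. -/
noncomputable def η (x : N) : N := if h : ∃ y ∈ X.K.occ, X.ξ y = x then X.τ (X.σ h.choose) else x

theorem η_ξ {y : N} (hy : y ∈ X.K.occ) : X.η (X.ξ y) = X.τ (X.σ y) := by
  have h : ∃ z ∈ X.K.occ, X.ξ z = X.ξ y := ⟨y, hy, rfl⟩
  rw [η, dif_pos h, X.ξ_inj _ h.choose_spec.1 y hy h.choose_spec.2]

theorem η_eq_self {x : N} (hx : ∀ y ∈ X.K.occ, X.ξ y ≠ x) : X.η x = x := by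
  rw [η, dif_neg]
  rintro ⟨y, hy, h⟩
  exact hx y hy h

/-- The class of a name: the name of the reduct that its component stands for. -/
noncomputable def cls (x : N) : N :=
  if x ∈ X.w then X.τ (X.σ x) else if x ∈ X.w₁ then X.τ (X.η (X.σ₁ x)) else X.τ (X.η x)

theorem cls_w {x : N} (hx : x ∈ X.w) : X.cls x = X.τ (X.σ x) := if_pos hx

theorem cls_w₁ {x : N} (hx : x ∈ X.w₁) : X.cls x = X.τ (X.η (X.σ₁ x)) := by
  rw [cls, if_neg (X.w₁_fresh hx).2, if_pos hx]

theorem cls_v {x : N} (hx : x ∈ X.v) : X.cls x = X.τ x := by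
  rw [cls, if_neg (X.v_disj_w x hx), if_neg fun h => (X.w₁_fresh h).1 hx, X.η_eq_self]
  rintro y hy rfl
  exact (X.ξ_fresh hy).1 hx

theorem cls_v₁ {x : N} (hx : x ∈ X.v₁) : X.cls x = x := by
  rw [cls, if_neg (X.v₁_fresh hx).2.1, if_neg (X.v₁_fresh hx).2.2, X.η_eq_self,
    X.τ_eq_self (X.v₁_fresh hx).1]
  rintro y hy rfl
  exact (X.ξ_fresh hy).2.2.1 hx

theorem cls_ξ {y : N} (hy : y ∈ X.K.occ) : X.cls (X.ξ y) = X.τ (X.σ y) := by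
  rw [cls, if_neg (X.ξ_fresh hy).2.1, if_neg (X.ξ_fresh hy).2.2.2, X.η_ξ hy, X.τ_idem]

theorem σ₁_fresh {y : N} (hy : y ∈ X.w₁) : X.σ₁ y ∉ X.v ∧ X.σ₁ y ∉ X.w ∧ X.σ₁ y ∉ X.w₁ := by
  rcases X.σ₁_mem hy with h | ⟨z, hz, h⟩
  · exact X.v₁_fresh h
  · rw [← h]
    have := X.ξ_fresh hz
    exact ⟨this.1, this.2.1, this.2.2.2⟩

theorem cls_σ₁ {y : N} (hy : y ∈ X.w₁) : X.cls (X.σ₁ y) = X.cls y := by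
  rw [X.cls_w₁ hy, cls, if_neg (X.σ₁_fresh hy).2.1, if_neg (X.σ₁_fresh hy).2.2]

/-- The class of a leaf is a restricted name of the reduct. -/
theorem cls_leaf {y : N} (hy : y ∈ X.w ∨ y ∈ X.w₁) :
    (∃ z ∈ X.w, X.σ z = X.cls y ∧ X.τ (X.cls y) = X.cls y) ∨
      (X.cls y ∈ X.v₁ ∧ ∃ z ∈ X.w₁, X.σ₁ z = X.cls y) := by
  rcases hy with hy | hy
  · obtain ⟨z, hz, h⟩ := X.τσ_hub hy
    exact .inl ⟨z, hz, by rw [X.cls_w hy, h], by rw [X.cls_w hy, X.τ_idem]⟩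
  · rcases X.σ₁_mem hy with h | ⟨z, hz, h⟩
    · have : X.cls y = X.σ₁ y := by rw [← X.cls_σ₁ hy, X.cls_v₁ h]
      exact .inr ⟨this ▸ h, y, hy, this.symm⟩
    · have : X.cls y = X.τ (X.σ z) := by rw [← X.cls_σ₁ hy, ← h, X.cls_ξ hz]
      obtain ⟨z', hz', h'⟩ := X.τσ_hub (X.K_sub hz)
      exact .inl ⟨z', hz', by rw [this, h'], by rw [this, X.τ_idem]⟩

/-- The connectors of the translations of the source and of the continuation. -/
def R : Graph Label N := translSubst X.w X.σ + translSubst X.w₁ X.σ₁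

/-- The connectors that link the names of the continuation to those of the source, and those that
implement the equations. -/
noncomputable def B : Graph Label N := translSubst X.K.fn.toList X.ξ + X.B₀

/-- The restricted names that are kept: representatives of classes, except for those whose
occurrences have all been consumed. -/
def Kept (c : N) : Prop :=
  X.τ c = c ∧ ((∀ y ∈ X.w, X.σ y ≠ c) ∨ ∃ y ∈ X.wr ++ X.w₁, X.cls y = c)

open Classical in
/-- The parameter `v` of the translation of the reduct. -/
noncomputable def v' : List N := (X.v.filter fun c => X.Kept c) ++ X.v₁

open Classical in
/-- The nodes that an edge `n` makes internal. -/
noncomputable def D : Finset N :=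
  (X.Wc \ (X.B₀.names ∪ X.K.fn)) ∪ X.v.toFinset.filter fun c => ¬ X.Kept c

theorem mem_fn_toList {y : N} : y ∈ X.K.fn.toList ↔ y ∈ X.K.occ := by
  rw [Finset.mem_toList, mem_fn]

theorem mem_R {x : N} : x ∈ X.R.names ↔
    (x ∈ X.w ∨ ∃ y ∈ X.w, X.σ y = x) ∨ (x ∈ X.w₁ ∨ ∃ y ∈ X.w₁, X.σ₁ y = x) := by
  rw [R, Graph.names_add, Finset.mem_union, mem_names_translSubst, mem_names_translSubst]

theorem mem_B {x : N} : x ∈ X.B.names ↔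
    (x ∈ X.K.occ ∨ ∃ y ∈ X.K.occ, X.ξ y = x) ∨ x ∈ X.B₀.names := by
  rw [B, Graph.names_add, Finset.mem_union, mem_names_translSubst]
  simp only [mem_fn_toList]

theorem B_sub {x : N} (hx : x ∈ X.B.names) : x ∈ X.Wc ∨ ∃ y ∈ X.K.occ, X.ξ y = x := by
  rcases X.mem_B.1 hx with (hx | hx) | hx
  · exact .inl (X.K_occ x hx)
  · exact .inr hx
  · exact .inl (X.B₀_names x hx).1

theorem notMem_B_of_v {x : N} (hx : x ∈ X.v) : x ∉ X.B.names := by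
  intro h
  rcases X.B_sub h with h | ⟨y, hy, rfl⟩
  · exact X.v_disj_w x hx (X.Wc_sub h)
  · exact (X.ξ_fresh hy).1 hx

theorem notMem_B_of_v₁ {x : N} (hx : x ∈ X.v₁) : x ∉ X.B.names := by
  intro h
  rcases X.B_sub h with h | ⟨y, hy, rfl⟩
  · exact (X.v₁_fresh hx).2.1 (X.Wc_sub h)
  · exact (X.ξ_fresh hy).2.2.1 hx

theorem mem_D {x : N} : x ∈ X.D ↔
    (x ∈ X.Wc ∧ x ∉ X.B₀.names ∧ x ∉ X.K.occ) ∨ (x ∈ X.v ∧ ¬ X.Kept x) := by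
  simp only [D, Finset.mem_union, Finset.mem_sdiff, Finset.mem_filter, List.mem_toFinset, mem_fn,
    not_or]

theorem mem_ext {x : N} : x ∈ IsWiring.ext X.R X.B X.D ↔
    x ∈ X.R.names ∧ x ∉ X.B.names ∧ x ∉ X.D := by
  simp only [IsWiring.ext, Finset.mem_sdiff, Finset.mem_union, not_or]

theorem leaf_ext {y : N} (hy : y ∈ X.wr ++ X.w₁) : y ∈ IsWiring.ext X.R X.B X.D := by
  rw [mem_ext, mem_R, mem_D]
  rcases List.mem_append.1 hy with hy | hy
  · refine ⟨.inl (.inl (X.wr_sub hy)), fun h => ?_, ?_⟩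
    · rcases X.B_sub h with h | ⟨z, hz, rfl⟩
      · exact X.wr_disj y hy h
      · exact (X.ξ_fresh hz).2.1 (X.wr_sub hy)
    · rintro (⟨h, -⟩ | ⟨h, -⟩)
      · exact X.wr_disj y hy h
      · exact X.v_disj_w y h (X.wr_sub hy)
  · refine ⟨.inr (.inl hy), fun h => ?_, ?_⟩
    · rcases X.B_sub h with h | ⟨z, hz, rfl⟩
      · exact (X.w₁_fresh hy).2 (X.Wc_sub h)
      · exact (X.ξ_fresh hz).2.2.2 hy
    · rintro (⟨h, -⟩ | ⟨h, -⟩)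
      · exact (X.w₁_fresh hy).2 (X.Wc_sub h)
      · exact (X.w₁_fresh hy).1 h

theorem leaf_sub {y : N} (hy : y ∈ X.wr ++ X.w₁) : y ∈ X.w ∨ y ∈ X.w₁ :=
  (List.mem_append.1 hy).imp_left X.wr_sub

theorem notMem_D_of_v₁ {x : N} (hx : x ∈ X.v₁) : x ∉ X.D := by
  rw [mem_D]
  rintro (⟨h, -⟩ | ⟨h, -⟩)
  · exact (X.v₁_fresh hx).2.1 (X.Wc_sub h)
  · exact (X.v₁_fresh hx).1 h

theorem notMem_D_of_kept {x : N} (hx : x ∈ X.v) (hk : X.Kept x) : x ∉ X.D := by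
  rw [mem_D]
  rintro (⟨h, -⟩ | ⟨-, h⟩)
  · exact X.v_disj_w x hx (X.Wc_sub h)
  · exact h hk

theorem mem_v' {x : N} : x ∈ X.v' ↔ (x ∈ X.v ∧ X.Kept x) ∨ x ∈ X.v₁ := by
  simp [v', List.mem_append, List.mem_filter]

theorem cls_leaf_mem {y : N} (hy : y ∈ X.wr ++ X.w₁) :
    X.cls y ∈ X.v' ∧ X.cls y ∈ X.R.names ∧ X.cls (X.cls y) = X.cls y := by
  rw [mem_v', mem_R]
  rcases X.cls_leaf (X.leaf_sub hy) with ⟨z, hz, h, h'⟩ | ⟨h, h'⟩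
  · have hv : X.cls y ∈ X.v := h ▸ X.σ_mem z hz
    exact ⟨.inl ⟨hv, h', .inr ⟨y, hy, rfl⟩⟩, .inl (.inr ⟨z, hz, h⟩), by rw [X.cls_v hv, h']⟩
  · exact ⟨.inr h, .inr (.inr h'), X.cls_v₁ h⟩

theorem v'_ext {x : N} (hx : x ∈ X.v') (hR : x ∈ X.R.names) :
    x ∈ IsWiring.ext X.R X.B X.D := by
  rw [mem_ext]
  rcases X.mem_v'.1 hx with ⟨h, hk⟩ | h
  · exact ⟨hR, X.notMem_B_of_v h, X.notMem_D_of_kept h hk⟩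
  · exact ⟨hR, X.notMem_B_of_v₁ h, X.notMem_D_of_v₁ h⟩

theorem v'_notMem {x : N} (hx : x ∈ X.v') : x ∉ X.wr ++ X.w₁ := by
  intro h
  rcases X.mem_v'.1 hx with ⟨h1, -⟩ | h1 <;> rcases X.leaf_sub h with h2 | h2
  · exact X.v_disj_w x h1 h2
  · exact (X.w₁_fresh h2).1 h1
  · exact (X.v₁_fresh h1).2.1 h2
  · exact (X.v₁_fresh h1).2.2 h2

theorem adj_R {y : N} (hy : y ∈ X.w) : Graph.Adj (X.R + X.B) y (X.σ y) := by
  obtain ⟨e, he, hn⟩ := exists_mem_translSubst X.σ hy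
  exact ⟨e, by simp [R, he], by simp [hn, hy], by simp [hn]⟩

theorem adj_R₁ {y : N} (hy : y ∈ X.w₁) : Graph.Adj (X.R + X.B) y (X.σ₁ y) := by
  obtain ⟨e, he, hn⟩ := exists_mem_translSubst X.σ₁ hy
  exact ⟨e, by simp [R, he], by simp [hn, hy], by simp [hn]⟩

theorem adj_B {y : N} (hy : y ∈ X.K.occ) : Graph.Adj (X.R + X.B) (X.ξ y) y := by
  obtain ⟨e, he, hn⟩ := exists_mem_translSubst X.ξ (X.mem_fn_toList.2 hy)
  exact ⟨e, by simp [B, he], by simp [hn], by simp [hn, mem_fn, hy]⟩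

theorem reach_symm {G : Graph Label N} {x y : N} (h : Relation.ReflTransGen G.Adj x y) :
    Relation.ReflTransGen G.Adj y x := by
  induction h with
  | refl => exact .refl
  | tail _ h ih =>
    obtain ⟨e, he, h1, h2⟩ := h
    exact .head ⟨e, he, h2, h1⟩ ih

/-- Hubs fused by `τ` are connected through the connectors implementing the equations. -/
theorem reach_of_τ_eq {c d : N} (h : X.τ c = X.τ d) :
    Relation.ReflTransGen (Graph.Adj (X.R + X.B)) c d := by
  have := (X.τ_effect.2 c d).1 h
  clear h
  induction this with
  | rel c d h =>
    obtain ⟨p, hp, he⟩ := List.mem_map.1 h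
    cases he
    refine .head (b := p.1) ?_ (.tail (b := p.2) ?_ (X.adj_R (X.Wc_sub (X.E_mem p hp).2)))
    · obtain ⟨e, he, h1, h2⟩ := X.adj_R (X.Wc_sub (X.E_mem p hp).1)
      exact ⟨e, he, h2, h1⟩
    · refine Relation.ReflTransGen.mono ?_ _ _ (X.B₀_complete p hp)
      rintro a b ⟨e, he, hab⟩
      exact ⟨e, by simp [B, he], hab⟩
  | refl => exact .refl
  | symm _ _ _ ih => exact reach_symm ih
  | trans _ _ _ _ _ ih1 ih2 => exact ih1.trans ih2

/-- Every node is connected to a restricted name. -/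
theorem exists_anchor {x : N} (hx : x ∈ X.R.names) : ∃ c, (c ∈ X.v ∨ c ∈ X.v₁) ∧
    Relation.ReflTransGen (Graph.Adj (X.R + X.B)) x c ∧ X.cls c = X.cls x := by
  have hw : ∀ y ∈ X.w, X.cls (X.σ y) = X.cls y := fun y hy => by
    rw [X.cls_w hy, X.cls_v (X.σ_mem y hy)]
  have hub : ∀ y ∈ X.w₁, ∃ c, (c ∈ X.v ∨ c ∈ X.v₁) ∧
      Relation.ReflTransGen (Graph.Adj (X.R + X.B)) (X.σ₁ y) c ∧ X.cls c = X.cls (X.σ₁ y) := by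
    intro y hy
    rcases X.σ₁_mem hy with h | ⟨z, hz, h⟩
    · exact ⟨_, .inr h, .refl, rfl⟩
    · rw [← h]
      exact ⟨X.σ z, .inl (X.σ_mem z (X.K_sub hz)),
        .head (X.adj_B hz) (.single (X.adj_R (X.K_sub hz))),
        by rw [hw z (X.K_sub hz), X.cls_ξ hz, X.cls_w (X.K_sub hz)]⟩
  rcases X.mem_R.1 hx with (hx | ⟨y, hy, rfl⟩) | (hx | ⟨y, hy, rfl⟩)
  · exact ⟨X.σ x, .inl (X.σ_mem x hx), .single (X.adj_R hx), hw x hx⟩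
  · exact ⟨_, .inl (X.σ_mem y hy), .refl, rfl⟩
  · obtain ⟨c, h1, h2, h3⟩ := hub x hx
    exact ⟨c, h1, .head (X.adj_R₁ hx) h2, h3.trans (X.cls_σ₁ hx)⟩
  · exact hub y hy

/-- The connectors of the two translations are red. Those that link the continuations to the source
or implement the equations are blue. Two names have the same class exactly if
they are connected, as every node is connected to a restricted name and the restricted names of a
class are connected through the equations. -/
theorem isWiring : IsWiring X.R X.B X.D X.cls where
  label e he := by
    simp only [R, B, Multiset.mem_add] at he
    rcases he with (he | he) | (he | he)
    · exact (mem_translSubst he).1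
    · exact (mem_translSubst he).1
    · exact (mem_translSubst he).1
    · exact X.B₀_label e he
  deg_red x hx := by
    have h1 : ∀ y ∈ X.w, X.σ y ∉ X.w := fun y hy => X.v_disj_w _ (X.σ_mem y hy)
    have h2 : ∀ y ∈ X.w₁, X.σ₁ y ∉ X.w₁ := fun y hy => (X.σ₁_fresh hy).2.2
    have hdisj : x ∈ (translSubst X.w X.σ).names → x ∉ (translSubst X.w₁ X.σ₁).names := by
      rw [mem_names_translSubst, mem_names_translSubst]
      rintro (hx | ⟨y, hy, rfl⟩) (hx' | ⟨z, hz, hx'⟩)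
      · exact (X.w₁_fresh hx').2 hx
      · exact (X.σ₁_fresh hz).2.1 (hx' ▸ hx)
      · exact (X.w₁_fresh hx').1 (X.σ_mem y hy)
      · exact (X.σ₁_fresh hz).1 (hx' ▸ X.σ_mem y hy)
    rw [R, Graph.deg_add]
    rw [R, Graph.names_add, Finset.mem_union] at hx
    by_cases hx' : x ∈ (translSubst X.w X.σ).names
    · rw [deg_translSubst h1 hx', Graph.deg_eq_zero.2 (hdisj hx')]
    · rw [deg_translSubst h2 (hx.resolve_left hx'), Graph.deg_eq_zero.2 hx']
  deg_blue x hx := by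
    have h1 : ∀ y ∈ X.K.fn.toList, X.ξ y ∉ X.K.fn.toList := by
      intro y hy h
      exact (X.ξ_fresh (X.mem_fn_toList.1 hy)).2.1 (X.K_sub (X.mem_fn_toList.1 h))
    have hdisj : x ∈ X.B₀.names → x ∉ (translSubst X.K.fn.toList X.ξ).names := by
      rw [mem_names_translSubst]
      rintro hx (h | ⟨y, hy, rfl⟩)
      · exact (X.B₀_names x hx).2 (X.mem_fn_toList.1 h)
      · exact (X.ξ_fresh (X.mem_fn_toList.1 hy)).2.1 (X.Wc_sub (X.B₀_names _ hx).1)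
    rw [B, Graph.deg_add]
    rw [B, Graph.names_add, Finset.mem_union] at hx
    by_cases hx' : x ∈ X.B₀.names
    · rw [X.B₀_deg x hx', Graph.deg_eq_zero.2 (hdisj hx')]
    · rw [deg_translSubst h1 (hx.resolve_right hx'), Graph.deg_eq_zero.2 hx']
  blue_sub x hx := by
    rw [mem_R]
    rcases X.B_sub hx with h | ⟨y, hy, rfl⟩
    · exact .inl (.inl (X.Wc_sub h))
    · exact .inr (.inr (X.ξ_mem hy))
  closed_sub x hx := by
    rw [mem_R]
    rcases X.mem_D.1 hx with ⟨h, -⟩ | ⟨h, hk⟩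
    · exact .inl (.inl (X.Wc_sub h))
    · by_contra hc
      simp only [not_or, not_exists, not_and] at hc
      refine hk ⟨?_, .inl hc.1.2⟩
      by_contra h'
      obtain ⟨⟨y, hy, h'⟩, -⟩ := X.τ_moves h'
      exact hc.1.2 y hy h'
  disj x hx hB := by
    rcases X.mem_D.1 hx with ⟨h, h1, h2⟩ | ⟨h, -⟩
    · rcases X.mem_B.1 hB with (h' | ⟨y, hy, rfl⟩) | h'
      · exact h2 h'
      · exact (X.ξ_fresh hy).2.1 (X.Wc_sub h)
      · exact h1 h'
    · exact X.notMem_B_of_v h hB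
  ne e he he' := by
    rcases Multiset.mem_add.1 he with he | he
    · obtain ⟨-, y, hy, hn⟩ := mem_translSubst he
      exact X.notMem_B_of_v (X.σ_mem y hy) (Graph.mem_names.2 ⟨e, he', by simp [hn]⟩)
    · obtain ⟨-, y, hy, hn⟩ := mem_translSubst he
      exact (X.mem_ext.1 (X.leaf_ext (List.mem_append_right _ hy))).2.1
        (Graph.mem_names.2 ⟨e, he', by simp [hn, hy]⟩)
  cls_const e he := by
    have key : (∃ c, ∀ x ∈ e.nodes, X.cls x = c) →
        ∀ x ∈ e.nodes, ∀ y ∈ e.nodes, X.cls x = X.cls y := by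
      rintro ⟨c, hc⟩ x hx y hy
      rw [hc x hx, hc y hy]
    simp only [R, B, Multiset.mem_add] at he
    rcases he with (he | he) | (he | he)
    · obtain ⟨-, y, hy, hn⟩ := mem_translSubst he
      refine key ⟨X.τ (X.σ y), fun x hx => ?_⟩
      simp only [hn, List.mem_cons, List.mem_filter, decide_eq_true_eq] at hx
      rcases hx with rfl | ⟨hx, hxy⟩
      · exact X.cls_v (X.σ_mem y hy)
      · rw [X.cls_w hx, hxy]
    · obtain ⟨-, y, hy, hn⟩ := mem_translSubst he
      refine key ⟨X.cls (X.σ₁ y), fun x hx => ?_⟩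
      simp only [hn, List.mem_cons, List.mem_filter, decide_eq_true_eq] at hx
      rcases hx with rfl | ⟨hx, hxy⟩
      · rfl
      · rw [← X.cls_σ₁ hx, hxy]
    · obtain ⟨-, y, hy, hn⟩ := mem_translSubst he
      have hy := X.mem_fn_toList.1 hy
      refine key ⟨X.τ (X.σ y), fun x hx => ?_⟩
      simp only [hn, List.mem_cons, List.mem_filter, decide_eq_true_eq, mem_fn_toList] at hx
      rcases hx with rfl | ⟨hx, hxy⟩
      · exact X.cls_ξ hy
      · rw [X.ξ_inj x hx y hy hxy, X.cls_w (X.K_sub hy)]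
    · intro x hx y hy
      have hmem : ∀ z ∈ e.nodes, z ∈ X.w := fun z hz =>
        X.Wc_sub (X.B₀_names z (Graph.mem_names.2 ⟨e, he, hz⟩)).1
      rw [X.cls_w (hmem x hx), X.cls_w (hmem y hy), X.τ_effect.2]
      refine eqvGen_map X.σ (fun a b hab => .rel _ _ ?_) (X.B₀_sound e he x hx y hy)
      exact List.mem_map.2 ⟨(a, b), hab, rfl⟩
  conn x hx y hy hxy := by
    obtain ⟨c, hc, hxc, hc'⟩ := X.exists_anchor hx
    obtain ⟨d, hd, hyd, hd'⟩ := X.exists_anchor hy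
    have hcd : X.cls c = X.cls d := by rw [hc', hd', hxy]
    have hmix : ∀ c ∈ X.v, ∀ d ∈ X.v₁, X.cls c ≠ X.cls d := by
      intro c hc d hd h
      rw [X.cls_v hc, X.cls_v₁ hd] at h
      by_cases hτ : X.τ c = c
      · exact (X.v₁_fresh hd).1 (h ▸ hτ.symm ▸ hc)
      · obtain ⟨-, z, hz, hz'⟩ := X.τ_moves hτ
        exact (X.v₁_fresh hd).1 (h ▸ hz' ▸ X.σ_mem z hz)
    refine hxc.trans (Relation.ReflTransGen.trans ?_ (reach_symm hyd))
    rcases hc with hc | hc <;> rcases hd with hd | hd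
    · rw [X.cls_v hc, X.cls_v hd] at hcd
      exact X.reach_of_τ_eq hcd
    · exact absurd hcd (hmix c hc d hd)
    · exact absurd hcd.symm (hmix d hd c hc)
    · rw [X.cls_v₁ hc, X.cls_v₁ hd] at hcd
      rw [hcd]

/-- The translation of the reduct. -/
noncomputable def H : Graph Label N :=
  ((X.er ++ X.e₁ : List (Edge Label N)) : Multiset (Edge Label N)) +
    translSubst (X.wr ++ X.w₁) X.cls + closeAll X.v'.toFinset

/-- The target of the transition. -/
noncomputable def target : Graph Label N :=
  (X.er : Multiset (Edge Label N)) + translSubst X.w X.σ + closeAll X.v.toFinset + X.graph +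
    X.B₀ + closeAll (X.Wc \ (X.B₀.names ∪ X.K.fn))

theorem v'_nodup : X.v'.Nodup :=
  (X.v_nodup.filter _).append X.v₁_nodup fun _ h1 h2 =>
    (X.v₁_fresh h2).1 (List.mem_filter.1 h1).1

theorem leaves_nodup : (X.wr ++ X.w₁).Nodup :=
  X.wr_nodup.append X.w₁_nodup fun _ h1 h2 => (X.w₁_fresh h2).2 (X.wr_sub h1)

theorem transl_seqs : List.Forall₂ IsTranslSeq (X.Sr ++ X.S₁) (X.er ++ X.e₁) :=
  List.rel_append X.Sr_transl X.S₁_transl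

theorem occ_seqs : (parList (X.Sr ++ X.S₁)).occ = X.wr ++ X.w₁ := by
  rw [occ_parList, List.flatMap_append, ← occ_parList, ← occ_parList]

/-- The target of the transition realizes the translation of the reduct. -/
theorem realizes : Realizes X.H X.target := by
  classical
  -- the edges `n` on names that are not kept belong to the wiring
  have hD : closeAll (X.Wc \ (X.B₀.names ∪ X.K.fn)) + closeAll X.v.toFinset +
      closeAll X.v₁.toFinset = closeAll X.v'.toFinset + closeAll X.D := by
    have h1 : X.v.toFinset = (X.v.toFinset.filter fun c => X.Kept c) ∪
        X.v.toFinset.filter fun c => ¬ X.Kept c := (Finset.filter_union_filter_not_eq _ _).symm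
    have h2 : X.v'.toFinset = (X.v.toFinset.filter fun c => X.Kept c) ∪ X.v₁.toFinset := by
      ext x
      rw [List.mem_toFinset, mem_v']
      simp
    rw [h2, D, closeAll_union, closeAll_union, h1, closeAll_union, ← h1]
    · abel
    · exact Finset.disjoint_filter_filter_not _ _ _
    · rw [Finset.disjoint_left]
      intro x hx hx'
      exact X.v_disj_w x (List.mem_toFinset.1 (Finset.mem_filter.1 hx').1)
        (X.Wc_sub (Finset.mem_sdiff.1 hx).1)
    · rw [Finset.disjoint_left]
      intro x hx hx'
      exact (X.v₁_fresh (List.mem_toFinset.1 hx')).1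
        (List.mem_toFinset.1 (Finset.mem_filter.1 hx).1)
  have := X.isWiring.realizes (w := X.wr ++ X.w₁) (σ := X.cls)
    (A := ((X.er ++ X.e₁ : List (Edge Label N)) : Multiset (Edge Label N)) +
      closeAll X.v'.toFinset) X.leaves_nodup ?_ ?_ ?_ ?_
  · have hH : X.H = ((X.er ++ X.e₁ : List (Edge Label N)) : Multiset (Edge Label N)) +
        closeAll X.v'.toFinset + translSubst (X.wr ++ X.w₁) X.cls := by
      rw [H]; abel
    have hT : X.target = ((X.er ++ X.e₁ : List (Edge Label N)) : Multiset (Edge Label N)) +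
        closeAll X.v'.toFinset + (X.R + X.B + closeAll X.D) := by
      calc X.target = (X.er : Multiset (Edge Label N)) + (X.e₁ : Multiset (Edge Label N)) +
            X.R + X.B + (closeAll (X.Wc \ (X.B₀.names ∪ X.K.fn)) + closeAll X.v.toFinset +
              closeAll X.v₁.toFinset) := by rw [target, Cont.graph, R, B]; abel
        _ = _ := by rw [hD, ← Multiset.coe_add]; abel
    rw [hH, hT]
    exact this
  · exact fun y hy => ⟨X.leaf_ext hy, rfl⟩
  -- the class of a leaf is an external node
  · intro y hy
    obtain ⟨h1, h2, h3⟩ := X.cls_leaf_mem hy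
    exact ⟨X.v'_ext h1 h2, h3, X.v'_notMem h1⟩
  -- every external node is a leaf or the class of a leaf
  · intro x hx
    obtain ⟨hR, hB, hD⟩ := X.mem_ext.1 hx
    rcases X.mem_R.1 hR with (hx | ⟨y, hy, rfl⟩) | (hx | ⟨y, hy, rfl⟩)
    · left
      refine List.mem_append_left _ (((X.mem_w x).1 hx).resolve_left fun hc => hD ?_)
      refine X.mem_D.2 (.inl ⟨hc, fun h => hB (X.mem_B.2 (.inr h)), fun h => hB ?_⟩)
      exact X.mem_B.2 (.inl (.inl h))
    · right
      have hk : X.Kept (X.σ y) := by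
        by_contra hk
        exact hD (X.mem_D.2 (.inr ⟨X.σ_mem y hy, hk⟩))
      exact hk.2.resolve_left fun h => h y hy rfl
    · exact .inl (List.mem_append_right _ hx)
    · right
      rcases X.σ₁_mem hy with h | h
      · exact ⟨y, List.mem_append_right _ hy, by rw [← X.cls_σ₁ hy, X.cls_v₁ h]⟩
      · exact absurd (X.mem_B.2 (.inl (.inr h))) hB
  -- process edges and edges `n` are attached at external nodes
  · intro x hR hA
    rw [Graph.names_add, Finset.mem_union, mem_names_translSeqs X.transl_seqs, occ_seqs,
      names_closeAll, List.mem_toFinset] at hA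
    rcases hA with hA | hA
    · exact X.leaf_ext hA
    · exact X.v'_ext hA hR

theorem names_H_subset : X.H.names ⊆ X.v'.toFinset ∪ (X.wr ++ X.w₁).toFinset := by
  intro x hx
  rw [H, Graph.names_add, Graph.names_add, Finset.mem_union, Finset.mem_union,
    mem_names_translSeqs X.transl_seqs, occ_seqs, names_closeAll, mem_names_translSubst] at hx
  rw [Finset.mem_union, List.mem_toFinset, List.mem_toFinset]
  rcases hx with (hx | hx | ⟨y, hy, rfl⟩) | hx
  · exact .inr hx
  · exact .inr hx
  · exact .inl (X.cls_leaf_mem hy).1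
  · exact .inl (List.mem_toFinset.1 hx)

/-- The restrictions of the continuations can be moved to the front, and restricted names that do
not occur can be dropped. -/
theorem cong_reduct : Cong
    (resList X.v (((parList X.Sr).par X.K).mapName (X.τ ∘ X.σ)))
    (resList X.v' ((parList (X.Sr ++ X.S₁)).mapName X.cls)) := by
  classical
  have hSr : (parList X.Sr).mapName (X.τ ∘ X.σ) = (parList X.Sr).mapName X.cls :=
    mapName_congr fun x hx => (X.cls_w (X.wr_sub hx)).symm
  have hK : Cong (X.K.mapName (X.τ ∘ X.σ)) (resList X.v₁ ((parList X.S₁).mapName X.cls)) := by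
    have h1 : X.K.mapName (X.τ ∘ X.σ) = (X.K.mapName X.ξ).mapName X.η := by
      rw [mapName_mapName]
      exact mapName_congr fun x hx => (X.η_ξ hx).symm
    rw [h1]
    refine (X.K_cong.mapName X.η).trans (.of_eq ?_)
    rw [mapName_resList X.v₁_nodup, mapName_mapName]
    · congr 1
      refine mapName_congr fun y hy => ?_
      have h2 := X.cls_σ₁ hy
      rcases X.σ₁_mem hy with h | ⟨z, hz, h⟩
      · rw [← h2, X.cls_v₁ h]
        simp [h]
      · have h3 : X.σ₁ y ∉ X.v₁ := h ▸ (X.ξ_fresh hz).2.2.1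
        rw [← h2, ← h, X.cls_ξ hz]
        simp only [Function.comp_apply, if_neg h3]
        rw [← h, X.η_ξ hz]
    · intro y hy
      rw [← X.K_cong.mem_occ, occ_mapName] at hy
      obtain ⟨z, hz, rfl⟩ := List.mem_map.1 hy
      rw [X.η_ξ hz]
      exact fun h => (X.v₁_fresh h).1 (X.τσ_mem (X.K_sub hz))
  have hpar : Cong (((parList X.Sr).par X.K).mapName (X.τ ∘ X.σ))
      (resList X.v₁ ((parList (X.Sr ++ X.S₁)).mapName X.cls)) := by
    refine (Cong.par (.of_eq hSr) hK).trans ((Cong.par_resList ?_).trans (Cong.resList ?_))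
    · intro x hx hx'
      rw [occ_mapName] at hx'
      obtain ⟨y, hy, rfl⟩ := List.mem_map.1 hx'
      rw [X.cls_w (X.wr_sub hy)] at hx
      exact (X.v₁_fresh hx).1 (X.τσ_mem (X.wr_sub hy))
    · exact ((Cong.parList_append X.Sr X.S₁).mapName X.cls).symm
  refine hpar.resList.trans ((Cong.resList_filter (fun c => decide (X.Kept c)) ?_).trans
    (.of_eq ?_))
  · intro c hc hk hc'
    rw [mem_occ_resList, occ_mapName, occ_seqs] at hc'
    obtain ⟨y, hy, rfl⟩ := List.mem_map.1 hc'.1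
    rcases X.mem_v'.1 (X.cls_leaf_mem hy).1 with h | h
    · simp [h.2] at hk
    · exact hc'.2 h
  · rw [v', resList_append]

theorem translates {P : Agent N Empty}
    (hP : Cong P (resList X.v (((parList X.Sr).par X.K).mapName (X.τ ∘ X.σ)))) :
    Translates P X.v' (X.wr ++ X.w₁) (P.fn ∪ X.v'.toFinset ∪ (X.wr ++ X.w₁).toFinset) X.H := by
  refine ⟨X.Sr ++ X.S₁, X.er ++ X.e₁, X.cls, ?_, X.occ_seqs, X.leaves_nodup, X.v'_nodup,
    fun x h => X.v'_notMem h, ?_, hP.trans X.cong_reduct, X.transl_seqs, rfl, rfl⟩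
  · intro S hS
    exact (List.mem_append.1 hS).elim (X.Sr_seq S) (X.S₁_seq S)
  · intro x hx
    exfalso
    rw [mem_fn, hP.mem_occ, mem_occ_resList, occ_mapName] at hx
    obtain ⟨y, hy, rfl⟩ := List.mem_map.1 hx.1
    refine hx.2 (X.τσ_mem ?_)
    exact (List.mem_append.1 hy).elim X.wr_sub X.K_sub

end Reduct

end Reduct

/-! ### Process productions and their renamings -/

section Productions

variable {N : Type} [DecidableEq N]

theorem map_mEdge (f : N → N) (x y : N) (l : List N) :
    (mEdge x y l).map f = mEdge (f x) (f y) (l.map f) := by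
  simp [mEdge, Edge.map]

theorem map_connector (f : N → N) (x : N) (l : List N) :
    Graph.map f (connector x l) = connector (f x) (l.map f) := by
  cases l with
  | nil => rfl
  | cons y l => simp [connector, Graph.map, map_mEdge]

theorem map_closeAll {f : N → N} (hf : Function.Injective f) (s : Finset N) :
    Graph.map f (closeAll s) = closeAll (s.image f) := by
  rw [closeAll, closeAll, Graph.map, Multiset.map_map, Finset.image_val_of_injOn hf.injOn,
    Multiset.map_map]
  rfl

theorem map_lEdge (f : N → N) {k : ℕ} (S : Agent (Fin k) Empty) (x : Fin k → N) :
    (lEdge S x).map f = lEdge S (f ∘ x) := by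
  simp [lEdge, Edge.map, List.map_ofFn]

theorem map_translSubst (e : Equiv.Perm N) (w : List N) (σ : N → N) :
    Graph.map e (translSubst w σ) = translSubst (w.map e) (e ∘ σ ∘ e.symm) := by
  rw [translSubst, translSubst, Graph.map_sum]
  have : (w.map e).toFinset.image (e ∘ σ ∘ e.symm) = (w.toFinset.image σ).image e := by
    ext x; simp
  rw [this, Finset.sum_image e.injective.injOn]
  refine Finset.sum_congr rfl fun c _ => ?_
  rw [map_connector, List.filter_map]
  congr 3
  funext y
  simp

theorem translSubst_congr {w : List N} {σ σ' : N → N} (h : ∀ y ∈ w, σ y = σ' y) :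
    translSubst w σ = translSubst w σ' := by
  rw [translSubst, translSubst,
    Finset.image_congr (g := σ') fun y hy => h y (List.mem_toFinset.1 hy)]
  refine Finset.sum_congr rfl fun c _ => ?_
  congr 1
  exact List.filter_congr fun y hy => by rw [h y hy]

theorem translSubst_append {w w' : List N} {σ : N → N} (h : ∀ y ∈ w, ∀ z ∈ w', σ y ≠ σ z) :
    translSubst (w ++ w') σ = translSubst w σ + translSubst w' σ := by
  have hd : Disjoint (w.toFinset.image σ) (w'.toFinset.image σ) := by
    rw [Finset.disjoint_left]
    intro c hc hc'
    obtain ⟨y, hy, rfl⟩ := Finset.mem_image.1 hc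
    obtain ⟨z, hz, he⟩ := Finset.mem_image.1 hc'
    exact h y (List.mem_toFinset.1 hy) z (List.mem_toFinset.1 hz) he.symm
  rw [translSubst, translSubst, translSubst, List.toFinset_append, Finset.image_union,
    Finset.sum_union hd]
  congr 1
  · refine Finset.sum_congr rfl fun c hc => ?_
    obtain ⟨y, hy, rfl⟩ := Finset.mem_image.1 hc
    rw [List.filter_append, (List.filter_eq_nil_iff (l := w')).2, List.append_nil]
    intro z hz
    simpa using (h y (List.mem_toFinset.1 hy) z hz).symm
  · refine Finset.sum_congr rfl fun c hc => ?_
    obtain ⟨z, hz, rfl⟩ := Finset.mem_image.1 hc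
    rw [List.filter_append, (List.filter_eq_nil_iff (l := w)).2, List.nil_append]
    intro y hy
    simpa using h y hy z (List.mem_toFinset.1 hz)

/-- The connectors of an injective substitution do not depend on the order of the names. -/
theorem translSubst_perm {w w' : List N} {σ : N → N} (hp : w.Perm w') (hw : w.Nodup)
    (hσ : ∀ y ∈ w, ∀ z ∈ w, σ y = σ z → y = z) : translSubst w σ = translSubst w' σ := by
  rw [translSubst, translSubst, List.toFinset_eq_of_perm _ _ hp]
  refine Finset.sum_congr rfl fun c hc => ?_
  congr 1
  obtain ⟨y, hy, rfl⟩ := Finset.mem_image.1 hc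
  have hy := hp.mem_iff.2 (List.mem_toFinset.1 hy)
  have h1 : w.filter (fun z => σ z = σ y) = [y] := by
    have : w.filter (fun z => σ z = σ y) = w.filter (fun z => z = y) :=
      List.filter_congr fun z hz => by
        simp only [decide_eq_decide]
        exact ⟨hσ z hz y hy, fun h => h ▸ rfl⟩
    rw [this]
    have h2 := List.filter_eq y (l := w)
    simp only [h2, List.count_eq_one_of_mem hw hy, List.replicate_one]
  have h2 := hp.filter fun z => decide (σ z = σ y)
  rw [h1] at h2 ⊢
  exact List.singleton_perm.1 h2

theorem mapName_translSeq {S : Agent N Empty} {e : Edge Label N} (h : IsTranslSeq S e)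
    (f : N → N) : IsTranslSeq (S.mapName f) (e.map f) := by
  obtain ⟨k, S', ρ, hS, rfl, rfl⟩ := h
  exact ⟨k, S', f ∘ ρ, hS, mapName_mapName _ _ _, map_lEdge _ _ _⟩

/-- An edge determines the sequential process that it translates. -/
theorem IsTranslSeq.eq_mapName {S : Agent N Empty} {k : ℕ} {S' : Agent (Fin k) Empty}
    {x : Fin k → N} (h : IsTranslSeq S (lEdge S' x)) : S = S'.mapName x := by
  obtain ⟨k', S'', ρ, -, rfl, he⟩ := h
  have h1 := congrArg Edge.label he
  have h2 := congrArg Edge.nodes he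
  simp only [lEdge, Label.L.injEq] at h1 h2
  obtain ⟨rfl, h1⟩ := h1
  rw [eq_of_heq h1, List.ofFn_injective h2]

theorem Agent.IsSequential.mapName {V V' W : Type} {S : Agent V W} (h : S.IsSequential) (f : V → V') :
    (S.mapName f).IsSequential := by
  obtain ⟨m, α, P, rfl⟩ := h
  exact ⟨m, _, _, rfl⟩

theorem fn_mapName (P : Agent N Empty) (f : N → N) : (P.mapName f).fn = P.fn.image f := by
  ext x
  simp [mem_fn, occ_mapName]

namespace Cont

/-- Renaming along a permutation of the names. -/
def rename (C : Cont N) (e : Equiv.Perm N) : Cont N where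
  K := C.K.mapName e
  ξ := e ∘ C.ξ ∘ e.symm
  v₁ := C.v₁.map e
  S₁ := C.S₁.map fun S => S.mapName e
  e₁ := C.e₁.map (Edge.map e)
  σ₁ := e ∘ C.σ₁ ∘ e.symm
  ξ_inj := by
    simp only [occ_mapName, List.mem_map]
    rintro _ ⟨x, hx, rfl⟩ _ ⟨y, hy, rfl⟩ h
    simp only [Function.comp_apply, Equiv.symm_apply_apply, EmbeddingLike.apply_eq_iff_eq] at h
    rw [C.ξ_inj x hx y hy h]
  ξ_notMem := by
    simp only [occ_mapName, ← mapName_parList, List.mem_map]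
    rintro _ ⟨x, hx, rfl⟩
    simpa using C.ξ_notMem x hx
  K_cong := by
    have := C.K_cong.mapName e
    rw [mapName_resList_of_injective e.injective] at this
    have hconj : ∀ f : N → N, (e ∘ f ∘ e.symm) ∘ e = e ∘ f := fun f => by
      funext y; simp
    rw [← mapName_parList, mapName_mapName, mapName_mapName, hconj, hconj, ← mapName_mapName,
      ← mapName_mapName]
    exact this
  S₁_seq := by
    simp only [List.mem_map]
    rintro _ ⟨S, hS, rfl⟩
    exact (C.S₁_seq S hS).mapName e
  S₁_transl := by
    rw [List.forall₂_map_left_iff, List.forall₂_map_right_iff]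
    exact C.S₁_transl.imp fun _ _ h => mapName_translSeq h e
  w₁_nodup := by
    rw [← mapName_parList, occ_mapName]
    exact C.w₁_nodup.map e.injective
  v₁_nodup := C.v₁_nodup.map e.injective
  v₁_notMem := by
    simp only [← mapName_parList, occ_mapName, List.mem_map]
    rintro _ ⟨x, hx, rfl⟩
    simpa using C.v₁_notMem x hx

theorem fresh_rename (C : Cont N) (e : Equiv.Perm N) :
    (C.rename e).fresh = C.fresh.image e := by
  ext z
  simp only [mem_fresh, Finset.mem_image, rename, w₁, ← mapName_parList, occ_mapName,
    List.mem_map]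
  constructor
  · rintro ((⟨x, hx, rfl⟩ | ⟨x, hx, rfl⟩) | ⟨_, ⟨y, hy, rfl⟩, rfl⟩)
    · exact ⟨x, .inl (.inl hx), rfl⟩
    · exact ⟨x, .inl (.inr hx), rfl⟩
    · exact ⟨C.ξ y, .inr ⟨y, hy, rfl⟩, by simp⟩
  · rintro ⟨x, (hx | hx) | ⟨y, hy, rfl⟩, rfl⟩
    · exact .inl (.inl ⟨x, hx, rfl⟩)
    · exact .inl (.inr ⟨x, hx, rfl⟩)
    · exact .inr ⟨e y, ⟨y, hy, rfl⟩, by simp⟩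

theorem graph_rename (C : Cont N) (e : Equiv.Perm N) :
    (C.rename e).graph = Graph.map e C.graph := by
  have h1 : Graph.map e (translSubst C.K.fn.toList C.ξ) =
      translSubst (C.K.mapName e).fn.toList (e ∘ C.ξ ∘ e.symm) := by
    rw [map_translSubst]
    have hnd : (C.K.fn.toList.map e).Nodup := (Finset.nodup_toList _).map e.injective
    refine translSubst_perm ?_ hnd ?_
    · refine (List.perm_ext_iff_of_nodup hnd (Finset.nodup_toList _)).2 fun x => ?_
      simp [fn_mapName]
    · simp only [List.mem_map, Finset.mem_toList, mem_fn]
      rintro _ ⟨x, hx, rfl⟩ _ ⟨y, hy, rfl⟩ h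
      simp only [Function.comp_apply, Equiv.symm_apply_apply, EmbeddingLike.apply_eq_iff_eq] at h
      rw [C.ξ_inj x hx y hy h]
  have h2 : (C.rename e).w₁ = C.w₁.map e := by
    simp only [w₁, rename, ← mapName_parList, occ_mapName]
  have h3 : Graph.map e (C.e₁ : Multiset (Edge Label N)) =
      ((C.e₁.map (Edge.map e) : List (Edge Label N)) : Multiset (Edge Label N)) :=
    Multiset.map_coe _ _
  rw [graph, graph, Graph.map_add, Graph.map_add, Graph.map_add, h1, h3, map_translSubst,
    map_closeAll e.injective, h2]
  have h4 : (C.rename e).v₁.toFinset = C.v₁.toFinset.image e := by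
    ext x
    simp [rename]
  rw [h4]
  rfl

/-- Parallel composition of continuations with disjoint names. -/
def par (C C' : Cont N) (hK : ∀ x ∈ C.K.occ, x ∉ C'.K.occ)
    (hf : ∀ x ∈ C.fresh, x ∉ C'.fresh) : Cont N where
  K := C.K.par C'.K
  ξ := fun y => if y ∈ C.K.occ then C.ξ y else C'.ξ y
  v₁ := C.v₁ ++ C'.v₁
  S₁ := C.S₁ ++ C'.S₁
  e₁ := C.e₁ ++ C'.e₁
  σ₁ := fun y => if y ∈ C.w₁ then C.σ₁ y else C'.σ₁ y
  ξ_inj := by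
    intro x hx y hy
    simp only [occ, List.mem_append] at hx hy
    split_ifs with h1 h2 h2
    · exact C.ξ_inj x h1 y h2
    · exact fun h => absurd (h ▸ fresh_ξ (hy.resolve_left h2)) (hf _ (fresh_ξ h1))
    · exact fun h => absurd (h ▸ fresh_ξ (hx.resolve_left h1)) (hf _ (fresh_ξ h2))
    · exact C'.ξ_inj x (hx.resolve_left h1) y (hy.resolve_left h2)
  ξ_notMem := by
    intro x hx
    simp only [occ, List.mem_append] at hx
    simp only [occ_parList, List.flatMap_append, List.mem_append]
    simp only [← occ_parList, not_or]
    split_ifs with h1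
    · have h := C.ξ_notMem x h1
      have h' := hf _ (fresh_ξ h1)
      exact ⟨⟨h.1, fun h => h' (fresh_v₁ h)⟩, h.2, fun h => h' (fresh_w₁ h)⟩
    · have h := C'.ξ_notMem x (hx.resolve_left h1)
      have h' := fun h => hf _ h (fresh_ξ (hx.resolve_left h1))
      exact ⟨⟨fun h => h' (fresh_v₁ h), h.1⟩, fun h => h' (fresh_w₁ h), h.2⟩
  K_cong := by
    have h1 : (C.K.par C'.K).mapName (fun y => if y ∈ C.K.occ then C.ξ y else C'.ξ y) =
        (C.K.mapName C.ξ).par (C'.K.mapName C'.ξ) := by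
      simp only [mapName]
      congr 1
      · exact mapName_congr fun x hx => if_pos hx
      · exact mapName_congr fun x hx => if_neg fun h => hK x h hx
    have h2 : ((parList C.S₁).par (parList C'.S₁)).mapName
        (fun y => if y ∈ C.w₁ then C.σ₁ y else C'.σ₁ y) =
        ((parList C.S₁).mapName C.σ₁).par ((parList C'.S₁).mapName C'.σ₁) := by
      simp only [mapName]
      congr 1
      · exact mapName_congr fun x hx => if_pos hx
      · exact mapName_congr fun x hx => if_neg fun h => hf x (fresh_w₁ h) (fresh_w₁ hx)
    rw [h1, resList_append]
    refine Cong.trans ?_ (((Cong.parList_append C.S₁ C'.S₁).mapName _).resList.resList).symm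
    rw [h2]
    have hocc : ∀ x, x ∈ (resList C'.v₁ ((parList C'.S₁).mapName C'.σ₁)).occ → x ∈ C'.fresh := by
      intro x hx
      rw [← C'.K_cong.mem_occ, occ_mapName, List.mem_map] at hx
      obtain ⟨y, hy, rfl⟩ := hx
      exact fresh_ξ hy
    have hocc₁ : ∀ x, x ∈ ((parList C.S₁).mapName C.σ₁).occ → x ∈ C.fresh := by
      intro x hx
      rw [occ_mapName, List.mem_map] at hx
      obtain ⟨y, hy, rfl⟩ := hx
      rcases C.σ₁_mem hy with h | ⟨z, hz, h⟩
      · exact fresh_v₁ h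
      · exact h ▸ fresh_ξ hz
    refine (Cong.par C.K_cong C'.K_cong).trans ((Cong.par_comm _ _).trans
      ((Cong.par_resList ?_).trans (Cong.resList ((Cong.par_comm _ _).trans
        (Cong.par_resList ?_)))))
    · exact fun x hx hx' => hf x (fresh_v₁ hx) (hocc x hx')
    · exact fun x hx hx' => hf x (hocc₁ x hx') (fresh_v₁ hx)
  S₁_seq := fun S hS => (List.mem_append.1 hS).elim (C.S₁_seq S) (C'.S₁_seq S)
  S₁_transl := List.rel_append C.S₁_transl C'.S₁_transl
  w₁_nodup := by
    rw [occ_parList, List.flatMap_append, ← occ_parList, ← occ_parList]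
    exact C.w₁_nodup.append C'.w₁_nodup fun x h h' => hf x (fresh_w₁ h) (fresh_w₁ h')
  v₁_nodup := C.v₁_nodup.append C'.v₁_nodup fun x h h' => hf x (fresh_v₁ h) (fresh_v₁ h')
  v₁_notMem := by
    intro x hx
    rw [occ_parList, List.flatMap_append, ← occ_parList, ← occ_parList, List.mem_append, not_or]
    rcases List.mem_append.1 hx with h | h
    · exact ⟨C.v₁_notMem x h, fun h' => hf x (fresh_v₁ h) (fresh_w₁ h')⟩
    · exact ⟨fun h' => hf x (fresh_w₁ h') (fresh_v₁ h), C'.v₁_notMem x h⟩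

variable {C C' : Cont N} (hK : ∀ x ∈ C.K.occ, x ∉ C'.K.occ) (hf : ∀ x ∈ C.fresh, x ∉ C'.fresh)

theorem w₁_par : (C.par C' hK hf).w₁ = C.w₁ ++ C'.w₁ := by
  simp only [w₁, par, occ_parList, List.flatMap_append]

theorem fresh_par : (C.par C' hK hf).fresh = C.fresh ∪ C'.fresh := by
  ext z
  rw [Finset.mem_union, mem_fresh, mem_fresh, mem_fresh, w₁_par]
  simp only [par, List.mem_append, occ]
  have : (∃ y, (y ∈ C.K.occ ∨ y ∈ C'.K.occ) ∧ (if y ∈ C.K.occ then C.ξ y else C'.ξ y) = z) ↔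
      (∃ y ∈ C.K.occ, C.ξ y = z) ∨ ∃ y ∈ C'.K.occ, C'.ξ y = z := by
    constructor
    · rintro ⟨y, hy, h⟩
      split_ifs at h with h1
      · exact .inl ⟨y, h1, h⟩
      · exact .inr ⟨y, hy.resolve_left h1, h⟩
    · rintro (⟨y, hy, h⟩ | ⟨y, hy, h⟩)
      · exact ⟨y, .inl hy, by rw [if_pos hy, h]⟩
      · exact ⟨y, .inr hy, by rw [if_neg fun h' => hK y h' hy, h]⟩
  rw [this]
  generalize (∃ y ∈ C.K.occ, C.ξ y = z) = p
  generalize (∃ y ∈ C'.K.occ, C'.ξ y = z) = q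
  tauto

theorem graph_par : (C.par C' hK hf).graph = C.graph + C'.graph := by
  have hσ₁ : ∀ {D : Cont N}, ∀ y ∈ D.w₁, D.σ₁ y ∈ D.fresh := by
    intro D y hy
    rcases D.σ₁_mem hy with h | ⟨z, hz, h⟩
    · exact fresh_v₁ h
    · exact h ▸ fresh_ξ hz
  have h1 : translSubst (C.w₁ ++ C'.w₁) (C.par C' hK hf).σ₁ =
      translSubst C.w₁ C.σ₁ + translSubst C'.w₁ C'.σ₁ := by
    have h : ∀ y ∈ C.w₁, (C.par C' hK hf).σ₁ y = C.σ₁ y := fun y hy => if_pos hy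
    have h' : ∀ y ∈ C'.w₁, (C.par C' hK hf).σ₁ y = C'.σ₁ y := fun y hy =>
      if_neg fun h => hf y (fresh_w₁ h) (fresh_w₁ hy)
    rw [translSubst_append, translSubst_congr h, translSubst_congr h']
    intro y hy z hz he
    rw [h y hy, h' z hz] at he
    exact hf _ (hσ₁ y hy) (he ▸ hσ₁ z hz)
  have h2 : translSubst (C.par C' hK hf).K.fn.toList (C.par C' hK hf).ξ =
      translSubst C.K.fn.toList C.ξ + translSubst C'.K.fn.toList C'.ξ := by
    have h : ∀ y ∈ C.K.fn.toList, (C.par C' hK hf).ξ y = C.ξ y := fun y hy =>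
      if_pos (mem_fn.1 (Finset.mem_toList.1 hy))
    have h' : ∀ y ∈ C'.K.fn.toList, (C.par C' hK hf).ξ y = C'.ξ y := fun y hy =>
      if_neg fun h => hK y h (mem_fn.1 (Finset.mem_toList.1 hy))
    rw [← translSubst_congr h, ← translSubst_congr h', ← translSubst_append]
    · refine translSubst_perm ?_ (Finset.nodup_toList _) ?_
      · refine (List.perm_ext_iff_of_nodup (Finset.nodup_toList _) ?_).2 fun x => ?_
        · refine (Finset.nodup_toList _).append (Finset.nodup_toList _) fun x h h' => ?_
          exact hK x (mem_fn.1 (Finset.mem_toList.1 h)) (mem_fn.1 (Finset.mem_toList.1 h'))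
        · simp only [Finset.mem_toList, List.mem_append, mem_fn]
          simp only [par, occ, List.mem_append]
      · intro y hy z hz
        exact (C.par C' hK hf).ξ_inj y (mem_fn.1 (Finset.mem_toList.1 hy)) z
          (mem_fn.1 (Finset.mem_toList.1 hz))
    · intro y hy z hz he
      rw [h y hy, h' z hz] at he
      exact hf _ (fresh_ξ (mem_fn.1 (Finset.mem_toList.1 hy)))
        (he ▸ fresh_ξ (mem_fn.1 (Finset.mem_toList.1 hz)))
  have h3 : closeAll (C.par C' hK hf).v₁.toFinset =
      closeAll C.v₁.toFinset + closeAll C'.v₁.toFinset := by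
    rw [← closeAll_union]
    · simp only [par, List.toFinset_append]
    · rw [Finset.disjoint_left]
      exact fun x h h' => hf x (fresh_v₁ (List.mem_toFinset.1 h)) (fresh_v₁ (List.mem_toFinset.1 h'))
  have h4 : ((C.par C' hK hf).e₁ : Multiset (Edge Label N)) =
      (C.e₁ : Multiset (Edge Label N)) + (C'.e₁ : Multiset (Edge Label N)) := by
    simp only [par, Multiset.coe_add]
  rw [graph, graph, graph, w₁_par, h1, h2, h3, h4]
  abel

end Cont

end Productions

section Productions

variable {N : Type} [DecidableEq N]

theorem exists_perm_extending {s : Finset N} {g : N → N}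
    (hg : ∀ x ∈ s, ∀ y ∈ s, g x = g y → x = y) : ∃ e : Equiv.Perm N, ∀ x ∈ s, e x = g x := by
  obtain ⟨e, he⟩ := Equiv.Perm.exists_extending_pair (fun x : s => (x : N)) (fun x : s => g x)
    Subtype.val_injective fun x y h => Subtype.ext (hg x x.2 y y.2 h)
  exact ⟨e, fun x hx => he ⟨x, hx⟩⟩

theorem isSubstEffect_conj (e : Equiv.Perm N) {φ : List (N × N)} {θ : N → N}
    (h : IsSubstEffect (listRel φ) θ) :
    IsSubstEffect (listRel (φ.map fun p => (e p.1, e p.2))) (e ∘ θ ∘ e.symm) := by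
  refine ⟨fun x => by simp [h.1], fun x y => ?_⟩
  simp only [Function.comp_apply, EmbeddingLike.apply_eq_iff_eq, h.2]
  constructor
  · intro hxy
    have := eqvGen_map (s := listRel (φ.map fun p => (e p.1, e p.2))) e
      (fun a b hab => .rel _ _ (List.mem_map.2 ⟨(a, b), hab, rfl⟩)) hxy
    simpa using this
  · refine eqvGen_map e.symm fun a b hab => .rel _ _ ?_
    obtain ⟨p, hp, he⟩ := List.mem_map.1 hab
    cases he
    simpa [listRel] using hp

theorem Prefix.eqs_map {V V' : Type} (f : V → V') (α : Prefix V) :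
    (α.map f).eqs = α.eqs.map fun p => (f p.1, f p.2) := by
  cases α <;> rfl

theorem Prefix.label_map {f : N → N} (hf : Function.Injective f) (α : Prefix N) (z : N) :
    (α.map f).label (f z) = ((α.label z).1, (α.label z).2.map f) := by
  cases α with
  | inp u xs =>
    by_cases h : z = u
    · simp [Prefix.map, Prefix.label, h]
    · simp [Prefix.map, Prefix.label, h, hf.ne h]
  | out u xs =>
    by_cases h : z = u
    · simp [Prefix.map, Prefix.label, h]
    · simp [Prefix.map, Prefix.label, h, hf.ne h]
  | fus φ => simp [Prefix.map, Prefix.label]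

/-- The data of a process production for the summand `α j . Q j` of a standard sequential process
whose names are instantiated along `x`; `θ` is the substitutive effect of the prefix, and `C` the
continuation with its translation. -/
structure ProcessData (N : Type) [DecidableEq N] where
  n : ℕ
  m : ℕ
  α : Fin m → Prefix (Fin n)
  Q : Fin m → Agent (Fin n) Empty
  j : Fin m
  x : Fin n → N
  θ : N → N
  C : Cont N
  standard : IsStandard (Agent.sum m α Q)
  x_inj : Function.Injective x
  K_eq : C.K = (Q j).mapName x
  effect : IsSubstEffect (listRel ((α j).map x).eqs) θ

namespace ProcessData

variable (D : ProcessData N)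

/-- The nodes of the source. -/
def nodes : Finset N := Finset.univ.image D.x

/-- The prefix that is executed. -/
def pre : Prefix N := (D.α D.j).map D.x

/-- The edge that is rewritten. -/
def edge : Edge Label N := lEdge (Agent.sum D.m D.α D.Q) D.x

/-- The nodes closed by an edge `n`. -/
def closed : Finset N :=
  D.nodes \ (D.nodes.biUnion (fun y => (D.pre.label y).2.toFinset) ∪ fusedNames D.nodes D.θ ∪
    D.C.K.fn)

/-- The edges that replace the rewritten one. -/
noncomputable def added : Graph Label N :=
  D.C.graph + translSubst (D.pre.occ.filter fun y => D.θ y ≠ y) D.θ + closeAll D.closed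

theorem occ_eq : ((Agent.sum D.m D.α D.Q).mapName D.x).occ = List.ofFn D.x := by
  rw [occ_mapName, D.standard.2, List.ofFn_eq_map]

theorem mem_nodes {z : N} : z ∈ D.nodes ↔ z ∈ ((Agent.sum D.m D.α D.Q).mapName D.x).occ := by
  rw [occ_eq, nodes, Finset.mem_image, List.mem_ofFn']
  simp

theorem occ_nodup : (D.pre.occ ++ D.C.K.occ).Nodup := by
  have h1 : (List.ofFn D.x).Nodup := List.nodup_ofFn.2 D.x_inj
  rw [← D.occ_eq] at h1
  simp only [mapName, occ] at h1
  rw [pre, D.K_eq]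
  exact (List.nodup_flatMap.1 h1).1 D.j (List.mem_finRange _)

theorem pre_sub {z : N} (hz : z ∈ D.pre.occ) : z ∈ D.nodes := by
  rw [mem_nodes]
  simp only [mapName, occ, List.mem_flatMap, List.mem_append]
  exact ⟨D.j, List.mem_finRange _, .inl hz⟩

theorem K_sub {z : N} (hz : z ∈ D.C.K.occ) : z ∈ D.nodes := by
  rw [mem_nodes]
  simp only [mapName, occ, List.mem_flatMap, List.mem_append]
  exact ⟨D.j, List.mem_finRange _, .inr (D.K_eq ▸ hz)⟩

end ProcessData

/-- The process productions are closed under permutations of the names. -/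
theorem ProcessProduction.exists_data {k : ProdKind} {T : Transition Label Action N}
    (h : ProcessProduction k T) (e : Equiv.Perm N) :
    ∃ D : ProcessData N, k = D.pre.kind ∧ T.Γ.image e = D.nodes ∧ Graph.map e T.G = {D.edge} ∧
      (∀ z, D.pre.label (e z) = ((T.Λ z).1, (T.Λ z).2.map e)) ∧
      D.C.fresh ⊆ T.Φ.image e ∧ (∀ z ∈ T.Γ, e z ∉ D.C.fresh) ∧ Graph.map e T.G' = D.added := by
  cases h with
  | @mk n m α Q j x ξ θ v w Γ G standard x_inj ξ_inj transl vw_fresh ξ_fresh effect =>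
  obtain ⟨Ss, es, σ, h1, rfl, h3, h4, h5, h6, h7, h8, rfl, rfl⟩ := transl
  let C₀ : Cont N :=
    { K := (Q j).mapName x
      ξ := ξ
      v₁ := v
      S₁ := Ss
      e₁ := es
      σ₁ := σ
      ξ_inj := fun y hy z hz h => ξ_inj (mem_fn.2 hy) (mem_fn.2 hz) h
      ξ_notMem := fun y hy => ⟨(ξ_fresh y (mem_fn.2 hy)).1, (ξ_fresh y (mem_fn.2 hy)).2.1⟩
      K_cong := h7
      S₁_seq := h1
      S₁_transl := h8
      w₁_nodup := h3
      v₁_nodup := h4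
      v₁_notMem := fun y hy hy' => h5 hy hy' }
  have hx : ∀ i, x i ∉ C₀.fresh := by
    intro i hi
    rcases Cont.mem_fresh.1 hi with (hi | hi) | ⟨y, hy, hi⟩
    · exact (vw_fresh i).1 hi
    · exact (vw_fresh i).2 hi
    · exact (ξ_fresh y (mem_fn.2 hy)).2.2 i hi
  have hfresh : ∀ z, e z ∈ (C₀.rename e).fresh ↔ z ∈ C₀.fresh := fun z => by
    rw [Cont.fresh_rename]; simp
  let D : ProcessData N :=
    { n := n, m := m, α := α, Q := Q, j := j, x := e ∘ x, θ := e ∘ θ ∘ e.symm, C := C₀.rename e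
      standard := standard
      x_inj := e.injective.comp x_inj
      K_eq := mapName_mapName _ _ _
      effect := by
        have := isSubstEffect_conj e effect
        rwa [← Prefix.eqs_map, Prefix.map_map] at this }
  have hpre : D.pre = ((α j).map x).map e := by
    rw [Prefix.map_map]; rfl
  have hnodes : D.nodes = (Finset.univ.image x).image e := by
    rw [Finset.image_image]; rfl
  refine ⟨D, ?_, hnodes.symm, ?_, ?_, ?_, ?_, ?_⟩
  · rw [hpre]
    cases α j <;> rfl
  · change {(lEdge _ x).map e} = _
    rw [map_lEdge]
    rfl
  · intro z
    rw [hpre, Prefix.label_map e.injective]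
  · intro z hz
    change z ∈ (C₀.rename e).fresh at hz
    rw [Cont.fresh_rename, Finset.mem_image] at hz
    obtain ⟨y, hy, rfl⟩ := hz
    refine Finset.mem_image_of_mem _ (Finset.mem_union_left _ ?_)
    rw [Finset.mem_union, Finset.mem_union, List.mem_toFinset, List.mem_toFinset, fn_mapName,
      Finset.mem_image]
    rcases Cont.mem_fresh.1 hy with (hy | hy) | ⟨z, hz, rfl⟩
    · exact .inl (.inr hy)
    · exact .inr hy
    · exact .inl (.inl ⟨z, mem_fn.2 hz, rfl⟩)
  · intro z hz h
    obtain ⟨i, -, rfl⟩ := Finset.mem_image.1 hz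
    exact hx i ((hfresh _).1 h)
  · have hc : closeAll D.closed = Graph.map e (closeAll (Finset.univ.image x \
        ((Finset.univ.image x).biUnion (fun y => (((α j).map x).label y).2.toFinset)
          ∪ fusedNames (Finset.univ.image x) θ ∪ ((Q j).mapName x).fn))) := by
      rw [map_closeAll e.injective]
      congr 1
      rw [ProcessData.closed, Finset.image_sdiff _ _ e.injective, Finset.image_union,
        Finset.image_union, ← hnodes]
      congr 1
      congr 1
      · congr 1
        · ext z
          simp only [hnodes, Finset.mem_biUnion, Finset.mem_image, List.mem_toFinset, hpre]
          constructor
          · rintro ⟨_, ⟨_, ⟨i, hi, rfl⟩, rfl⟩, hz⟩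
            rw [Prefix.label_map e.injective] at hz
            obtain ⟨y, hy, rfl⟩ := List.mem_map.1 hz
            exact ⟨y, ⟨_, ⟨i, hi, rfl⟩, hy⟩, rfl⟩
          · rintro ⟨y, ⟨_, ⟨i, hi, rfl⟩, hy⟩, rfl⟩
            refine ⟨_, ⟨_, ⟨i, hi, rfl⟩, rfl⟩, ?_⟩
            rw [Prefix.label_map e.injective]
            exact List.mem_map_of_mem hy
        · ext z
          rw [hnodes]
          simp only [fusedNames, Finset.mem_filter, Finset.mem_image, D]
          constructor
          · rintro ⟨⟨y, hy, rfl⟩, _, ⟨y', hy', rfl⟩, hne, he⟩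
            exact ⟨y, ⟨hy, y', hy', fun h => hne (h ▸ rfl), by simpa using he⟩, rfl⟩
          · rintro ⟨y, ⟨hy, y', hy', hne, he⟩, rfl⟩
            exact ⟨⟨y, hy, rfl⟩, e y', ⟨y', hy', rfl⟩, e.injective.ne hne, by simpa using he⟩
      · exact fn_mapName _ _
    have ht : translSubst (D.pre.occ.filter fun y => D.θ y ≠ y) D.θ =
        Graph.map e (translSubst (((α j).map x).occ.filter fun y => θ y ≠ y) θ) := by
      rw [map_translSubst, hpre, Prefix.occ_map, List.filter_map]
      congr 2
      refine List.filter_congr fun y _ => ?_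
      simp [D]
    have hg : D.C.graph = Graph.map e C₀.graph := Cont.graph_rename C₀ e
    rw [ProcessData.added, hc, ht, hg, Graph.map_add, Graph.map_add, Graph.map_add]
    congr 2
    rw [Cont.graph]
    simp only [Graph.map_add]
    rfl

theorem exists_substEffect (φ : List (N × N)) : ∃ τ, IsSubstEffect (listRel φ) τ := by
  classical
  let s := Relation.EqvGen.setoid (listRel φ)
  refine ⟨fun x => (Quotient.mk s x).out, fun x => ?_, fun x y => ?_⟩
  · change (Quotient.mk s (Quotient.mk s x).out).out = _
    rw [Quotient.out_eq]
  · constructor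
    · intro h
      have := congrArg (Quotient.mk s) h
      simp only [Quotient.out_eq] at this
      exact Quotient.exact this
    · intro h
      exact congrArg Quotient.out (Quotient.sound (s := s) h)

end Productions

/-! ### The two kinds of reactions -/

theorem forall₂_perm {α β : Type*} {R : α → β → Prop} {l : List α} {l₁ l₂ : List β}
    (h : List.Forall₂ R l l₁) (hp : l₁.Perm l₂) : ∃ l', l.Perm l' ∧ List.Forall₂ R l' l₂ := by
  induction hp generalizing l with
  | nil => exact ⟨l, .refl _, h⟩
  | cons b _ ih =>
    cases h with
    | cons h1 h2 =>
      obtain ⟨l', hp, h'⟩ := ih h2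
      exact ⟨_, hp.cons _, .cons h1 h'⟩
  | swap b b' _ =>
    cases h with
    | cons h1 h2 =>
      cases h2 with
      | cons h2 h3 => exact ⟨_, .swap _ _ _, .cons h2 (.cons h1 h3)⟩
  | trans _ _ ih1 ih2 =>
    obtain ⟨l', hp, h'⟩ := ih1 h
    obtain ⟨l'', hp', h''⟩ := ih2 h'
    exact ⟨l'', hp.trans hp', h''⟩

section Reactions

variable {N : Type} [DecidableEq N]

/-- The connectors `m₂(x, y)` for the corresponding elements of two lists of names. -/
def pairs (xs ys : List N) : Graph Label N :=
  (List.zipWith (fun s t => mEdge s t []) xs ys : Multiset (Edge Label N))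

theorem pairs_cons (x y : N) (xs ys : List N) :
    pairs (x :: xs) (y :: ys) = {mEdge x y []} + pairs xs ys := rfl

theorem mem_pairs {xs ys : List N} {e : Edge Label N} (he : e ∈ pairs xs ys) :
    ∃ p ∈ xs.zip ys, e = mEdge p.1 p.2 [] := by
  induction xs generalizing ys with
  | nil => simp [pairs] at he
  | cons x xs ih =>
    cases ys with
    | nil => simp [pairs] at he
    | cons y ys =>
      rw [pairs_cons, Multiset.mem_add, Multiset.mem_singleton] at he
      rcases he with rfl | he
      · exact ⟨(x, y), by simp, rfl⟩
      · obtain ⟨p, hp, rfl⟩ := ih he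
        exact ⟨p, by simp [hp], rfl⟩

theorem mem_pairs_of_mem {xs ys : List N} {p : N × N} (hp : p ∈ xs.zip ys) :
    mEdge p.1 p.2 [] ∈ pairs xs ys := by
  induction xs generalizing ys with
  | nil => simp at hp
  | cons x xs ih =>
    cases ys with
    | nil => simp at hp
    | cons y ys =>
      rw [pairs_cons, Multiset.mem_add, Multiset.mem_singleton]
      rcases List.mem_cons.1 hp with rfl | hp
      · exact .inl rfl
      · exact .inr (ih hp)

theorem names_pairs {xs ys : List N} (h : xs.length = ys.length) :
    (pairs xs ys).names = xs.toFinset ∪ ys.toFinset := by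
  induction xs generalizing ys with
  | nil =>
    cases ys with
    | nil => simp [pairs, Graph.names]
    | cons y ys => simp at h
  | cons x xs ih =>
    cases ys with
    | nil => simp at h
    | cons y ys =>
      rw [pairs_cons, Graph.names_add, ih (by simpa using h)]
      have : Graph.names ({mEdge x y []} : Graph Label N) = {x, y} := by
        ext z; simp [Graph.mem_names, mEdge]
      rw [this]
      ext z
      simp only [Finset.mem_union, Finset.mem_insert, Finset.mem_singleton, List.mem_toFinset,
        List.mem_cons]
      tauto

theorem deg_pairs {xs ys : List N} (h : xs.length = ys.length) (hnd : (xs ++ ys).Nodup) {z : N}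
    (hz : z ∈ (pairs xs ys).names) : (pairs xs ys).deg z = 1 := by
  induction xs generalizing ys with
  | nil => simp [pairs, Graph.names] at hz
  | cons x xs ih =>
    cases ys with
    | nil => simp at h
    | cons y ys =>
      have h' : xs.length = ys.length := by simpa using h
      rw [List.nodup_append'] at hnd
      obtain ⟨h1, h2, h3⟩ := hnd
      obtain ⟨hx, h1⟩ := List.nodup_cons.1 h1
      obtain ⟨hy, h2⟩ := List.nodup_cons.1 h2
      simp only [List.disjoint_cons_left, List.disjoint_cons_right, List.mem_cons, not_or] at h3
      have ih := @ih ys h' (List.nodup_append'.2 ⟨h1, h2, h3.2.2⟩)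
      rw [names_pairs h'] at ih
      have hdeg : Graph.deg ({mEdge x y []} : Graph Label N) z =
          if z = x ∨ z = y then 1 else 0 := by
        rw [Graph.deg, Multiset.filter_singleton]
        simp only [mEdge, List.mem_cons, List.not_mem_nil, or_false]
        split_ifs <;> rfl
      rw [pairs_cons, Graph.deg_add, hdeg]
      by_cases hzxy : z = x ∨ z = y
      · rw [if_pos hzxy, Graph.deg_eq_zero.2]
        rw [names_pairs h', Finset.mem_union, List.mem_toFinset, List.mem_toFinset, not_or]
        rcases hzxy with rfl | rfl
        · exact ⟨hx, h3.2.1⟩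
        · exact ⟨h3.1.2, hy⟩
      · rw [if_neg hzxy, zero_add]
        refine ih ?_
        rw [names_pairs h, Finset.mem_union, List.mem_toFinset, List.mem_toFinset, List.mem_cons,
          List.mem_cons] at hz
        rw [Finset.mem_union, List.mem_toFinset, List.mem_toFinset]
        tauto

/-- The data of a translation of the closed process `P`. As `P` has no free names, `σ` maps the
names `w` to restricted names. -/
structure IsSource (P : Agent N Empty) (v w : List N) (Ss : List (Agent N Empty))
    (es : List (Edge Label N)) (σ : N → N) : Prop where
  seq : ∀ S ∈ Ss, S.IsSequential
  occ_eq : (parList Ss).occ = w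
  w_nodup : w.Nodup
  v_nodup : v.Nodup
  disj : ∀ x ∈ v, x ∉ w
  cong : Cong P (resList v ((parList Ss).mapName σ))
  transl : List.Forall₂ IsTranslSeq Ss es
  σ_mem : ∀ y ∈ w, σ y ∈ v

theorem IsSource.of_translates {P : Agent N Empty} (closed : P.fn = ∅) {v w : List N}
    {Γ : Finset N} {G : Graph Label N} (h : Translates P v w Γ G) :
    ∃ Ss es σ, IsSource P v w Ss es σ ∧ Γ = v.toFinset ∪ w.toFinset ∧
      G = (es : Multiset (Edge Label N)) + translSubst w σ + closeAll v.toFinset := by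
  obtain ⟨Ss, es, σ, h1, h2, h3, h4, h5, -, h7, h8, h9, h10⟩ := h
  refine ⟨Ss, es, σ, ⟨h1, h2, h3, h4, fun x hx hx' => h5 hx hx', h7, h8, fun y hy => ?_⟩,
    by rw [h9, closed, Finset.empty_union], h10⟩
  by_contra hv
  have : σ y ∈ P.fn := by
    rw [mem_fn, h7.mem_occ, mem_occ_resList, occ_mapName, h2]
    exact ⟨List.mem_map_of_mem hy, hv⟩
  simp [closed] at this

namespace ProcessData

theorem isTranslSeq_edge {D : ProcessData N} {S : Agent N Empty} (h : IsTranslSeq S D.edge) :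
    S = (Agent.sum D.m D.α D.Q).mapName D.x := h.eq_mapName

theorem θ_eq_self {D : ProcessData N} (h : D.pre.eqs = []) (z : N) : D.θ z = z := by
  have h1 := (D.effect.2 (D.θ z) z).1 (D.effect.1 z)
  rw [show ((D.α D.j).map D.x).eqs = [] from h] at h1
  exact (EqvGen.mem_or_eq (s := fun _ => False) (fun a b hab => by simp [listRel] at hab)
    h1).resolve_right fun h => h.1

theorem added_comm {D : ProcessData N} (h : D.pre.eqs = []) :
    D.added = D.C.graph + closeAll D.closed := by
  have : (D.pre.occ.filter fun y => D.θ y ≠ y) = [] := by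
    rw [List.filter_eq_nil_iff]
    intro y _
    simp [D.θ_eq_self h y]
  rw [added, this]
  simp [translSubst]

theorem fused_comm {D : ProcessData N} (h : D.pre.eqs = []) : fusedNames D.nodes D.θ = ∅ := by
  rw [fusedNames, Finset.filter_eq_empty_iff]
  rintro z _ ⟨y, _, hne, he⟩
  rw [D.θ_eq_self h, D.θ_eq_self h] at he
  exact hne he.symm

theorem exposed_inp {D : ProcessData N} {u : N} {xs : List N} (h : D.pre = .inp u xs) :
    D.nodes.biUnion (fun y => (D.pre.label y).2.toFinset) = xs.toFinset := by
  have hu : u ∈ D.nodes := D.pre_sub (by simp [h, Prefix.occ])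
  ext z
  simp only [h, Prefix.label, Finset.mem_biUnion, List.mem_toFinset]
  constructor
  · rintro ⟨y, _, hz⟩
    split_ifs at hz
    · exact hz
    · simp at hz
  · exact fun hz => ⟨u, hu, by simpa using hz⟩

theorem exposed_out {D : ProcessData N} {u : N} {xs : List N} (h : D.pre = .out u xs) :
    D.nodes.biUnion (fun y => (D.pre.label y).2.toFinset) = xs.toFinset := by
  have hu : u ∈ D.nodes := D.pre_sub (by simp [h, Prefix.occ])
  ext z
  simp only [h, Prefix.label, Finset.mem_biUnion, List.mem_toFinset]
  constructor
  · rintro ⟨y, _, hz⟩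
    split_ifs at hz
    · exact hz
    · simp at hz
  · exact fun hz => ⟨u, hu, by simpa using hz⟩

theorem exposed_fus {D : ProcessData N} {φ : List (N × N)} (h : D.pre = .fus φ) :
    D.nodes.biUnion (fun y => (D.pre.label y).2.toFinset) = ∅ := by
  ext z
  simp [h, Prefix.label]

end ProcessData

/-- A substitutive effect of equations between restricted names moves only such names. -/
theorem IsSubstEffect.moves {φ : List (N × N)} {τ : N → N} (h : IsSubstEffect (listRel φ) τ)
    {v : List N} (hφ : ∀ p ∈ φ, p.1 ∈ v ∧ p.2 ∈ v) (x : N) (hx : τ x ≠ x) : x ∈ v := by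
  have h1 := (h.2 (τ x) x).1 (h.1 x)
  rcases EqvGen.mem_or_eq (s := fun a => a ∈ v) (fun a b hab => hφ (a, b) hab) h1 with h2 | h2
  · exact absurd h2 hx
  · exact h2.2

/-- A communication reaction: the graph obtained by rewriting the edges of an input and of an output
prefix, and connecting the exposed names, realizes a translation of a reduct. -/
theorem reaction_comm {P : Agent N Empty} {v w : List N} {Ss : List (Agent N Empty)}
    {es er : List (Edge Label N)} {σ : N → N} (hs : IsSource P v w Ss es σ)
    (D D' : ProcessData N) {u u' : N} {xs ys : List N} (hD : D.pre = .inp u xs)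
    (hD' : D'.pre = .out u' ys) (hlen : xs.length = ys.length) (hu : σ u = σ u')
    (hes : es.Perm (D.edge :: D'.edge :: er))
    (hf : ∀ z ∈ D.C.fresh, z ∉ v ∧ z ∉ w) (hf' : ∀ z ∈ D'.C.fresh, z ∉ v ∧ z ∉ w)
    (hff : ∀ z ∈ D.C.fresh, z ∉ D'.C.fresh) :
    ∃ P', Red P P' ∧ ∃ v' w' Γ' H, Translates P' v' w' Γ' H ∧ Graph.names H ⊆ Γ' ∧
      Realizes H ((er : Multiset (Edge Label N)) + translSubst w σ + closeAll v.toFinset +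
        D.added + D'.added + pairs xs ys) := by
  obtain ⟨l, hp, hl⟩ := forall₂_perm hs.transl hes
  cases hl with
  | cons h1 hl =>
  cases hl with
  | @cons _ _ Sr _ h2 hl =>
  have h1 := ProcessData.isTranslSeq_edge h1
  have h2 := ProcessData.isTranslSeq_edge h2
  subst h1 h2
  set S := (Agent.sum D.m D.α D.Q).mapName D.x with hS
  set S' := (Agent.sum D'.m D'.α D'.Q).mapName D'.x with hS'
  -- the names of the three parts
  have hperm : w.Perm (S.occ ++ (S'.occ ++ (parList Sr).occ)) := by
    rw [← hs.occ_eq, occ_parList]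
    have := hp.flatMap_right occ
    rwa [List.flatMap_cons, List.flatMap_cons, ← occ_parList Sr] at this
  have hnd := hperm.nodup_iff.1 hs.w_nodup
  obtain ⟨-, hnd', hd⟩ := List.nodup_append'.1 hnd
  obtain ⟨-, hnr, hd'⟩ := List.nodup_append'.1 hnd'
  have hmw : ∀ y, y ∈ w ↔ y ∈ D.nodes ∪ D'.nodes ∨ y ∈ (parList Sr).occ := by
    intro y
    rw [hperm.mem_iff, List.mem_append, List.mem_append, Finset.mem_union, D.mem_nodes,
      D'.mem_nodes, or_assoc]
  have hnn : ∀ y ∈ D.nodes, y ∉ D'.nodes := by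
    intro y h h'
    exact hd (D.mem_nodes.1 h) (List.mem_append_left _ (D'.mem_nodes.1 h'))
  have hxs : ∀ z ∈ xs, z ∈ D.nodes ∧ z ∉ D.C.K.occ := by
    intro z hz
    have hz' : z ∈ D.pre.occ := by simp [hD, Prefix.occ, hz]
    exact ⟨D.pre_sub hz', fun h => (List.nodup_append'.1 D.occ_nodup).2.2 hz' h⟩
  have hys : ∀ z ∈ ys, z ∈ D'.nodes ∧ z ∉ D'.C.K.occ := by
    intro z hz
    have hz' : z ∈ D'.pre.occ := by simp [hD', Prefix.occ, hz]
    exact ⟨D'.pre_sub hz', fun h => (List.nodup_append'.1 D'.occ_nodup).2.2 hz' h⟩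
  have hxynd : (xs ++ ys).Nodup := by
    have h1 := (List.nodup_append'.1 D.occ_nodup).1
    have h2 := (List.nodup_append'.1 D'.occ_nodup).1
    rw [hD] at h1
    rw [hD'] at h2
    exact List.nodup_append'.2 ⟨(List.nodup_cons.1 h1).2, (List.nodup_cons.1 h2).2,
      fun z hz hz' => hnn z (hxs z hz).1 (hys z hz').1⟩
  have hKK : ∀ y ∈ D.C.K.occ, y ∉ D'.C.K.occ := fun y h h' => hnn y (D.K_sub h) (D'.K_sub h')
  have hzip : ∀ p ∈ xs.zip ys, p.1 ∈ D.nodes ∪ D'.nodes ∧ p.2 ∈ D.nodes ∪ D'.nodes := by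
    rintro ⟨a, b⟩ hab
    obtain ⟨ha, hb⟩ := List.of_mem_zip hab
    exact ⟨Finset.mem_union_left _ (hxs a ha).1, Finset.mem_union_right _ (hys b hb).1⟩
  obtain ⟨τ, hτ⟩ := exists_substEffect ((xs.zip ys).map fun p => (σ p.1, σ p.2))
  let X : Reduct N :=
    { D.C.par D'.C hKK hff with
      v := v, w := w, Sr := Sr, er := er, Wc := D.nodes ∪ D'.nodes, σ := σ, τ := τ
      E := xs.zip ys, B₀ := pairs xs ys
      v_nodup := hs.v_nodup
      v_disj_w := hs.disj
      σ_mem := hs.σ_mem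
      mem_w := hmw
      wr_disj := by
        intro y hy h
        rcases Finset.mem_union.1 h with h | h
        · exact hd (D.mem_nodes.1 h) (List.mem_append_right _ hy)
        · exact hd' (D'.mem_nodes.1 h) hy
      wr_nodup := hnr
      Sr_seq := fun T hT => hs.seq T (hp.mem_iff.2 (by simp [hT]))
      Sr_transl := hl
      K_occ := by
        intro y hy
        rcases List.mem_append.1 hy with h | h
        · exact Finset.mem_union_left _ (D.K_sub h)
        · exact Finset.mem_union_right _ (D'.K_sub h)
      fresh_notMem := by
        intro z hz
        have hz' : z ∈ (D.C.par D'.C hKK hff).fresh := hz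
        rw [Cont.fresh_par] at hz'
        exact (Finset.mem_union.1 hz').elim (hf z) (hf' z)
      E_mem := hzip
      B₀_label := by
        intro e he
        obtain ⟨p, -, rfl⟩ := mem_pairs he
        exact ⟨_, rfl⟩
      B₀_deg := fun z hz => deg_pairs hlen hxynd hz
      B₀_names := by
        intro z hz
        rw [names_pairs hlen, Finset.mem_union, List.mem_toFinset, List.mem_toFinset] at hz
        change z ∈ D.nodes ∪ D'.nodes ∧ z ∉ D.C.K.occ ++ D'.C.K.occ
        rw [List.mem_append, not_or, Finset.mem_union]
        rcases hz with hz | hz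
        · exact ⟨.inl (hxs z hz).1, (hxs z hz).2, fun h => hnn z (hxs z hz).1 (D'.K_sub h)⟩
        · exact ⟨.inr (hys z hz).1, fun h => hnn z (D.K_sub h) (hys z hz).1, (hys z hz).2⟩
      B₀_sound := by
        intro e he a ha b hb
        obtain ⟨p, hp, rfl⟩ := mem_pairs he
        have hrel : Relation.EqvGen (listRel (xs.zip ys)) p.1 p.2 := .rel _ _ hp
        simp only [mEdge, List.mem_cons, List.not_mem_nil, or_false] at ha hb
        rcases ha with rfl | rfl <;> rcases hb with rfl | rfl
        · exact .refl _
        · exact hrel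
        · exact .symm _ _ hrel
        · exact .refl _
      B₀_complete := fun p hp =>
        .single ⟨_, mem_pairs_of_mem hp, by simp [mEdge], by simp [mEdge]⟩
      τ_effect := hτ }
  have hmoves : ∀ x, τ x ≠ x → x ∈ v := by
    refine hτ.moves fun q hq => ?_
    obtain ⟨p, hp, rfl⟩ := List.mem_map.1 hq
    have := hzip p hp
    exact ⟨hs.σ_mem _ ((hmw _).2 (.inl this.1)), hs.σ_mem _ ((hmw _).2 (.inl this.2))⟩
  have hcong : Cong P (resList v (((parList Sr).mapName σ).par
      ((S.mapName σ).par (S'.mapName σ)))) := by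
    refine hs.cong.trans (Cong.resList ?_)
    refine ((Cong.parList_perm hp).mapName σ).trans ?_
    change Cong ((S.mapName σ).par ((S'.mapName σ).par ((parList Sr).mapName σ))) _
    exact (Cong.par_assoc _ _ _).symm.trans (Cong.par_comm _ _)
  have hred := Red.comm v ((parList Sr).mapName σ) D.m
    (fun i => ((D.α i).map D.x).map σ) (fun i => ((D.Q i).mapName D.x).mapName σ) D.j D'.m
    (fun i => ((D'.α i).map D'.x).map σ) (fun i => ((D'.Q i).mapName D'.x).mapName σ) D'.j
    (σ u) (xs.map σ) (ys.map σ) τ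
    (by change D.pre.map σ = _; rw [hD]; rfl)
    (by change D'.pre.map σ = _; rw [hD', hu]; rfl) (by simpa using hlen)
    (by rw [List.zip_map]; exact hτ) hmoves
  refine ⟨_, .struct hcong hred (.refl _), X.v', X.wr ++ X.w₁, _, X.H, X.translates ?_, ?_, ?_⟩
  · refine Cong.of_eq ?_
    change _ = resList v (((parList Sr).par (D.C.K.par D'.C.K)).mapName (τ ∘ σ))
    rw [D.K_eq, D'.K_eq]
    simp only [mapName, mapName_mapName]
    rfl
  · refine X.names_H_subset.trans ?_
    rw [Finset.union_assoc]
    exact Finset.subset_union_right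
  · have hc : X.target = (er : Multiset (Edge Label N)) + translSubst w σ + closeAll v.toFinset +
        D.added + D'.added + pairs xs ys := by
      have h1 : closeAll (X.Wc \ (X.B₀.names ∪ X.K.fn)) =
          closeAll D.closed + closeAll D'.closed := by
        rw [← closeAll_union]
        · congr 1
          have hB : X.B₀.names = xs.toFinset ∪ ys.toFinset := names_pairs hlen
          have hK : ∀ z, z ∈ X.K.fn ↔ z ∈ D.C.K.occ ∨ z ∈ D'.C.K.occ := by
            intro z
            rw [mem_fn]
            exact List.mem_append
          ext z
          simp only [ProcessData.closed, D.exposed_inp hD, D'.exposed_out hD',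
            D.fused_comm (by rw [hD]; rfl), D'.fused_comm (by rw [hD']; rfl), hB, hK,
            Finset.mem_sdiff, Finset.mem_union, List.mem_toFinset, mem_fn, X,
            Finset.notMem_empty, or_false]
          constructor
          · rintro ⟨h | h, h'⟩
            · exact .inl ⟨h, by tauto⟩
            · exact .inr ⟨h, by tauto⟩
          · rintro (⟨h, h'⟩ | ⟨h, h'⟩)
            · refine ⟨.inl h, ?_⟩
              rintro ((h1 | h1) | h1 | h1)
              · exact h' (.inl h1)
              · exact hnn z h (hys z h1).1
              · exact h' (.inr h1)
              · exact hnn z h (D'.K_sub h1)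
            · refine ⟨.inr h, ?_⟩
              rintro ((h1 | h1) | h1 | h1)
              · exact hnn z (hxs z h1).1 h
              · exact h' (.inl h1)
              · exact hnn z (D.K_sub h1) h
              · exact h' (.inr h1)
        · rw [Finset.disjoint_left]
          intro z hz hz'
          exact hnn z (Finset.mem_sdiff.1 hz).1 (Finset.mem_sdiff.1 hz').1
      have h2 : X.graph = D.C.graph + D'.C.graph := Cont.graph_par hKK hff
      rw [Reduct.target, h1, h2, D.added_comm (by rw [hD]; rfl),
        D'.added_comm (by rw [hD']; rfl)]
      change (er : Multiset (Edge Label N)) + translSubst w σ + closeAll v.toFinset +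
        (D.C.graph + D'.C.graph) + pairs xs ys + (closeAll D.closed + closeAll D'.closed) = _
      abel
    rw [← hc]
    exact X.realizes

namespace ProcessData

/-- The connectors implementing the substitutive effect of a fusion prefix. -/
noncomputable def fusers (D : ProcessData N) : Graph Label N :=
  translSubst (D.pre.occ.filter fun y => D.θ y ≠ y) D.θ

variable {D : ProcessData N}

theorem mem_pre_of_moved {z : N} (hz : D.θ z ≠ z) : z ∈ D.pre.occ ∧ D.θ z ∈ D.pre.occ := by
  have h1 := (D.effect.2 (D.θ z) z).1 (D.effect.1 z)
  have h2 := EqvGen.mem_or_eq (s := fun a => a ∈ D.pre.occ) (fun a b hab => by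
    change (a, b) ∈ D.pre.eqs at hab
    cases hD : D.pre with
    | inp u xs => simp [hD, Prefix.eqs] at hab
    | out u xs => simp [hD, Prefix.eqs] at hab
    | fus φ =>
      rw [hD] at hab
      simp only [Prefix.occ, List.mem_flatMap]
      exact ⟨⟨(a, b), hab, by simp⟩, ⟨(a, b), hab, by simp⟩⟩) h1
  exact (h2.resolve_left hz).symm

theorem mem_moved {z : N} : (z ∈ D.pre.occ.filter fun y => D.θ y ≠ y) ↔ D.θ z ≠ z := by
  simp only [List.mem_filter, decide_eq_true_eq, and_iff_right_iff_imp]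
  exact fun h => (mem_pre_of_moved h).1

theorem names_fusers : D.fusers.names = fusedNames D.nodes D.θ := by
  ext z
  rw [fusers, mem_names_translSubst, mem_moved, fusedNames, Finset.mem_filter]
  constructor
  · rintro (h | ⟨y, hy, rfl⟩)
    · obtain ⟨h1, h2⟩ := mem_pre_of_moved h
      exact ⟨D.pre_sub h1, _, D.pre_sub h2, h, (D.effect.1 z).symm⟩
    · rw [mem_moved] at hy
      obtain ⟨h1, h2⟩ := mem_pre_of_moved hy
      exact ⟨D.pre_sub h2, _, D.pre_sub h1, hy.symm, D.effect.1 y⟩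
  · rintro ⟨-, y, -, hne, he⟩
    by_cases h : D.θ z = z
    · exact .inr ⟨y, mem_moved.2 fun h' => hne (by rw [← h', ← he, h]), by rw [← he, h]⟩
    · exact .inl h

theorem mem_fusers {e : Edge Label N} (he : e ∈ D.fusers) :
    (∃ k, e.label = Label.m k) ∧ ∃ c, ∀ y ∈ e.nodes, D.θ y = c := by
  obtain ⟨h, y, -, hn⟩ := mem_translSubst he
  refine ⟨h, D.θ y, fun z hz => ?_⟩
  rw [hn, List.mem_cons] at hz
  rcases hz with rfl | hz
  · exact D.effect.1 y
  · simpa using (List.mem_filter.1 hz).2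

/-- A moved name is attached to the same connector as its representative. -/
theorem fusers_adj (z : N) : Relation.ReflTransGen D.fusers.Adj z (D.θ z) ∧
    Relation.ReflTransGen D.fusers.Adj (D.θ z) z := by
  by_cases h : D.θ z = z
  · rw [h]
    exact ⟨.refl, .refl⟩
  · obtain ⟨e, he, hn⟩ := exists_mem_translSubst D.θ (mem_moved.2 h)
    have h1 : z ∈ e.nodes := by
      rw [hn]
      exact List.mem_cons_of_mem _ (List.mem_filter.2 ⟨mem_moved.2 h, by simp⟩)
    have h2 : D.θ z ∈ e.nodes := by simp [hn]
    exact ⟨.single ⟨e, he, h1, h2⟩, .single ⟨e, he, h2, h1⟩⟩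

end ProcessData

/-- A fusion reaction: the graph obtained by rewriting the edge of a fusion prefix realizes a
translation of a reduct. -/
theorem reaction_fusion {P : Agent N Empty} {v w : List N} {Ss : List (Agent N Empty)}
    {es er : List (Edge Label N)} {σ : N → N} (hs : IsSource P v w Ss es σ)
    (D : ProcessData N) {φ : List (N × N)} (hD : D.pre = .fus φ)
    (hes : es.Perm (D.edge :: er)) (hf : ∀ z ∈ D.C.fresh, z ∉ v ∧ z ∉ w) :
    ∃ P', Red P P' ∧ ∃ v' w' Γ' H, Translates P' v' w' Γ' H ∧ Graph.names H ⊆ Γ' ∧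
      Realizes H ((er : Multiset (Edge Label N)) + translSubst w σ + closeAll v.toFinset +
        D.added) := by
  obtain ⟨l, hp, hl⟩ := forall₂_perm hs.transl hes
  cases hl with
  | @cons _ _ Sr _ h1 hl =>
  have h1 := ProcessData.isTranslSeq_edge h1
  subst h1
  set S := (Agent.sum D.m D.α D.Q).mapName D.x with hS
  have hperm : w.Perm (S.occ ++ (parList Sr).occ) := by
    rw [← hs.occ_eq, occ_parList]
    have := hp.flatMap_right occ
    rwa [List.flatMap_cons, ← occ_parList Sr] at this
  obtain ⟨-, hnr, hd⟩ := List.nodup_append'.1 (hperm.nodup_iff.1 hs.w_nodup)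
  have hmw : ∀ y, y ∈ w ↔ y ∈ D.nodes ∨ y ∈ (parList Sr).occ := by
    intro y
    rw [hperm.mem_iff, List.mem_append, D.mem_nodes]
  have hφ : ∀ p ∈ φ, p.1 ∈ D.nodes ∧ p.2 ∈ D.nodes := by
    intro p hp
    constructor <;> refine D.pre_sub ?_ <;> rw [hD] <;>
      exact List.mem_flatMap.2 ⟨p, hp, by simp⟩
  have heff : ∀ x y, D.θ x = D.θ y ↔ Relation.EqvGen (listRel φ) x y := by
    intro x y
    rw [D.effect.2]
    change Relation.EqvGen (listRel D.pre.eqs) x y ↔ _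
    rw [hD]
    rfl
  obtain ⟨τ, hτ⟩ := exists_substEffect (φ.map fun p => (σ p.1, σ p.2))
  let X : Reduct N :=
    { D.C with
      v := v, w := w, Sr := Sr, er := er, Wc := D.nodes, σ := σ, τ := τ
      E := φ, B₀ := D.fusers
      v_nodup := hs.v_nodup
      v_disj_w := hs.disj
      σ_mem := hs.σ_mem
      mem_w := hmw
      wr_disj := fun y hy h => hd (D.mem_nodes.1 h) hy
      wr_nodup := hnr
      Sr_seq := fun T hT => hs.seq T (hp.mem_iff.2 (by simp [hT]))
      Sr_transl := hl
      K_occ := fun y hy => D.K_sub hy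
      fresh_notMem := hf
      E_mem := hφ
      B₀_label := fun e he => (ProcessData.mem_fusers he).1
      B₀_deg := fun z hz => deg_translSubst (fun y hy h => by
        rw [ProcessData.mem_moved] at h
        exact h (D.effect.1 y)) hz
      B₀_names := by
        intro z hz
        have hz' : z ∈ D.pre.occ := by
          rcases mem_names_translSubst.1 hz with hz | ⟨y, hy, rfl⟩
          · exact (ProcessData.mem_pre_of_moved (ProcessData.mem_moved.1 hz)).1
          · exact (ProcessData.mem_pre_of_moved (ProcessData.mem_moved.1 hy)).2
        exact ⟨D.pre_sub hz', fun h => (List.nodup_append'.1 D.occ_nodup).2.2 hz' h⟩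
      B₀_sound := by
        intro e he a ha b hb
        obtain ⟨-, c, hc⟩ := ProcessData.mem_fusers he
        rw [← heff, hc a ha, hc b hb]
      B₀_complete := by
        intro p hp
        have : D.θ p.1 = D.θ p.2 := (heff _ _).2 (.rel _ _ hp)
        exact (ProcessData.fusers_adj p.1).1.trans (this ▸ (ProcessData.fusers_adj p.2).2)
      τ_effect := hτ }
  have hmoves : ∀ x, τ x ≠ x → x ∈ v := by
    refine hτ.moves fun q hq => ?_
    obtain ⟨p, hp, rfl⟩ := List.mem_map.1 hq
    have := hφ p hp
    exact ⟨hs.σ_mem _ ((hmw _).2 (.inl this.1)), hs.σ_mem _ ((hmw _).2 (.inl this.2))⟩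
  have hcong : Cong P (resList v (((parList Sr).mapName σ).par (S.mapName σ))) := by
    refine hs.cong.trans (Cong.resList ?_)
    exact ((Cong.parList_perm hp).mapName σ).trans (Cong.par_comm _ _)
  have hred := Red.fus v ((parList Sr).mapName σ) D.m
    (fun i => ((D.α i).map D.x).map σ) (fun i => ((D.Q i).mapName D.x).mapName σ) D.j
    (φ.map fun p => (σ p.1, σ p.2)) τ
    (by change D.pre.map σ = _; rw [hD]; rfl) hτ hmoves
  refine ⟨_, .struct hcong hred (.refl _), X.v', X.wr ++ X.w₁, _, X.H, X.translates ?_, ?_, ?_⟩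
  · refine Cong.of_eq ?_
    change _ = resList v (((parList Sr).par D.C.K).mapName (τ ∘ σ))
    rw [D.K_eq]
    simp only [mapName, mapName_mapName]
    rfl
  · refine X.names_H_subset.trans ?_
    rw [Finset.union_assoc]
    exact Finset.subset_union_right
  · have hc : X.target = (er : Multiset (Edge Label N)) + translSubst w σ + closeAll v.toFinset +
        D.added := by
      have h1 : D.closed = X.Wc \ (X.B₀.names ∪ X.K.fn) := by
        rw [ProcessData.closed, D.exposed_fus hD, Finset.empty_union,
          ← ProcessData.names_fusers]
      rw [Reduct.target, ← h1]
      change (er : Multiset (Edge Label N)) + translSubst w σ + closeAll v.toFinset +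
        D.C.graph + D.fusers + closeAll D.closed = _ + (D.C.graph + D.fusers + closeAll D.closed)
      abel
    rw [← hc]
    exact X.realizes

end Reactions

/-! ### The unifier of a decomposition -/

section Basics

variable {LE : Type*} [RankedAlphabet LE] {Act : Type*} [ActionSet Act] {N : Type} [DecidableEq N]
  {κ : Type}

theorem Basic.names_source {Prods : κ → Transition LE Act N → Prop} {u : Multiset κ}
    {T : Transition LE Act N} (hT : Basic Prods u T) : T.G.names ⊆ T.Γ := by
  cases hT with
  | prod _ h => exact h.source_wf
  | idle _ h => exact h.source_wf
  | new z a ys _ hG _ _ _ _ _ _ _ => rw [hG]; simp [Graph.names]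

theorem Basic.names_target {Prods : κ → Transition LE Act N → Prop} {u : Multiset κ}
    {T : Transition LE Act N} (hT : Basic Prods u T) : T.G'.names ⊆ T.Φ := by
  cases hT with
  | prod _ h => exact h.target_wf
  | idle _ h => exact h.target_wf
  | new z a ys _ _ _ _ _ _ _ _ hG => rw [hG]; simp [Graph.names]

/-- If the fresh names exposed by a basic transition determine where they are exposed, then the
unifier can be computed by hand: `X z` is the vector of nodes that the node `z` exposes in the
merged transition. Nodes are sent to their images, exposed fresh names to the corresponding entries
of `X`, and all the other names are left alone. Since this assignment solves the unification
problem, the most general unifier identifies no further nodes and none of the other names. -/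
theorem IsDecomp.kernel_le {ι : Type} [Fintype ι] {B : ι → Transition LE Act N} {f g : ι → N → N}
    {T : Transition LE Act N} (h : IsDecomp B f g T) (X : N → List N)
    (hX : ∀ i, ∀ x ∈ (B i).Γ, ∀ (n : ℕ) d, ((B i).Λ x).2[n]? = some d → d ∈ (B i).Γ →
      (X (f i x))[n]? = some (f i d))
    (hU : ∀ i, ∀ x ∈ (B i).Γ, ∀ y ∈ (B i).Γ, ∀ (n n' : ℕ) d, ((B i).Λ x).2[n]? = some d →
      ((B i).Λ y).2[n']? = some d → d ∉ (B i).Γ → x = y ∧ n = n') :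
    (∀ i, ∀ x ∈ (B i).Γ, ∀ j, ∀ y ∈ (B j).Γ, g i x = g j y → f i x = f j y) ∧
    ∀ i, ∀ d ∈ (B i).Φ, d ∉ (B i).Γ → (∀ x ∈ (B i).Γ, d ∉ ((B i).Λ x).2) →
      ∀ j, ∀ y ∈ (B j).Γ ∪ (B j).Φ, g i d = g j y → (i, d) = (j, y) := by
  classical
  let E (p : ι × N) (q : N × ℕ) : Prop :=
    ∃ x ∈ (B p.1).Γ, ((B p.1).Λ x).2[q.2]? = some p.2 ∧ q.1 = f p.1 x
  let m (p : ι × N) : Option N ⊕ (ι × N) :=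
    if p.2 ∈ (B p.1).Γ then .inl (some (f p.1 p.2))
    else if hp : ∃ q, E p q then .inl (X hp.choose.1)[hp.choose.2]? else .inr p
  have hm : ∀ i, ∀ x ∈ (B i).Γ, ∀ (n : ℕ) d, ((B i).Λ x).2[n]? = some d →
      m (i, d) = .inl (X (f i x))[n]? := by
    intro i x hx n d hd
    by_cases hdΓ : d ∈ (B i).Γ
    · simp only [m, if_pos hdΓ, hX i x hx n d hd hdΓ]
    · have hp : ∃ q, E (i, d) q := ⟨(f i x, n), x, hx, hd, rfl⟩
      obtain ⟨y, hy, hd', hq⟩ := hp.choose_spec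
      obtain ⟨rfl, hn⟩ := hU i x hx y hy n _ d hd hd' hdΓ
      simp only [m, if_neg hdΓ, dif_pos hp, hq, hn]
  have hker : ∀ {p q}, Relation.EqvGen (unifEqs B f) p q → m p = m q := by
    intro p q hpq
    induction hpq with
    | rel p q hpq =>
      rcases hpq with ⟨h1, h2, h3⟩ | ⟨x, hx, y, hy, hxy, hz⟩
      · simp only [m, if_pos h1, if_pos h2, h3]
      · obtain ⟨n, hn⟩ := List.mem_iff_getElem?.1 hz
        rw [List.getElem?_zip_eq_some] at hn
        have h1 := hm p.1 x hx n p.2 hn.1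
        have h2 := hm q.1 y hy n q.2 hn.2
        rw [← hxy] at h2
        exact h1.trans h2.symm
    | refl => rfl
    | symm _ _ _ ih => exact ih.symm
    | trans _ _ _ _ _ ih1 ih2 => exact ih1.trans ih2
  constructor
  · intro i x hx j y hy he
    have := hker (h.kernel i j x (Finset.mem_union_left _ hx) y (Finset.mem_union_left _ hy) he)
    simpa [m, hx, hy] using this
  · intro i d hd hdΓ hde j y hy he
    have h1 := hker (h.kernel i j d (Finset.mem_union_right _ hd) y hy he)
    have h2 : m (i, d) = .inr (i, d) := by
      have : ¬ ∃ q, E (i, d) q := by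
        rintro ⟨q, x, hx, hq, -⟩
        exact hde x hx (List.mem_of_getElem? hq)
      simp only [m, if_neg hdΓ, dif_neg this]
    rw [h2] at h1
    by_cases hyΓ : y ∈ (B j).Γ
    · simp [m, hyΓ] at h1
    · by_cases hp : ∃ q, E (j, y) q
      · simp only [m, if_neg hyΓ, dif_pos hp] at h1
        cases h1
      · simp only [m, if_neg hyΓ, dif_neg hp] at h1
        exact Sum.inr.inj h1

end Basics

section Labels

variable {N : Type} [DecidableEq N]

theorem Prefix.label_snd_of_eps {α : Prefix N} {x : N} (h : (α.label x).1 = Action.eps) :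
    (α.label x).2 = [] := by
  cases α with
  | inp u xs => simp only [Prefix.label] at h ⊢; split_ifs at h ⊢; rfl
  | out u xs => simp only [Prefix.label] at h ⊢; split_ifs at h ⊢; rfl
  | fus φ => rfl

theorem Prefix.label_unique {α : Prefix N} {x y : N} (hx : (α.label x).1 ≠ Action.eps)
    (hy : (α.label y).1 ≠ Action.eps) : x = y := by
  cases α with
  | inp u xs =>
    simp only [Prefix.label] at hx hy
    split_ifs at hx hy <;> simp_all
  | out u xs =>
    simp only [Prefix.label] at hx hy
    split_ifs at hx hy <;> simp_all
  | fus φ => exact absurd rfl hx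

theorem Prefix.eq_inp_of_label {α : Prefix N} {x : N} {l : ℕ} {ys : List N}
    (h : α.label x = (Action.inn l, ys)) : α = .inp x ys := by
  cases α with
  | inp u xs =>
    simp only [Prefix.label] at h
    split_ifs at h <;> simp_all
  | out u xs =>
    simp only [Prefix.label] at h
    split_ifs at h <;> simp_all
  | fus φ => simp [Prefix.label] at h

theorem Prefix.eq_out_of_label {α : Prefix N} {x : N} {l : ℕ} {ys : List N}
    (h : α.label x = (Action.out l, ys)) : α = .out x ys := by
  cases α with
  | inp u xs =>
    simp only [Prefix.label] at h
    split_ifs at h <;> simp_all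
  | out u xs =>
    simp only [Prefix.label] at h
    split_ifs at h <;> simp_all
  | fus φ => simp [Prefix.label] at h

theorem Prefix.mem_occ_of_label {α : Prefix N} {x c : N} (h : c ∈ (α.label x).2) : c ∈ α.occ := by
  cases α with
  | inp u xs => simp only [Prefix.label] at h; split_ifs at h <;> simp_all [Prefix.occ]
  | out u xs => simp only [Prefix.label] at h; split_ifs at h <;> simp_all [Prefix.occ]
  | fus φ => simp [Prefix.label] at h

namespace ProcessProduction

variable {k : ProdKind} {T : Transition Label Action N}

theorem exists_pre (h : ProcessProduction k T) : ∃ D : ProcessData N, k = D.pre.kind ∧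
    T.Γ = D.nodes ∧ T.G = {D.edge} ∧ T.Λ = D.pre.label := by
  obtain ⟨D, h1, h2, h3, h4, -⟩ := h.exists_data (Equiv.refl N)
  refine ⟨D, h1, by simpa using h2, ?_, ?_⟩
  · rw [← h3]
    exact (Graph.map_id _).symm
  · funext z
    have := h4 z
    simpa using this.symm

theorem kind_ne_aux (h : ProcessProduction k T) : k ≠ .aux := by
  obtain ⟨D, rfl, -⟩ := h.exists_pre
  cases D.pre <;> simp [Prefix.kind]

theorem active_unique (h : ProcessProduction k T) {x y : N} (hx : (T.Λ x).1 ≠ Action.eps)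
    (hy : (T.Λ y).1 ≠ Action.eps) : x = y := by
  obtain ⟨D, -, -, -, hΛ⟩ := h.exists_pre
  rw [hΛ] at hx hy
  exact Prefix.label_unique hx hy

theorem exposed_mem (h : ProcessProduction k T) {x c : N} (hc : c ∈ (T.Λ x).2) : c ∈ T.Γ := by
  obtain ⟨D, -, hΓ, -, hΛ⟩ := h.exists_pre
  rw [hΛ] at hc
  rw [hΓ]
  exact D.pre_sub (Prefix.mem_occ_of_label hc)

theorem exposed_of_eps (h : ProcessProduction k T) {x : N} (hx : (T.Λ x).1 = Action.eps) :
    (T.Λ x).2 = [] := by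
  obtain ⟨D, -, -, -, hΛ⟩ := h.exists_pre
  rw [hΛ] at hx ⊢
  exact Prefix.label_snd_of_eps hx

theorem kind_of_active (h : ProcessProduction k T) {x : N} (hx : (T.Λ x).1 ≠ Action.eps) :
    k = .comm := by
  obtain ⟨D, rfl, -, -, hΛ⟩ := h.exists_pre
  rw [hΛ] at hx
  cases hD : D.pre with
  | inp u xs => rfl
  | out u xs => rfl
  | fus φ => rw [hD] at hx; exact absurd rfl hx

theorem exists_active (h : ProcessProduction .comm T) : ∃ x ∈ T.Γ, (T.Λ x).1 ≠ Action.eps := by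
  obtain ⟨D, hk, hΓ, -, hΛ⟩ := h.exists_pre
  rw [hΓ, hΛ]
  cases hD : D.pre with
  | inp u xs =>
    exact ⟨u, D.pre_sub (by simp [hD, Prefix.occ]), by simp [Prefix.label]⟩
  | out u xs =>
    exact ⟨u, D.pre_sub (by simp [hD, Prefix.occ]), by simp [Prefix.label]⟩
  | fus φ => simp [hD, Prefix.kind] at hk

end ProcessProduction

theorem FusionProduction.π_eq {k : ProdKind} {T : Transition Label Action N}
    (h : FusionProduction k T) : T.π = id := by
  rcases h with h | h <;> cases h <;> rfl

/-- The basic transitions of the HSHR system for Fusion. -/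
theorem Basic.cases_fusion {u : Multiset ProdKind} {T : Transition Label Action N}
    (h : Basic FusionProduction u T) :
    (∃ k, u = {k} ∧ ProcessProduction k T) ∨ (u = {.aux} ∧ AuxProduction T) ∨
    (u = 0 ∧ T.IsIdle) ∨
    (u = 0 ∧ T.G = 0 ∧ T.G' = 0 ∧ ∃ x a ys, T.Γ = {x} ∧ T.Λ x = (a, ys) ∧ ys.Nodup ∧ x ∉ ys) := by
  cases h with
  | prod hp _ =>
    cases hp with
    | process hp => exact .inl ⟨_, rfl, hp⟩
    | auxiliary hp => exact .inr (.inl ⟨rfl, hp⟩)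
  | idle h _ => exact .inr (.inr (.inl ⟨rfl, h⟩))
  | new x a ys hΓ hG hΛ _ _ hnd hx _ hG' =>
    exact .inr (.inr (.inr ⟨rfl, hG, hG', x, a, ys, hΓ, hΛ, hnd, hx⟩))

theorem AuxProduction.label_edge {T : Transition Label Action N} (h : AuxProduction T)
    {e : Edge Label N} (he : e ∈ T.G) : ∃ k, e.label = Label.m k := by
  cases h with
  | mk x y l a b ys zs =>
    rw [Multiset.mem_singleton] at he
    exact ⟨_, congrArg Edge.label he⟩

theorem AuxProduction.fresh_exposed {T : Transition Label Action N} (h : AuxProduction T)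
    {x c : N} (hc : c ∈ (T.Λ x).2) : c ∉ T.Γ := by
  cases h with
  | mk x y l a b ys zs nodup ha hb hab len fresh disj =>
    rw [List.mem_toFinset]
    refine fun h => disj ?_ h
    simp only at hc
    split_ifs at hc
    · exact List.mem_append_left _ hc
    · exact List.mem_append_right _ hc
    · simp at hc

theorem AuxProduction.exposed_unique {T : Transition Label Action N} (h : AuxProduction T)
    {x y c : N} {n n' : ℕ} (hx : (T.Λ x).2[n]? = some c) (hy : (T.Λ y).2[n']? = some c) :
    x = y ∧ n = n' := by
  cases h with
  | mk x' y' l a b ys zs nodup ha hb hab len fresh disj =>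
    obtain ⟨h1, h2, h3⟩ := List.nodup_append'.1 fresh
    have key : ∀ {ys : List N}, ys.Nodup → ys[n]? = some c → ys[n']? = some c → n = n' := by
      intro ys h hn hn'
      obtain ⟨hl, -⟩ := List.getElem?_eq_some_iff.1 hn
      exact (List.getElem?_inj hl h).1 (hn.trans hn'.symm)
    simp only at hx hy
    split_ifs at hx hy with hxa hya hyb hxb hya hyb
    · exact ⟨hxa.trans hya.symm, key h1 hx hy⟩
    · exact absurd (List.mem_of_getElem? hy) (h3 (List.mem_of_getElem? hx))
    · simp at hy
    · exact absurd (List.mem_of_getElem? hx) (h3 (List.mem_of_getElem? hy))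
    · exact ⟨hxb.trans hyb.symm, key h2 hx hy⟩
    all_goals simp at hx hy

end Labels

/-! ### Transitions of translations -/

section Runs

variable {N : Type} [DecidableEq N]

theorem nodup_of_mem_translSeqs {Ss : List (Agent N Empty)} {es : List (Edge Label N)}
    (h : List.Forall₂ IsTranslSeq Ss es) (hnd : (parList Ss).occ.Nodup) {e : Edge Label N}
    (he : e ∈ es) : e.nodes.Nodup := by
  rw [occ_parList, List.nodup_flatMap] at hnd
  replace hnd := hnd.1
  induction h with
  | nil => simp at he
  | cons h _ ih =>
    rcases List.mem_cons.1 he with rfl | he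
    · rw [h.nodes]
      exact hnd _ List.mem_cons_self
    · exact ih he fun S hS => hnd S (List.mem_cons_of_mem _ hS)

theorem label_of_mem_translSeqs {Ss : List (Agent N Empty)} {es : List (Edge Label N)}
    (h : List.Forall₂ IsTranslSeq Ss es) {e : Edge Label N} (he : e ∈ es) :
    ∃ k S, e.label = Label.L k S := by
  induction h with
  | nil => simp at he
  | cons h _ ih =>
    rcases List.mem_cons.1 he with rfl | he
    · obtain ⟨k, S', ρ, -, -, rfl⟩ := h
      exact ⟨k, S', rfl⟩
    · exact ih he

/-- A transition `T` of the translation of a closed process, decomposed into basic transitions. -/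
structure IsRun {ι : Type} [Fintype ι] (u : ι → Multiset ProdKind)
    (B : ι → Transition Label Action N) (f g : ι → N → N) (T : Transition Label Action N)
    (v w : List N) (es : List (Edge Label N)) (σ : N → N) : Prop where
  shr : T.IsSHR
  basic : ∀ i, Basic FusionProduction (u i) (B i)
  decomp : IsDecomp B f g T
  source : T.G = (es : Multiset (Edge Label N)) + translSubst w σ + closeAll v.toFinset
  nodes : T.Γ = v.toFinset ∪ w.toFinset
  es_label : ∀ e ∈ es, ∃ k S, e.label = Label.L k S
  es_nodup : ∀ e ∈ es, e.nodes.Nodup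
  es_names : ∀ z ∈ w, ∃ e ∈ es, z ∈ e.nodes
  disj : ∀ x ∈ v, x ∉ w
  σ_mem : ∀ y ∈ w, σ y ∈ v

namespace IsRun

variable {ι : Type} [Fintype ι] {u : ι → Multiset ProdKind}
  {B : ι → Transition Label Action N} {f g : ι → N → N} {T : Transition Label Action N}
  {v w : List N} {es : List (Edge Label N)} {σ : N → N}

theorem exists_source (h : IsRun u B f g T v w es σ) {e : Edge Label N} (he : e ∈ T.G) :
    ∃ i, ∃ e' ∈ (B i).G, e'.map (f i) = e := by
  rw [h.decomp.source] at he
  obtain ⟨i, -, he⟩ := Multiset.mem_sum.1 he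
  exact ⟨i, Multiset.mem_map.1 he⟩

theorem label_eq (h : IsRun u B f g T v w es σ) {i : ι} {x : N} (hx : x ∈ (B i).Γ) :
    T.Λ (f i x) = (((B i).Λ x).1, ((B i).Λ x).2.map (g i)) := h.decomp.label i x hx

/-- The basic transition that rewrites an edge attached to an active node uses a production. -/
theorem exists_production (h : IsRun u B f g T v w es σ) {e : Edge Label N} (he : e ∈ T.G) {z : N}
    (hz : z ∈ e.nodes) (ha : (T.Λ z).1 ≠ Action.eps) :
    ∃ i, ∃ e' ∈ (B i).G, e'.map (f i) = e ∧ ∃ x ∈ (B i).Γ, f i x = z ∧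
      ((∃ k, u i = {k} ∧ ProcessProduction k (B i)) ∨ (u i = {.aux} ∧ AuxProduction (B i))) := by
  obtain ⟨i, e', he', rfl⟩ := h.exists_source he
  obtain ⟨x, hx, rfl⟩ := List.mem_map.1 hz
  have hxΓ : x ∈ (B i).Γ := (h.basic i).names_source (Graph.mem_names.2 ⟨e', he', hx⟩)
  refine ⟨i, e', he', rfl, x, hxΓ, rfl, ?_⟩
  rcases (h.basic i).cases_fusion with hp | hp | ⟨-, hp⟩ | ⟨-, hp, -⟩
  · exact .inl hp
  · exact .inr hp
  · rw [h.label_eq hxΓ, (hp.label x hxΓ).1] at ha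
    exact absurd rfl ha
  · simp [hp] at he'

theorem label_process {k : ProdKind} {B : Transition Label Action N} (h : ProcessProduction k B)
    {e : Edge Label N} (he : e ∈ B.G) : ∃ k S, e.label = Label.L k S := by
  obtain ⟨D, -, -, hG, -⟩ := h.exists_pre
  rw [hG, Multiset.mem_singleton] at he
  exact ⟨_, _, congrArg Edge.label he⟩

/-- Only nodes of `w` can be active, as every node of `v` is attached to an edge `n`. -/
theorem active_mem (h : IsRun u B f g T v w es σ) {z : N} (hz : z ∈ T.Γ)
    (ha : (T.Λ z).1 ≠ Action.eps) : z ∈ w := by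
  rw [h.nodes, Finset.mem_union, List.mem_toFinset, List.mem_toFinset] at hz
  refine hz.resolve_left fun hv => ?_
  -- the edge `n(z)` can only be idle
  have he : nEdge z ∈ T.G := by
    rw [h.source]
    exact Multiset.mem_add.2 (.inr (mem_closeAll.2 ⟨z, List.mem_toFinset.2 hv, rfl⟩))
  obtain ⟨i, e', he', hee, -, -, -, ⟨k, -, hp⟩ | ⟨-, hp⟩⟩ :=
    h.exists_production he (by simp [nEdge]) ha
  · obtain ⟨k, S, hl⟩ := label_process hp he'
    have hl' : (e'.map (f i)).label = (nEdge z).label := congrArg Edge.label hee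
    simp [Edge.map, hl, nEdge] at hl'
  · obtain ⟨k, hl⟩ := hp.label_edge he'
    have hl' : (e'.map (f i)).label = (nEdge z).label := congrArg Edge.label hee
    simp [Edge.map, hl, nEdge] at hl'

theorem exists_process (h : IsRun u B f g T v w es σ) {z : N} (hz : z ∈ T.Γ)
    (ha : (T.Λ z).1 ≠ Action.eps) :
    ∃ i, u i = {.comm} ∧ ProcessProduction .comm (B i) ∧ ∃ x ∈ (B i).Γ, f i x = z := by
  obtain ⟨e, he, hze⟩ := h.es_names z (h.active_mem hz ha)
  have he' : e ∈ T.G := by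
    rw [h.source, add_assoc]
    exact Multiset.mem_add.2 (.inl he)
  obtain ⟨i, e', he', hee, x, hx, rfl, ⟨k, hu, hp⟩ | ⟨-, hp⟩⟩ :=
    h.exists_production he' hze ha
  · rw [h.label_eq hx] at ha
    obtain rfl := hp.kind_of_active ha
    exact ⟨i, hu, hp, x, hx, rfl⟩
  · obtain ⟨k, hl⟩ := hp.label_edge he'
    obtain ⟨k', S, hl'⟩ := h.es_label e he
    have hl₂ : (e'.map (f i)).label = e.label := congrArg Edge.label hee
    simp [Edge.map, hl, hl'] at hl₂

theorem exists_aux (h : IsRun u B f g T v w es σ) {z : N} (hz : z ∈ T.Γ)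
    (ha : (T.Λ z).1 ≠ Action.eps) : ∃ i, AuxProduction (B i) := by
  obtain ⟨e, he, hn⟩ := exists_mem_translSubst σ (h.active_mem hz ha)
  have hze : z ∈ e.nodes := by
    rw [hn]
    exact List.mem_cons_of_mem _ (List.mem_filter.2 ⟨h.active_mem hz ha, by simp⟩)
  have he' : e ∈ T.G := by
    rw [h.source]
    exact Multiset.mem_add.2 (.inl (Multiset.mem_add.2 (.inr he)))
  obtain ⟨i, e', he', hee, -, -, -, ⟨k, -, hp⟩ | ⟨-, hp⟩⟩ := h.exists_production he' hze ha
  · obtain ⟨k, S, hl⟩ := label_process hp he'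
    obtain ⟨⟨k', hl'⟩, -⟩ := mem_translSubst he
    have hl₂ : (e'.map (f i)).label = e.label := congrArg Edge.label hee
    simp [Edge.map, hl, hl'] at hl₂
  · exact ⟨i, hp⟩

/-- The merged transition fuses no nodes, and the names added by process productions are fresh and
pairwise distinct. Here `X z` is the vector exposed by the process edge at the node `z`. -/
theorem kernel_le (h : IsRun u B f g T v w es σ) (X : N → List N)
    (hX : ∀ i k, ProcessProduction k (B i) → ∀ x ∈ (B i).Γ, ((B i).Λ x).1 ≠ Action.eps →
      X (f i x) = ((B i).Λ x).2.map (f i)) :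
    (∀ i, ∀ x ∈ (B i).Γ, g i x = f i x) ∧
    ∀ i k, ProcessProduction k (B i) → ∀ d ∈ (B i).Φ, d ∉ (B i).Γ →
      g i d ∉ T.Γ ∧ ∀ j, ∀ y ∈ (B j).Γ ∪ (B j).Φ, g i d = g j y → (i, d) = (j, y) := by
  obtain ⟨h1, h2⟩ := h.decomp.kernel_le X
    (by
      intro i x hx n d hd hdΓ
      have hmem := List.mem_of_getElem? hd
      rcases (h.basic i).cases_fusion with ⟨k, -, hp⟩ | ⟨-, hp⟩ | ⟨-, hp⟩ |
        ⟨-, -, -, z, a, ys, hΓ, hΛ, -, hz⟩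
      · have ha : ((B i).Λ x).1 ≠ Action.eps := fun h0 => by
          rw [hp.exposed_of_eps h0] at hmem
          simp at hmem
        rw [hX i k hp x hx ha, List.getElem?_map, hd]
        rfl
      · exact absurd hdΓ (hp.fresh_exposed hmem)
      · rw [(hp.label x hx).1] at hmem
        simp at hmem
      · rw [hΓ, Finset.mem_singleton] at hx hdΓ
        subst hx hdΓ
        rw [hΛ] at hmem
        exact absurd hmem hz)
    (by
      intro i x hx y hy n n' d hd hd' hdΓ
      have hmem := List.mem_of_getElem? hd
      rcases (h.basic i).cases_fusion with ⟨k, -, hp⟩ | ⟨-, hp⟩ | ⟨-, hp⟩ |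
        ⟨-, -, -, z, a, ys, hΓ, hΛ, hnd, hz⟩
      · exact absurd (hp.exposed_mem hmem) hdΓ
      · exact hp.exposed_unique hd hd'
      · rw [(hp.label x hx).1] at hmem
        simp at hmem
      · rw [hΓ, Finset.mem_singleton] at hx hy
        subst hx hy
        rw [hΛ] at hd hd'
        obtain ⟨hl, -⟩ := List.getElem?_eq_some_iff.1 hd
        exact ⟨rfl, (List.getElem?_inj hl hnd).1 (hd.trans hd'.symm)⟩)
  have hmemΓ : ∀ i, ∀ x ∈ (B i).Γ, f i x ∈ T.Γ := fun i x hx =>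
    (h.decomp.nodes _).2 ⟨i, x, hx, rfl⟩
  -- `π` is idempotent, so it is the identity if it identifies no nodes
  have h3 : ∀ i, ∀ x ∈ (B i).Γ, g i x = f i x := by
    intro i x hx
    have hπ := h.decomp.fusion i x hx
    obtain ⟨j, y, hy, hjy⟩ := (h.decomp.nodes _).1 (h.shr.maps _ (hmemΓ i x hx))
    have h5 : g i x = g j y := by
      rw [← h.decomp.fusion j y hy, hjy, h.shr.idem _ (hmemΓ i x hx), hπ]
    rw [h1 i x hx j y hy h5, hjy, hπ]
  refine ⟨h3, fun i k hp d hd hdΓ => ?_⟩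
  have h4 := h2 i d hd hdΓ fun x _ hdx => hdΓ (hp.exposed_mem hdx)
  refine ⟨fun hT => ?_, h4⟩
  obtain ⟨j, y, hy, hjy⟩ := (h.decomp.nodes _).1 hT
  have := h4 j y (Finset.mem_union_left _ hy) (by rw [h3 j y hy, hjy])
  cases this
  exact hdΓ hy

/-- A process production of a run, with its names replaced by those of the merged transition: this
is a renaming, since the unifier identifies no nodes and leaves the added names alone. -/
theorem exists_data (h : IsRun u B f g T v w es σ) (hg : ∀ i, ∀ x ∈ (B i).Γ, g i x = f i x)
    (hfresh : ∀ i k, ProcessProduction k (B i) → ∀ d ∈ (B i).Φ, d ∉ (B i).Γ →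
      g i d ∉ T.Γ ∧ ∀ j, ∀ y ∈ (B j).Γ ∪ (B j).Φ, g i d = g j y → (i, d) = (j, y))
    {i : ι} {k : ProdKind} (hp : ProcessProduction k (B i)) :
    ∃ D : ProcessData N, k = D.pre.kind ∧ Graph.map (f i) (B i).G = {D.edge} ∧
      (∀ x ∈ (B i).Γ, D.pre.label (f i x) = T.Λ (f i x)) ∧
      (∀ z ∈ D.C.fresh, ∃ d ∈ (B i).Φ, d ∉ (B i).Γ ∧ g i d = z) ∧
      (∀ z ∈ D.C.fresh, z ∉ v ∧ z ∉ w) ∧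
      Graph.map (g i) (B i).G' = D.added := by
  obtain ⟨D₀, -, hΓ, hG, -⟩ := hp.exists_pre
  have hle : Graph.map (f i) (B i).G ≤ T.G := by
    rw [h.decomp.source]
    exact Finset.single_le_sum (f := fun i => Graph.map (f i) (B i).G)
      (fun _ _ => Multiset.zero_le _) (Finset.mem_univ i)
  -- the nodes of the edge are not identified
  have hf : ∀ x ∈ (B i).Γ, ∀ y ∈ (B i).Γ, f i x = f i y → x = y := by
    have he : D₀.edge.map (f i) ∈ T.G := Multiset.mem_of_le hle (by
      rw [hG]
      exact Multiset.mem_singleton_self _)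
    have he' : D₀.edge.map (f i) ∈ es := by
      rw [h.source, Multiset.mem_add, Multiset.mem_add] at he
      rcases he with (he | he) | he
      · exact he
      · obtain ⟨⟨k, hk⟩, -⟩ := mem_translSubst he
        simp [Edge.map, ProcessData.edge, lEdge] at hk
      · obtain ⟨z, -, hz⟩ := mem_closeAll.1 he
        have := congrArg Edge.label hz
        simp [Edge.map, ProcessData.edge, lEdge, nEdge] at this
    have hnd := h.es_nodup _ he'
    have hmem : ∀ x ∈ (B i).Γ, x ∈ D₀.edge.nodes := by
      intro x hx
      rw [hΓ, D₀.mem_nodes, D₀.occ_eq] at hx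
      exact hx
    exact fun x hx y hy hxy => List.inj_on_of_nodup_map hnd (hmem x hx) (hmem y hy) hxy
  have hginj : ∀ x ∈ (B i).Γ ∪ (B i).Φ, ∀ y ∈ (B i).Γ ∪ (B i).Φ, g i x = g i y → x = y := by
    intro x hx y hy hxy
    by_cases hxΓ : x ∈ (B i).Γ
    · by_cases hyΓ : y ∈ (B i).Γ
      · rw [hg i x hxΓ, hg i y hyΓ] at hxy
        exact hf x hxΓ y hyΓ hxy
      · have hyΦ := (Finset.mem_union.1 hy).resolve_left hyΓ
        exact (Prod.ext_iff.1 ((hfresh i k hp y hyΦ hyΓ).2 i x hx hxy.symm)).2.symm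
    · have hxΦ := (Finset.mem_union.1 hx).resolve_left hxΓ
      exact (Prod.ext_iff.1 ((hfresh i k hp x hxΦ hxΓ).2 i y hy hxy)).2
  obtain ⟨e, he⟩ := exists_perm_extending hginj
  obtain ⟨D, hk, -, hedge, hlabel, hfr, hfr', hadd⟩ := hp.exists_data e
  have hef : ∀ x ∈ (B i).Γ, e x = f i x := fun x hx => by
    rw [he x (Finset.mem_union_left _ hx), hg i x hx]
  have hfr'' : ∀ z ∈ D.C.fresh, ∃ d ∈ (B i).Φ, d ∉ (B i).Γ ∧ g i d = z := by
    intro z hz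
    obtain ⟨d, hd, rfl⟩ := Finset.mem_image.1 (hfr hz)
    exact ⟨d, hd, fun hdΓ => hfr' d hdΓ hz, (he d (Finset.mem_union_right _ hd)).symm⟩
  refine ⟨D, hk, ?_, ?_, hfr'', ?_, ?_⟩
  · rw [← hedge]
    exact Graph.map_congr fun x hx => (hef x ((h.basic i).names_source hx)).symm
  · intro x hx
    rw [← hef x hx, hlabel x, hef x hx, h.label_eq hx]
    congr 1
    exact List.map_congr_left fun c hc => he c (Finset.mem_union_left _ (hp.exposed_mem hc))
  · intro z hz
    obtain ⟨d, hd, hdΓ, rfl⟩ := hfr'' z hz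
    have := (hfresh i k hp d hd hdΓ).1
    rw [h.nodes, Finset.mem_union, not_or, List.mem_toFinset, List.mem_toFinset] at this
    exact this
  · rw [← hadd]
    exact Graph.map_congr fun x hx =>
      (he x (Finset.mem_union_right _ ((h.basic i).names_target hx))).symm

/-- A basic transition that uses no production leaves its edges unchanged. -/
theorem map_idle (h : IsRun u B f g T v w es σ) (hg : ∀ i, ∀ x ∈ (B i).Γ, g i x = f i x) {i : ι}
    (hu : u i = 0) : Graph.map (g i) (B i).G' = Graph.map (f i) (B i).G := by
  rcases (h.basic i).cases_fusion with ⟨k, hk, -⟩ | ⟨hk, -⟩ | ⟨-, hp⟩ | ⟨-, hG, hG', -⟩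
  · simp [hk] at hu
  · simp [hk] at hu
  · rw [hp.target]
    exact Graph.map_congr fun x hx => hg i x ((h.basic i).names_source hx)
  · rw [hG, hG']
    rfl

theorem le_es (h : IsRun u B f g T v w es σ) {s : Graph Label N} (hs : s ≤ T.G)
    (hl : ∀ e ∈ s, ∃ k S, e.label = Label.L k S) : s ≤ (es : Multiset (Edge Label N)) := by
  rw [h.source, add_assoc] at hs
  refine le_of_le_add_of_forall hs _ hl fun e he => ?_
  rintro ⟨k, S, hkS⟩
  rcases Multiset.mem_add.1 he with he | he
  · obtain ⟨⟨k', hk'⟩, -⟩ := mem_translSubst he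
    rw [hk'] at hkS
    cases hkS
  · obtain ⟨z, -, rfl⟩ := mem_closeAll.1 he
    cases hkS

theorem le_translSubst (h : IsRun u B f g T v w es σ) {s : Graph Label N} (hs : s ≤ T.G)
    (hl : ∀ e ∈ s, ∃ k, e.label = Label.m k) : s ≤ translSubst w σ := by
  rw [h.source, add_right_comm, add_comm] at hs
  refine le_of_le_add_of_forall hs _ hl fun e he => ?_
  rintro ⟨k, hk⟩
  rcases Multiset.mem_add.1 he with he | he
  · obtain ⟨k', S, hk'⟩ := h.es_label e he
    rw [hk'] at hk
    cases hk
  · obtain ⟨z, -, rfl⟩ := mem_closeAll.1 he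
    cases hk

end IsRun

end Runs

/-! ### Completeness -/

section Completeness

variable {N : Type} [DecidableEq N]

theorem map_pairs (g : N → N) (xs ys : List N) :
    Graph.map g (pairs xs ys) = pairs (xs.map g) (ys.map g) := by
  rw [pairs, pairs, List.zipWith_map, Graph.map, Multiset.map_coe, List.map_zipWith]
  rfl

theorem AuxProduction.exists_pairs {T : Transition Label Action N} (h : AuxProduction T) :
    ∃ a ∈ T.Γ, ∃ b ∈ T.Γ, ∃ ys zs : List N, ys.length = zs.length ∧
      T.Λ a = (Action.inn ys.length, ys) ∧ T.Λ b = (Action.out zs.length, zs) ∧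
      T.G' = T.G + pairs ys zs ∧ ∃ e, T.G = {e} ∧ a ∈ e.nodes ∧ b ∈ e.nodes := by
  cases h with
  | mk x y l a b ys zs nodup ha hb hab len fresh disj =>
    refine ⟨a, List.mem_toFinset.2 ha, b, List.mem_toFinset.2 hb, ys, zs, len, ?_, ?_, rfl, _, rfl,
      ha, hb⟩
    · simp
    · simp [hab.symm]

namespace IsRun

variable {ι : Type} [Fintype ι] {u : ι → Multiset ProdKind}
  {B : ι → Transition Label Action N} {f g : ι → N → N} {T : Transition Label Action N}
  {v w : List N} {es : List (Edge Label N)} {σ : N → N}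

theorem kind_of_active (h : IsRun u B f g T v w es σ) {i : ι} {k : ProdKind}
    (hp : ProcessProduction k (B i)) {x : N} (hx : x ∈ (B i).Γ)
    (ha : ((B i).Λ x).1 ≠ Action.eps) : u i = {.comm} := by
  obtain ⟨D, -, -, hG, -⟩ := hp.exists_pre
  rcases (h.basic i).cases_fusion with ⟨k', hk, hp'⟩ | ⟨-, hp'⟩ | ⟨-, hp'⟩ | ⟨-, hG', -⟩
  · rw [hk, hp'.kind_of_active ha]
  · obtain ⟨k', hk'⟩ := hp'.label_edge (hG ▸ Multiset.mem_singleton_self D.edge)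
    cases hk'
  · rw [(hp'.label x hx).1] at ha
    exact absurd rfl ha
  · rw [hG] at hG'
    simp at hG'

theorem map_le (h : IsRun u B f g T v w es σ) {i j : ι} (hij : i ≠ j) :
    Graph.map (f i) (B i).G + Graph.map (f j) (B j).G ≤ T.G := by
  classical
  rw [h.decomp.source, ← Finset.sum_pair (f := fun i => Graph.map (f i) (B i).G) hij]
  exact Finset.sum_le_sum_of_subset (Finset.subset_univ _)

theorem mem_Γ (h : IsRun u B f g T v w es σ) {i : ι} {x : N} (hx : x ∈ (B i).Γ) : f i x ∈ T.Γ :=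
  (h.decomp.nodes _).2 ⟨i, x, hx, rfl⟩

/-- Two active connectors at the same node would both be the unique connector at that node. -/
theorem aux_unique (h : IsRun u B f g T v w es σ) {i j : ι} {e e' : Edge Label N}
    (hi : (B i).G = {e}) (hj : (B j).G = {e'}) (hpi : AuxProduction (B i))
    (hpj : AuxProduction (B j)) {x y : N} (hx : x ∈ e.nodes) (hy : y ∈ e'.nodes)
    (hxy : f i x = f j y) (hw : f i x ∈ w) : i = j := by
  by_contra hij
  have hle := h.le_translSubst (h.map_le hij) (by
    intro e he
    rcases Multiset.mem_add.1 he with he | he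
    · obtain ⟨e', he', rfl⟩ := Multiset.mem_map.1 he
      obtain ⟨k, hk⟩ := hpi.label_edge he'
      exact ⟨k, hk⟩
    · obtain ⟨e', he', rfl⟩ := Multiset.mem_map.1 he
      obtain ⟨k, hk⟩ := hpj.label_edge he'
      exact ⟨k, hk⟩)
  have h1 : (translSubst w σ).deg (f i x) = 1 :=
    deg_translSubst (fun y hy hy' => h.disj _ (h.σ_mem y hy) hy')
      (mem_names_translSubst.2 (.inl hw))
  have h2 : Graph.deg (Graph.map (f i) (B i).G + Graph.map (f j) (B j).G) (f i x) ≤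
      (translSubst w σ).deg (f i x) :=
    Multiset.card_le_card (Multiset.filter_le_filter _ hle)
  have h3 : 0 < Graph.deg (Graph.map (f i) (B i).G) (f i x) :=
    Graph.deg_pos.2 (Graph.mem_names_map.2
      ⟨x, Graph.mem_names.2 ⟨e, by rw [hi]; exact Multiset.mem_singleton_self _, hx⟩, rfl⟩)
  have h4 : 0 < Graph.deg (Graph.map (f j) (B j).G) (f i x) :=
    Graph.deg_pos.2 (Graph.mem_names_map.2
      ⟨y, Graph.mem_names.2 ⟨e', by rw [hj]; exact Multiset.mem_singleton_self _, hy⟩, hxy.symm⟩)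
  rw [Graph.deg_add] at h2
  omega

/-- Two communication productions implement a communication. -/
theorem exists_red_of_comm (h : IsRun u B f g T v w es σ) {P : Agent N Empty} {Ss : List (Agent N Empty)}
    (hs : IsSource P v w Ss es σ) (hc : (∑ i, u i).count .comm = 2)
    (hf : (∑ i, u i).count .fusion = 0) :
    ∃ P', Red P P' ∧ ∃ v' w' Γ' H, Translates P' v' w' Γ' H ∧ Graph.names H ⊆ Γ' ∧
      Realizes H T.G' := by
  classical
  rw [Multiset.count_sum'] at hc hf
  -- a connector that is active together with the edges of an input and of an output
  obtain ⟨i₀, hi₀⟩ : ∃ i, (u i).count .comm ≠ 0 := by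
    by_contra! h0
    simp [h0] at hc
  have hp₀ : ProcessProduction .comm (B i₀) := by
    rcases (h.basic i₀).cases_fusion with ⟨k, hk, hp⟩ | ⟨hk, -⟩ | ⟨hk, -⟩ | ⟨hk, -⟩
    · have : k = .comm := by
        rw [hk, Multiset.count_singleton] at hi₀
        by_contra hne
        exact hi₀ (if_neg (Ne.symm hne))
      exact this ▸ hp
    all_goals simp [hk] at hi₀
  obtain ⟨x₀, hx₀, ha₀⟩ := hp₀.exists_active
  obtain ⟨k, hk⟩ := h.exists_aux (h.mem_Γ hx₀) (by rw [h.label_eq hx₀]; exact ha₀)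
  obtain ⟨a, ha, b, hb, ys, zs, hlen, hΛa, hΛb, hG'k, ek, hGk, hae, hbe⟩ := hk.exists_pairs
  have hTa := h.label_eq ha
  have hTb := h.label_eq hb
  rw [hΛa] at hTa
  rw [hΛb] at hTb
  obtain ⟨ia, hua, hpa, xa, hxa, hfa⟩ := h.exists_process (h.mem_Γ ha) (by rw [hTa]; simp)
  obtain ⟨ib, hub, hpb, xb, hxb, hfb⟩ := h.exists_process (h.mem_Γ hb) (by rw [hTb]; simp)
  have hLa := h.label_eq hxa
  have hLb := h.label_eq hxb
  rw [hfa, hTa, Prod.mk.injEq] at hLa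
  rw [hfb, hTb, Prod.mk.injEq] at hLb
  have hacta : ((B ia).Λ xa).1 ≠ Action.eps := by rw [← hLa.1]; simp
  have hactb : ((B ib).Λ xb).1 ≠ Action.eps := by rw [← hLb.1]; simp
  have hab : ia ≠ ib := by
    rintro rfl
    have := hpa.active_unique hacta hactb
    subst this
    have := hLa.1.trans hLb.1.symm
    cases this
  have hzne : f k a ≠ f k b := by
    intro he
    rw [he, hTb] at hTa
    cases (Prod.ext_iff.1 hTa).1
  -- there are no other process productions
  have hcomm : ∀ i, u i = {.comm} → i = ia ∨ i = ib := by
    intro i hi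
    by_contra! hne
    have := Finset.sum_le_sum_of_subset (f := fun i => (u i).count .comm)
      (Finset.subset_univ {i, ia, ib})
    rw [hc, Finset.sum_insert (by simp [hne.1, hne.2]), Finset.sum_pair hab, hi, hua, hub] at this
    simp at this
  have hfus : ∀ i, u i ≠ {.fusion} := by
    intro i hi
    have := Finset.sum_eq_zero_iff.1 hf i (Finset.mem_univ i)
    simp [hi] at this
  -- the vectors exposed by the two edges determine the unifier
  obtain ⟨hg, hfresh⟩ := h.kernel_le
    (fun z => if z = f k a then ((B ia).Λ xa).2.map (f ia)
      else if z = f k b then ((B ib).Λ xb).2.map (f ib) else [])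
    (by
      intro i k' hp x hx hact
      rcases hcomm i (h.kind_of_active hp hx hact) with rfl | rfl
      · obtain rfl := hp.active_unique hact hacta
        rw [if_pos hfa]
      · obtain rfl := hp.active_unique hact hactb
        rw [if_neg (by rw [hfb]; exact hzne.symm), if_pos hfb])
  obtain ⟨D, -, hDG, hDΛ, hDf, hDv, hDG'⟩ := h.exists_data hg hfresh hpa
  obtain ⟨D', -, hDG₂, hDΛ₂, hDf₂, hDv₂, hDG₂'⟩ := h.exists_data hg hfresh hpb
  have hpre : D.pre = .inp (f k a) (ys.map (g k)) := by
    have := hDΛ xa hxa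
    rw [hfa, hTa] at this
    exact Prefix.eq_inp_of_label this
  have hpre' : D'.pre = .out (f k b) (zs.map (g k)) := by
    have := hDΛ₂ xb hxb
    rw [hfb, hTb] at this
    exact Prefix.eq_out_of_label this
  have haw : f k a ∈ w := h.active_mem (h.mem_Γ ha) (by rw [hTa]; simp)
  have hbw : f k b ∈ w := h.active_mem (h.mem_Γ hb) (by rw [hTb]; simp)
  -- there is no other active connector
  have haux : ∀ j, AuxProduction (B j) → j = k := by
    intro j hj
    obtain ⟨a', ha', -, -, ys', -, -, hΛa', -, -, ej, hGj, hae', -⟩ := hj.exists_pairs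
    have hTa' := h.label_eq ha'
    rw [hΛa'] at hTa'
    obtain ⟨i, hui, hpi, x, hx, hfx⟩ := h.exists_process (h.mem_Γ ha') (by rw [hTa']; simp)
    have hL := h.label_eq hx
    rw [hfx, hTa', Prod.mk.injEq] at hL
    have hact : ((B i).Λ x).1 ≠ Action.eps := by rw [← hL.1]; simp
    rcases hcomm i hui with rfl | rfl
    · obtain rfl := hpi.active_unique hact hacta
      exact (h.aux_unique hGk hGj hk hj hae hae' (hfa.symm.trans hfx) haw).symm
    · obtain rfl := hpi.active_unique hact hactb
      have := hL.1.trans hLb.1.symm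
      cases this
  -- the two nodes are attached to the same connector
  have hσ : σ (f k a) = σ (f k b) := by
    have hle : ({ek.map (f k)} : Graph Label N) ≤ translSubst w σ := by
      refine h.le_translSubst ?_ ?_
      · rw [h.decomp.source]
        have := Finset.single_le_sum (f := fun i => Graph.map (f i) (B i).G)
          (fun _ _ => Multiset.zero_le _) (Finset.mem_univ k)
        simpa [hGk, Graph.map] using this
      · intro e he
        rw [Multiset.mem_singleton] at he
        obtain ⟨n, hn⟩ := hk.label_edge (hGk ▸ Multiset.mem_singleton_self ek)
        exact ⟨n, by rw [he]; exact hn⟩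
    obtain ⟨-, y, hy, hn⟩ := mem_translSubst (Multiset.singleton_le.1 hle)
    have key : ∀ c ∈ ek.nodes, f k c ∈ w → σ (f k c) = σ y := by
      intro c hc hcw
      have : f k c ∈ (ek.map (f k)).nodes := List.mem_map_of_mem hc
      rw [hn, List.mem_cons] at this
      rcases this with h1 | h1
      · exact absurd hcw (h1 ▸ h.disj _ (h.σ_mem y hy))
      · simpa using (List.mem_filter.1 h1).2
    rw [key a hae haw, key b hbe hbw]
  -- splitting off the three productions
  have hka : k ≠ ia := by
    rintro rfl
    obtain ⟨n, hn⟩ := hk.label_edge (hGk ▸ Multiset.mem_singleton_self ek)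
    obtain ⟨n', S, hn'⟩ := label_process hpa (hGk ▸ Multiset.mem_singleton_self ek)
    rw [hn] at hn'
    cases hn'
  have hkb : k ≠ ib := by
    rintro rfl
    obtain ⟨n, hn⟩ := hk.label_edge (hGk ▸ Multiset.mem_singleton_self ek)
    obtain ⟨n', S, hn'⟩ := label_process hpb (hGk ▸ Multiset.mem_singleton_self ek)
    rw [hn] at hn'
    cases hn'
  have hsplit : ∀ F : ι → Graph Label N, ∑ i, F i = F ia + (F ib + (F k +
      ∑ i ∈ ((Finset.univ.erase ia).erase ib).erase k, F i)) := by
    intro F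
    rw [Finset.add_sum_erase _ F (by simp [hka, hkb]), Finset.add_sum_erase _ F (by simp [hab.symm]),
      Finset.add_sum_erase _ F (Finset.mem_univ _)]
  have hrest : ∑ i ∈ ((Finset.univ.erase ia).erase ib).erase k, Graph.map (g i) (B i).G' =
      ∑ i ∈ ((Finset.univ.erase ia).erase ib).erase k, Graph.map (f i) (B i).G := by
    refine Finset.sum_congr rfl fun i hi => h.map_idle hg ?_
    simp only [Finset.mem_erase, Finset.mem_univ, and_true] at hi
    obtain ⟨hik, hib, hia⟩ := hi
    rcases (h.basic i).cases_fusion with ⟨k', hk', hp⟩ | ⟨-, hp⟩ | ⟨hu, -⟩ | ⟨hu, -⟩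
    · cases k' with
      | comm => exact absurd (hcomm i hk') (by simp [hia, hib])
      | fusion => exact absurd hk' (hfus i)
      | aux => exact absurd rfl hp.kind_ne_aux
    · exact absurd (haux i hp) hik
    · exact hu
    · exact hu
  have hsrc := h.decomp.source
  have htgt := h.decomp.target
  rw [hsplit] at hsrc htgt
  rw [hrest, hDG', hDG₂', hG'k, Graph.map_add, map_pairs] at htgt
  have hgf : Graph.map (g k) (B k).G = Graph.map (f k) (B k).G :=
    Graph.map_congr fun x hx => hg k x ((h.basic k).names_source hx)
  rw [hgf] at htgt
  rw [hDG, hDG₂] at hsrc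
  have hle : ({D.edge} + {D'.edge} : Graph Label N) ≤ (es : Multiset (Edge Label N)) := by
    refine h.le_es ?_ ?_
    · rw [hsrc, ← add_assoc]
      exact Multiset.le_add_right _ _
    · intro e he
      rcases Multiset.mem_add.1 he with he | he <;> rw [Multiset.mem_singleton] at he <;>
        exact ⟨_, _, congrArg Edge.label he⟩
  obtain ⟨er, her⟩ := Multiset.le_iff_exists_add.1 hle
  induction er using Quotient.inductionOn with
  | h er =>
  change (es : Multiset (Edge Label N)) = {D.edge} + {D'.edge} + (er : Multiset (Edge Label N))
    at her
  have hperm : es.Perm (D.edge :: D'.edge :: er) := Multiset.coe_eq_coe.1 (by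
    rw [her]
    rfl)
  have htarget : T.G' = (er : Multiset (Edge Label N)) + translSubst w σ + closeAll v.toFinset +
      D.added + D'.added + pairs (ys.map (g k)) (zs.map (g k)) := by
    rw [h.source, her] at hsrc
    have h1 : (er : Multiset (Edge Label N)) + translSubst w σ + closeAll v.toFinset =
        Graph.map (f k) (B k).G +
          ∑ i ∈ ((Finset.univ.erase ia).erase ib).erase k, Graph.map (f i) (B i).G := by
      refine add_left_cancel (a := ({D.edge} + {D'.edge} : Graph Label N)) ?_
      rw [add_assoc ({D.edge} : Graph Label N) {D'.edge} (Graph.map _ _ + _), ← hsrc]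
      abel
    rw [htgt, h1]
    abel
  rw [htarget]
  refine reaction_comm hs D D' hpre hpre' (by simpa using hlen) hσ hperm hDv hDv₂ ?_
  intro z hz hz'
  obtain ⟨d, hd, hdΓ, rfl⟩ := hDf z hz
  obtain ⟨d', hd', -, he⟩ := hDf₂ _ hz'
  exact hab (Prod.ext_iff.1 ((hfresh ia _ hpa d hd hdΓ).2 ib d'
    (Finset.mem_union_right _ hd') he.symm)).1

/-- A fusion production implements a fusion. -/
theorem exists_red_of_fusion (h : IsRun u B f g T v w es σ) {P : Agent N Empty}
    {Ss : List (Agent N Empty)} (hs : IsSource P v w Ss es σ)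
    (hc : (∑ i, u i).count .comm = 0) (hf : (∑ i, u i).count .fusion = 1) :
    ∃ P', Red P P' ∧ ∃ v' w' Γ' H, Translates P' v' w' Γ' H ∧ Graph.names H ⊆ Γ' ∧
      Realizes H T.G' := by
  classical
  rw [Multiset.count_sum'] at hc hf
  have hcomm : ∀ i, u i ≠ {.comm} := by
    intro i hi
    have := Finset.sum_eq_zero_iff.1 hc i (Finset.mem_univ i)
    simp [hi] at this
  obtain ⟨i₀, hi₀⟩ : ∃ i, (u i).count .fusion ≠ 0 := by
    by_contra! h0
    simp [h0] at hf
  obtain ⟨hu₀, hp₀⟩ : u i₀ = {.fusion} ∧ ProcessProduction .fusion (B i₀) := by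
    rcases (h.basic i₀).cases_fusion with ⟨k, hk, hp⟩ | ⟨hk, -⟩ | ⟨hk, -⟩ | ⟨hk, -⟩
    · have : k = .fusion := by
        rw [hk, Multiset.count_singleton] at hi₀
        by_contra hne
        exact hi₀ (if_neg (Ne.symm hne))
      exact this ▸ ⟨hk, hp⟩
    all_goals simp [hk] at hi₀
  have hfus : ∀ i, u i = {.fusion} → i = i₀ := by
    intro i hi
    by_contra hne
    have := Finset.sum_le_sum_of_subset (f := fun i => (u i).count .fusion)
      (Finset.subset_univ {i, i₀})
    rw [hf, Finset.sum_pair hne, hi, hu₀] at this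
    simp at this
  -- without communication productions no connector is active
  have haux : ∀ j, ¬ AuxProduction (B j) := by
    intro j hj
    obtain ⟨a, ha, -, -, ys, -, -, hΛa, -⟩ := hj.exists_pairs
    have hTa := h.label_eq ha
    rw [hΛa] at hTa
    obtain ⟨i, hui, -⟩ := h.exists_process (h.mem_Γ ha) (by rw [hTa]; simp)
    exact hcomm i hui
  obtain ⟨hg, hfresh⟩ := h.kernel_le (fun _ => [])
    (fun i k hp x hx hact => absurd (h.kind_of_active hp hx hact) (hcomm i))
  obtain ⟨D, hDk, hDG, -, -, hDv, hDG'⟩ := h.exists_data hg hfresh hp₀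
  obtain ⟨φ, hφ⟩ : ∃ φ, D.pre = .fus φ := by
    cases hD : D.pre with
    | inp u xs => simp [hD, Prefix.kind] at hDk
    | out u xs => simp [hD, Prefix.kind] at hDk
    | fus φ => exact ⟨φ, rfl⟩
  have hrest : ∑ i ∈ Finset.univ.erase i₀, Graph.map (g i) (B i).G' =
      ∑ i ∈ Finset.univ.erase i₀, Graph.map (f i) (B i).G := by
    refine Finset.sum_congr rfl fun i hi => h.map_idle hg ?_
    rcases (h.basic i).cases_fusion with ⟨k', hk', hp⟩ | ⟨-, hp⟩ | ⟨hu, -⟩ | ⟨hu, -⟩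
    · cases k' with
      | comm => exact absurd hk' (hcomm i)
      | fusion => exact absurd (hfus i hk') (Finset.ne_of_mem_erase hi)
      | aux => exact absurd rfl hp.kind_ne_aux
    · exact absurd hp (haux i)
    · exact hu
    · exact hu
  have hsrc := h.decomp.source
  have htgt := h.decomp.target
  rw [← Finset.add_sum_erase _ _ (Finset.mem_univ i₀)] at hsrc htgt
  rw [hrest, hDG'] at htgt
  rw [hDG] at hsrc
  have hle : ({D.edge} : Graph Label N) ≤ (es : Multiset (Edge Label N)) := by
    refine h.le_es ?_ ?_
    · rw [hsrc]
      exact Multiset.le_add_right _ _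
    · intro e he
      rw [Multiset.mem_singleton] at he
      exact ⟨_, _, congrArg Edge.label he⟩
  obtain ⟨er, her⟩ := Multiset.le_iff_exists_add.1 hle
  induction er using Quotient.inductionOn with
  | h er =>
  change (es : Multiset (Edge Label N)) = {D.edge} + (er : Multiset (Edge Label N)) at her
  have hperm : es.Perm (D.edge :: er) := Multiset.coe_eq_coe.1 (by
    rw [her]
    rfl)
  have htarget : T.G' = (er : Multiset (Edge Label N)) + translSubst w σ + closeAll v.toFinset +
      D.added := by
    rw [h.source, her] at hsrc
    have h1 : (er : Multiset (Edge Label N)) + translSubst w σ + closeAll v.toFinset =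
        ∑ i ∈ Finset.univ.erase i₀, Graph.map (f i) (B i).G := by
      refine add_left_cancel (a := ({D.edge} : Graph Label N)) ?_
      rw [← hsrc]
      abel
    rw [htgt, h1]
    abel
  rw [htarget]
  exact reaction_fusion hs D hφ hperm hDv

end IsRun

theorem IsSource.isRun {P : Agent N Empty} {v w : List N} {Ss : List (Agent N Empty)}
    {es : List (Edge Label N)} {σ : N → N} (hs : IsSource P v w Ss es σ) {ι : Type} [Fintype ι]
    {u : ι → Multiset ProdKind} {B : ι → Transition Label Action N} {f g : ι → N → N}
    {T : Transition Label Action N} (hT : T.IsSHR)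
    (hB : ∀ i, Basic FusionProduction (u i) (B i)) (hd : IsDecomp B f g T)
    (hΓ : T.Γ = v.toFinset ∪ w.toFinset)
    (hG : T.G = (es : Multiset (Edge Label N)) + translSubst w σ + closeAll v.toFinset) :
    IsRun u B f g T v w es σ where
  shr := hT
  basic := hB
  decomp := hd
  source := hG
  nodes := hΓ
  es_label := fun _ he => label_of_mem_translSeqs hs.transl he
  es_nodup := fun _ he => nodup_of_mem_translSeqs hs.transl (hs.occ_eq ▸ hs.w_nodup) he
  es_names := fun z hz => by
    rw [← hs.occ_eq, ← mem_names_translSeqs hs.transl, Graph.mem_names] at hz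
    exact hz
  disj := hs.disj
  σ_mem := hs.σ_mem

end Completeness
end FusionSHR

theorem mainTheorem2 {N : Type} [DecidableEq N] [Infinite N]
    (P : FusionSHR.Agent N Empty) (closed : P.fn = ∅) (guarded : P.Guarded)
    (v w : List N) (T : FusionSHR.Transition FusionSHR.Label FusionSHR.Action N)
    (source : FusionSHR.Translates P v w T.Γ T.G)
    (U : Multiset FusionSHR.ProdKind)
    (derivation : FusionSHR.Derives FusionSHR.FusionProduction U T)
    (uses : (U.count FusionSHR.ProdKind.comm = 2 ∧ U.count FusionSHR.ProdKind.fusion = 0) ∨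
      (U.count FusionSHR.ProdKind.comm = 0 ∧ U.count FusionSHR.ProdKind.fusion = 1)) :
    ∃ P' : FusionSHR.Agent N Empty, FusionSHR.Red P P' ∧
      ∃ (v' w' : List N) (Γ' : Finset N) (H : FusionSHR.Graph FusionSHR.Label N),
        FusionSHR.Translates P' v' w' Γ' H ∧ FusionSHR.EqualUpTo T.Φ T.G' Γ' H := by
  have hT := derivation.isSHR
  obtain ⟨ι, _, u, B, f, g, hB, rfl, hd⟩ :=
    derivation.exists_isDecomp fun _ _ h => h.π_eq
  obtain ⟨Ss, es, σ, hs, hΓ, hG⟩ := FusionSHR.IsSource.of_translates closed source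
  have hrun := hs.isRun hT hB hd hΓ hG
  obtain ⟨P', hred, v', w', Γ', H, htr, hH, hR⟩ : ∃ P', FusionSHR.Red P P' ∧ ∃ v' w' Γ' H,
      FusionSHR.Translates P' v' w' Γ' H ∧ FusionSHR.Graph.names H ⊆ Γ' ∧
        FusionSHR.Realizes H T.G' := by
    rcases uses with ⟨hc, hf⟩ | ⟨hc, hf⟩
    · exact hrun.exists_red_of_comm hs hc hf
    · exact hrun.exists_red_of_fusion hs hc hf
  exact ⟨P', hred, v', w', Γ', H, htr, hT.target_wf, hH, id, Function.injective_id, by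
    rwa [FusionSHR.Graph.map_id]⟩
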